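/- Let $G$ be a finite connected graph (loops and multiple edges allowed) that remains connected after the removal of any one edge, and fix an orientation of $G$. Let $\mathcal F(G)\subset\mathbb Z^{E(G)}$ be its lattice of integer flows, with the inner product $(\cdot,\cdot)$ induced by the Euclidean one, let $r$ be its rank, and let $A$ be the Gram matrix of $\mathcal F(G)$ in some lattice basis. Let $V(G)$ be the Voronoi cell of $\mathcal F(G)$ in $\mathcal F(G)\otimes\mathbb R$, that is, the set of points at least as close to $0$ as to every other lattice point. For a lattice vector $v$ let $F_v=\{x\in V(G): (x,v)=(v,v)/2\}$. The circuit element of an oriented circuit is the signed sum of its edges. The graphic matroid $\mathcal M(G)$ is given by the ground set $E(G)$ and the family of (edge sets of) circuits of $G$, equivalently by the $(0,1)$-matrix with rows indexed by circuits and columns by edges that records which edge participates in which circuit. A 2-cut is a pair of distinct edges whose removal disconnects $G$; the 2-cut blocks are the classes of the equivalence relation "$e=f$ or $\{e,f\}$ is a 2-cut" on $E(G)$. Then $\mathcal M(G)$ can be computed from $\mathcal F(G)$: there is a partial recursive function, independent of $G$, which is defined at every such Gram matrix $A$ and whose value there is the $(0,1)$-matrix of $\mathcal M(G)$ (for some ordering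 of rows and columns). Moreover, $\mathcal M(G)$ is obtained from $A$ by the following explicit procedure. 1. $V(G)$ has finitely many facets (faces of codimension one). Each facet equals $F_v$ for exactly one lattice vector $v$, and $F_v$ is a facet if and only if $v$ is a circuit element. Call a lattice basis $C_1,\dots,C_r$ good if every $F_{C_i}$ is a facet and, for all $i\ne j$, $F_{C_i}$ meets $F_{C_j}$ or $F_{-C_j}$. Good bases exist, and every good basis is a cancellation-free circuit basis: its members are circuit elements, and the number of common edges of the circuits $C_i$ and $C_j$ is $|(C_i,C_j)|$ for all $i,j$. 2. $V(G)$ has finitely many edges $\epsilon$ (one-dimensional faces). Let $[\epsilon]$ denote their parallel classes, and write $[\epsilon]\in F$ if some edge in the class $[\epsilon]$ is contained in the facet $F$, and $[\epsilon]\notin F$ otherwise. There is a bijection $[\epsilon]\mapsto S_{[\epsilon]}$ from the parallel classes onto the 2-cut blocks of $G$, with the following properties for every good basis $C_1,\dots,C_r$. 3. The system of linear equations $$\sum_{[\epsilon]\notin F_{C_i}} n_{[\epsilon]}=(C_i,C_i)\quad(1\le i\le r),\qquad \sum_{[\epsilon]\notin F_{C_i},\,[\epsilon]\notin F_{C_j}}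 n_{[\epsilon]}=|(C_i,C_j)|\quad(i\ne j)$$ has a unique solution $\{n_{[\epsilon]}\}$ in positive integers. 4. This solution is $n_{[\epsilon]}=|S_{[\epsilon]}|$, and $E(G)$ is the disjoint union of the sets $S_{[\epsilon]}$. So $E(G)$ can be identified with the disjoint union of sets of sizes $n_{[\epsilon]}$, one for each parallel class, in such a way that $S_{[\epsilon]}$ corresponds to the set of $[\epsilon]$. 5. Under this identification, an edge $e\in S_{[\epsilon]}$ belongs to the circuit with circuit element $C$ if and only if $[\epsilon]\notin F_C$. The circuits of $G$ are exactly the sets $\bigcup_{[\epsilon]\notin F}S_{[\epsilon]}$, where $F$ runs over the facets of $V(G)$. -/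

import Mathlib

open scoped Graph Matrix

namespace FlowRecon

section Graphs

variable {α β : Type*}

/-! ### Multigraphs: connectedness, 2-cuts, circuits

Graphs are Mathlib's multigraphs `Graph α β` (loops and parallel edges allowed). -/

/-- A graph is connected if it has a vertex and any two vertices are joined by a walk. -/
def Connected (G : Graph α β) : Prop :=
  V(G).Nonempty ∧ ∀ x ∈ V(G), ∀ y ∈ V(G), Relation.ReflTransGen G.Adj x y

/-- A connected graph that remains connected after the removal of any one edge. -/
def TwoEdgeConnected (G : Graph α β) : Prop :=
  Connected G ∧ ∀ e ∈ E(G), Connected (G.deleteEdges {e})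

/-- Two distinct edges form a 2-cut if the graph is disconnected by the removal of both. -/
def IsTwoCut (G : Graph α β) (e f : E(G)) : Prop :=
  e ≠ f ∧ ¬ Connected (G.deleteEdges {e.1, f.1})

/-- The 2-cut blocks: the classes of the equivalence relation
"`e` and `f` are the same or form a 2-cut". -/
def IsTwoCutBlock (G : Graph α β) (B : Set E(G)) : Prop :=
  ∃ e, B = {f | e = f ∨ IsTwoCut G e f}

/-- The closed walk `v 0, e 0, v 1, e 1, …, v k, e k, v 0` (indices modulo `k + 1`)
is a walk of `G` and repeats no vertex and no edge. -/
def IsSimpleClosedWalk (G : Graph α β) (k : ℕ) (v : Fin (k + 1) → α)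
    (e : Fin (k + 1) → E(G)) : Prop :=
  v.Injective ∧ e.Injective ∧ ∀ i, G.IsLink (e i).1 (v i) (v (i + 1))

/-- The (unoriented) circuits of `G`, as edge sets. The graphic matroid of `G` is given by
the ground set `E(G)` and this family of circuits. -/
def IsCircuit (G : Graph α β) (C : Set E(G)) : Prop :=
  ∃ k v e, IsSimpleClosedWalk G k v e ∧ C = Set.range e

open Classical in
/-- The rows of `X` form the `(0,1)`-matrix of the graphic matroid of `G`: for suitable
enumerations of the edges and of the circuits of `G`, the columns are indexed by the edges and
the rows by the circuits, with an entry `1` exactly when the edge participates in the circuit. -/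
def IsMatroidMatrix (G : Graph α β) (X : List (List Bool)) : Prop :=
  ∃ (m : ℕ) (edge : Fin m ≃ E(G)) (circuit : Fin X.length ≃ {C : Set E(G) // IsCircuit G C}),
    ∀ i, X.get i = List.ofFn fun j => decide (edge j ∈ (circuit i).1)

/-! ### Orientations and the lattice of integer flows -/

/-- An orientation of `G`: a direction for each edge. -/
structure Orientation (G : Graph α β) where
  /-- The vertex at which the edge starts. -/
  tail : E(G) → α
  /-- The vertex at which the edge ends. -/
  head : E(G) → α
  isLink : ∀ e : E(G), G.IsLink e.1 (tail e) (head e)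

variable {G : Graph α β} [Fintype E(G)]

open Classical in
/-- The lattice of integer flows: at each vertex the incoming and the outgoing sums agree. -/
noncomputable def flowLattice (o : Orientation G) : Submodule ℤ (E(G) → ℤ) where
  carrier := {a | ∀ x ∈ V(G), ∑ e with o.head e = x, a e - ∑ e with o.tail e = x, a e = 0}
  zero_mem' := by intro x _; simp
  add_mem' := by
    intro a b ha hb x hx
    have h1 := ha x hx
    have h2 := hb x hx
    simp only [Pi.add_apply, Finset.sum_add_distrib]
    linarith
  smul_mem' := by
    intro c a ha x hx
    have h1 := ha x hx
    simp only [Pi.smul_apply, smul_eq_mul, ← Finset.mul_sum, ← mul_sub]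
    rw [h1, mul_zero]

/-- The inner product induced by the Euclidean one on `ℤ^E(G)`. -/
def pairing (a b : E(G) → ℤ) : ℤ := ∑ e, a e * b e

open Classical in
/-- Circuit elements: the signed edge sums of oriented circuits, with coefficient `1` on the
edges traversed from tail to head and `-1` on those traversed backwards. -/
def IsCircuitElement (o : Orientation G) (a : E(G) → ℤ) : Prop :=
  ∃ k v e, IsSimpleClosedWalk G k v e ∧ ∃ s : Fin (k + 1) → ℤ,
    (∀ i, (s i = 1 ∧ o.tail (e i) = v i ∧ o.head (e i) = v (i + 1)) ∨
      (s i = -1 ∧ o.head (e i) = v i ∧ o.tail (e i) = v (i + 1))) ∧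
    a = ∑ i, Pi.single (e i) (s i)

/-- The edges used by a flow. -/
def edgeSupport (a : E(G) → ℤ) : Set E(G) := {e | a e ≠ 0}

/-- The flow with coordinates `v` in the basis `b`. -/
noncomputable def flowOf {o : Orientation G} {r : ℕ} (b : Module.Basis (Fin r) ℤ (flowLattice o))
    (v : Fin r → ℤ) : E(G) → ℤ :=
  ((∑ i, v i • b i : flowLattice o) : E(G) → ℤ)

/-- The Gram matrix of the lattice of integer flows in the basis `b`. -/
noncomputable def gramMatrix {o : Orientation G} {r : ℕ}
    (b : Module.Basis (Fin r) ℤ (flowLattice o)) : Matrix (Fin r) (Fin r) ℤ :=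
  fun i j => pairing (b i : E(G) → ℤ) (b j : E(G) → ℤ)

/-- A family of circuit elements in which the number of common edges of any two members is the
absolute value of their pairing. -/
def IsCancellationFree {r : ℕ} (o : Orientation G) (C : Fin r → (E(G) → ℤ)) : Prop :=
  (∀ i, IsCircuitElement o (C i)) ∧
    ∀ i j, ((edgeSupport (C i) ∩ edgeSupport (C j)).ncard : ℤ) = |pairing (C i) (C j)|

end Graphs

/-! ### The procedure

Everything below depends only on an integer matrix `A`, the Gram matrix of a lattice. The
lattice is `Fin r → ℤ` and the ambient space is `Fin r → ℝ`, both with the form given by `A`. -/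

section Procedure

variable {r : ℕ}

/-- The inner product of lattice vectors. -/
def latticeForm (A : Matrix (Fin r) (Fin r) ℤ) (u w : Fin r → ℤ) : ℤ := u ⬝ᵥ (A *ᵥ w)

/-- The inner product on the real span of the lattice. -/
def realForm (A : Matrix (Fin r) (Fin r) ℤ) (x y : Fin r → ℝ) : ℝ :=
  x ⬝ᵥ (A.map (fun a : ℤ => (a : ℝ)) *ᵥ y)

/-- A lattice vector as a point of the real span. -/
def toReal (v : Fin r → ℤ) : Fin r → ℝ := fun i => (v i : ℝ)

/-- The Voronoi cell: the points at least as close to the origin as to any lattice point. -/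
def voronoiCell (A : Matrix (Fin r) (Fin r) ℤ) : Set (Fin r → ℝ) :=
  {x | ∀ v : Fin r → ℤ, realForm A x x ≤ realForm A (x - toReal v) (x - toReal v)}

/-- The nonempty faces of the Voronoi cell (the cell itself included). -/
def IsFace (A : Matrix (Fin r) (Fin r) ℤ) (F : Set (Fin r → ℝ)) : Prop :=
  F.Nonempty ∧ IsExposed ℝ (voronoiCell A) F

/-- The faces of codimension one. -/
def IsFacet (A : Matrix (Fin r) (Fin r) ℤ) (F : Set (Fin r → ℝ)) : Prop :=
  IsFace A F ∧ Module.finrank ℝ (vectorSpan ℝ F) + 1 = r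

/-- The edges of the Voronoi cell: its faces of dimension one. -/
def VoronoiEdge (A : Matrix (Fin r) (Fin r) ℤ) : Type :=
  {F : Set (Fin r → ℝ) // IsFace A F ∧ Module.finrank ℝ (vectorSpan ℝ F) = 1}

/-- Parallelism of edges of the Voronoi cell. -/
def parallel (A : Matrix (Fin r) (Fin r) ℤ) : Setoid (VoronoiEdge A) where
  r ε ε' := vectorSpan ℝ ε.1 = vectorSpan ℝ ε'.1
  iseqv := ⟨fun _ => rfl, fun h => h.symm, fun h h' => h.trans h'⟩

/-- The parallel classes of edges of the Voronoi cell. -/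
def EdgeClass (A : Matrix (Fin r) (Fin r) ℤ) : Type := Quotient (parallel A)

/-- Some edge of the parallel class `c` belongs to the face `F`. -/
def Participates {A : Matrix (Fin r) (Fin r) ℤ} (c : EdgeClass A) (F : Set (Fin r → ℝ)) : Prop :=
  ∃ ε : VoronoiEdge A, Quotient.mk (parallel A) ε = c ∧ ε.1 ⊆ F

/-- The part of the Voronoi cell on the perpendicular bisector of the lattice vector `v`. -/
def bisectorFace (A : Matrix (Fin r) (Fin r) ℤ) (v : Fin r → ℤ) : Set (Fin r → ℝ) :=
  {x ∈ voronoiCell A | realForm A x (toReal v) = realForm A (toReal v) (toReal v) / 2}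

/-- A good basis, read off from the facets: a lattice basis of vectors whose perpendicular
bisectors support facets, such that for any two of them, `C i` and `C j`, the facet of `C i`
meets the facet of `C j` or the facet of `-C j`. -/
structure IsGoodBasis (A : Matrix (Fin r) (Fin r) ℤ) (C : Fin r → (Fin r → ℤ)) : Prop where
  linearIndependent : LinearIndependent ℤ C
  span_eq_top : Submodule.span ℤ (Set.range C) = ⊤
  isFacet : ∀ i, IsFacet A (bisectorFace A (C i))
  meets : ∀ i j, i ≠ j →
    (bisectorFace A (C i) ∩ bisectorFace A (C j)).Nonempty ∨
      (bisectorFace A (C i) ∩ bisectorFace A (-C j)).Nonempty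

/-- The positive integer solutions of the linear system of the basis `C`, with one unknown for
each parallel class of edges and one equation for each basis vector and each pair of them. -/
structure IsSolution (A : Matrix (Fin r) (Fin r) ℤ) (C : Fin r → (Fin r → ℤ))
    (n : EdgeClass A → ℕ) : Prop where
  pos : ∀ c, 0 < n c
  length : ∀ i, ((∑ᶠ c ∈ {c : EdgeClass A | ¬ Participates c (bisectorFace A (C i))}, n c : ℕ) : ℤ)
    = latticeForm A (C i) (C i)
  intersect : ∀ i j, i ≠ j →
    ((∑ᶠ c ∈ {c : EdgeClass A | ¬ Participates c (bisectorFace A (C i)) ∧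
        ¬ Participates c (bisectorFace A (C j))}, n c : ℕ) : ℤ)
      = |latticeForm A (C i) (C j)|

/-- The ground set put out by the procedure: a disjoint union of sets of sizes `n c`. -/
abbrev GroundSet (A : Matrix (Fin r) (Fin r) ℤ) (n : EdgeClass A → ℕ) : Type :=
  Σ c : EdgeClass A, Fin (n c)

/-- The circuits put out by the procedure: for each facet, the elements whose parallel class
does not participate in it. -/
def IsOutputCircuit (A : Matrix (Fin r) (Fin r) ℤ) (n : EdgeClass A → ℕ)
    (X : Set (GroundSet A n)) : Prop :=
  ∃ F, IsFacet A F ∧ X = {p | ¬ Participates p.1 F}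

end Procedure

end FlowRecon

open FlowRecon

/-! Let `B = flowMatrix b` have the basis flows as rows. Then the Gram matrix is `B * Bᵀ`, and
`coord B z` is the real flow with coordinates `z`. The key property is `IsRegular`: a nonzero real
flow, followed in its own direction, closes up to a simple circuit with the signs of the flow
(`exists_conformal_walk`), so every real flow is a sign-consistent positive combination of lattice
vectors with entries in {-1, 0, 1} (`IsRegular.induction`).

For such sign vectors `(u, u)` is the l¹-norm, so the decomposition gives `(x, z) ≤ ‖z‖₁ / 2` on the
Voronoi cell (`IsRegular.form_le`), and projecting points of the cube `[-1/2, 1/2]^E` shows that the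
bound is attained. Hence the face exposed by `z` depends only on the sign pattern of the flow, and
its directions are orthogonal to exactly the flows supported in the support of `z`
(`IsRegular.orthogonal_vectorSpan`). Facets come from flows of minimal support, the circuits. Edges
come from flows vanishing on exactly one class of proportional coordinates, and these classes are
the 2-cut blocks (`parallelCoords_iff`). A class has an edge in the facet of `v` iff `v` vanishes on
the class (`IsRegular.participates_iff`).

Facets of `u` and `v` meet iff `u` and `v` nowhere have opposite signs. So for a good basis `|(C i,
C j)|` counts common edges, and the block sizes solve the system. The difference `d` of two
solutions gives a bilinear form `∑ d c * u c * v c` that vanishes on the basis, hence everywhere. On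
sign vectors this reads `∑ d c * |u c| = 0`, which extends to all real flows by conformal
decomposition. Absolute values of pairwise nonproportional functionals are linearly independent
(`sum_parallel_eq_zero`), so `d = 0`.

Computability is proved by a search, not by running the procedure. A certificate contains some
directed multigraph whose flow matrix is regular with the given Gram matrix. Equal Gram matrices
give equal l¹-norms, so by the same independence the columns agree up to order and sign
(`IsRegular.exists_equiv_of_gram_eq`). Every valid certificate therefore has the circuits of `G`,
and `G` itself supplies one, so the search halts. -/

namespace FlowRecon

/-! ### Regular lattices and the support function of the Voronoi cell -/

section Regular

variable {E : Type*} {r : ℕ}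

/-- The coordinates of a real combination of the rows of `B`. -/
noncomputable def coord (B : Matrix (Fin r) E ℤ) : (Fin r → ℝ) →ₗ[ℝ] (E → ℝ) :=
  Matrix.vecMulLinear (B.map (Int.cast : ℤ → ℝ))

/-- The rows of `B` span a regular lattice without zero coordinates: every nonzero vector of the
real span dominates a nonzero lattice vector with entries in `{-1, 0, 1}`. -/
structure IsRegular (B : Matrix (Fin r) E ℤ) : Prop where
  inj : ∀ z, coord B z = 0 → z = 0
  conformal : ∀ z, z ≠ 0 → ∃ u : Fin r → ℤ, u ≠ 0 ∧ (∀ e, |(u ᵥ* B) e| ≤ 1) ∧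
    ∀ e, (u ᵥ* B) e ≠ 0 → 0 < ((u ᵥ* B) e : ℝ) * coord B z e
  col_ne : ∀ e, ∃ z, coord B z e ≠ 0

variable {B : Matrix (Fin r) E ℤ}

lemma coord_apply (z : Fin r → ℝ) (e : E) : coord B z e = ∑ i, z i * (B i e : ℝ) := rfl

lemma coord_toReal (v : Fin r → ℤ) (e : E) : coord B (toReal v) e = ((v ᵥ* B) e : ℝ) := by
  simp [coord_apply, toReal, Matrix.vecMul, dotProduct]

lemma toReal_injective : Function.Injective (toReal : (Fin r → ℤ) → (Fin r → ℝ)) := by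
  intro u v h
  ext i
  have := congrFun h i
  simpa [toReal] using this

@[simp] lemma toReal_zero : toReal (0 : Fin r → ℤ) = 0 := by ext; simp [toReal]

lemma toReal_sub (u v : Fin r → ℤ) : toReal (u - v) = toReal u - toReal v := by
  ext; simp [toReal]

variable [Fintype E]

lemma realForm_gram (x y : Fin r → ℝ) :
    realForm (B * Bᵀ) x y = ∑ e, coord B x e * coord B y e := by
  have h : (B * Bᵀ).map (fun a : ℤ => (a : ℝ)) =
      B.map (Int.cast : ℤ → ℝ) * (B.map (Int.cast : ℤ → ℝ))ᵀ := by
    ext i j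
    simp [Matrix.mul_apply]
  rw [realForm, h, ← Matrix.mulVec_mulVec, Matrix.dotProduct_mulVec, Matrix.mulVec_transpose]
  rfl

lemma latticeForm_gram (u w : Fin r → ℤ) :
    latticeForm (B * Bᵀ) u w = ∑ e, (u ᵥ* B) e * (w ᵥ* B) e := by
  rw [latticeForm, ← Matrix.mulVec_mulVec, Matrix.dotProduct_mulVec, Matrix.mulVec_transpose]
  rfl

/-- The inner product as a bilinear form. -/
noncomputable def gramForm (B : Matrix (Fin r) E ℤ) : LinearMap.BilinForm ℝ (Fin r → ℝ) :=
  Matrix.toBilin' ((B * Bᵀ).map (fun a : ℤ => (a : ℝ)))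

lemma gramForm_eq (x y : Fin r → ℝ) : gramForm B x y = realForm (B * Bᵀ) x y := by
  rw [gramForm, Matrix.toBilin'_apply']; rfl

lemma gramForm_apply (x y : Fin r → ℝ) :
    gramForm B x y = ∑ e, coord B x e * coord B y e := by
  rw [gramForm_eq, realForm_gram]

lemma gramForm_comm (x y : Fin r → ℝ) : gramForm B x y = gramForm B y x := by
  simp only [gramForm_apply, mul_comm]

lemma IsRegular.eq_zero_of_form (h : IsRegular B) {z : Fin r → ℝ} (hz : gramForm B z z = 0) :
    z = 0 := by
  apply h.inj
  rw [gramForm_apply, Finset.sum_eq_zero_iff_of_nonneg fun e _ => mul_self_nonneg _] at hz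
  ext e
  simpa using hz e (Finset.mem_univ e)

lemma IsRegular.nondegenerate (h : IsRegular B) : (gramForm B).Nondegenerate := by
  constructor
  · intro x hx
    exact h.eq_zero_of_form (hx x)
  · intro x hx
    exact h.eq_zero_of_form (hx x)

lemma IsRegular.exists_form_eq (h : IsRegular B) (φ : (Fin r → ℝ) →ₗ[ℝ] ℝ) :
    ∃ x, ∀ y, gramForm B x y = φ y :=
  ⟨((gramForm B).toDual h.nondegenerate).symm φ, fun _ =>
    LinearMap.BilinForm.apply_toDual_symm_apply _ _⟩

/-- The sum of the absolute values of the coordinates. -/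
noncomputable def normOne (B : Matrix (Fin r) E ℤ) (z : Fin r → ℝ) : ℝ := ∑ e, |coord B z e|

/-- A lattice vector with coordinates in `{-1, 0, 1}`. -/
def IsSignVector (B : Matrix (Fin r) E ℤ) (u : Fin r → ℤ) : Prop := ∀ e, |(u ᵥ* B) e| ≤ 1

lemma mul_self_eq_abs_of_abs_le_one {a : ℤ} (h : |a| ≤ 1) : a * a = |a| := by
  have := abs_le.mp h
  obtain h | h | h : a = -1 ∨ a = 0 ∨ a = 1 := by omega
  all_goals subst h; simp

lemma IsSignVector.form_self {u : Fin r → ℤ} (hu : IsSignVector B u) :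
    gramForm B (toReal u) (toReal u) = normOne B (toReal u) := by
  rw [gramForm_apply, normOne]
  refine Finset.sum_congr rfl fun e _ => ?_
  rw [coord_toReal]
  exact_mod_cast mul_self_eq_abs_of_abs_le_one (hu e)

/-- Integers satisfy `|a| ≤ a * a`. This is what puts the projected cube inside the Voronoi cell. -/
lemma normOne_le_form_self (v : Fin r → ℤ) :
    normOne B (toReal v) ≤ gramForm B (toReal v) (toReal v) := by
  rw [gramForm_apply, normOne]
  refine Finset.sum_le_sum fun e _ => ?_
  rw [coord_toReal]
  have : |(v ᵥ* B) e| ≤ (v ᵥ* B) e * (v ᵥ* B) e := by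
    rw [← abs_mul_abs_self]
    have := abs_nonneg ((v ᵥ* B) e)
    nlinarith
  exact_mod_cast this

/-- Peeling off sign vectors conformally: an induction principle for the real span. -/
theorem IsRegular.induction (h : IsRegular B) {P : (Fin r → ℝ) → Prop} (h0 : P 0)
    (hadd : ∀ (u : Fin r → ℤ) (t : ℝ) (z : Fin r → ℝ), IsSignVector B u → 0 < t →
      (∀ e, |coord B (z + t • toReal u) e| = |coord B z e| + t * |coord B (toReal u) e|) →
      P z → P (z + t • toReal u)) (z : Fin r → ℝ) : P z := by
  classical
  induction hn : (Finset.univ.filter fun e => coord B z e ≠ 0).card using Nat.strong_induction_on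
    generalizing z with
  | _ n ih =>
    by_cases hz : z = 0
    · rwa [hz]
    obtain ⟨u, hu0, hus, huz⟩ := h.conformal z hz
    have hne : (Finset.univ.filter fun e => (u ᵥ* B) e ≠ 0).Nonempty := by
      by_contra hcon
      rw [Finset.not_nonempty_iff_eq_empty, Finset.filter_eq_empty_iff] at hcon
      apply hu0
      apply toReal_injective
      rw [toReal_zero]
      apply h.inj
      ext e
      rw [coord_toReal]
      simpa using hcon (Finset.mem_univ e)
    -- The smallest `|z e|` on the support of `u` is the largest multiple of `u` that can be removed
    -- without a change of sign. Removing it kills the coordinate `e₀`, so the support shrinks.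
    obtain ⟨e₀, he₀, hmin⟩ := Finset.exists_min_image _ (fun e => |coord B z e|) hne
    simp only [Finset.mem_filter, Finset.mem_univ, true_and] at he₀ hmin
    set t := |coord B z e₀| with ht
    have hz0 : coord B z e₀ ≠ 0 := by
      intro h0
      have := huz e₀ he₀
      rw [h0, mul_zero] at this
      exact lt_irrefl _ this
    have htpos : 0 < t := abs_pos.mpr hz0
    have key : ∀ e, |coord B z e| = |coord B (z - t • toReal u) e| + t * |coord B (toReal u) e| ∧
        (coord B z e = 0 → coord B (z - t • toReal u) e = 0) ∧
        (e = e₀ → coord B (z - t • toReal u) e = 0) := by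
      intro e
      simp only [map_sub, map_smul, Pi.sub_apply, Pi.smul_apply, smul_eq_mul, coord_toReal]
      by_cases hue : (u ᵥ* B) e = 0
      · refine ⟨by simp [hue], by simp [hue], fun h => absurd (h ▸ hue) he₀⟩
      · have h1 := huz e hue
        have h2 := hmin e hue
        have h3 := abs_le.mp (hus e)
        obtain h4 | h4 : (u ᵥ* B) e = -1 ∨ (u ᵥ* B) e = 1 := by omega
        · rw [h4] at h1 ⊢
          push_cast at h1 ⊢
          have h5 : coord B z e < 0 := by linarith
          rw [abs_of_neg h5] at h2 ⊢
          refine ⟨?_, fun h => absurd h h5.ne, ?_⟩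
          · rw [abs_of_nonpos (by linarith)]; simp
          · rintro rfl
            rw [ht, abs_of_neg h5]; ring
        · rw [h4] at h1 ⊢
          push_cast at h1 ⊢
          have h5 : 0 < coord B z e := by linarith
          rw [abs_of_pos h5] at h2 ⊢
          refine ⟨?_, fun h => absurd h h5.ne', ?_⟩
          · rw [abs_of_nonneg (by linarith)]; simp
          · rintro rfl
            rw [ht, abs_of_pos h5]; ring
    have hP : P (z - t • toReal u) := by
      refine ih _ ?_ _ rfl
      rw [← hn]
      apply Finset.card_lt_card
      refine ⟨fun e he => ?_, fun hcon => ?_⟩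
      · simp only [Finset.mem_filter, Finset.mem_univ, true_and] at he ⊢
        exact fun h => he ((key e).2.1 h)
      · have := hcon (show e₀ ∈ _ by simpa using hz0)
        simp only [Finset.mem_filter, Finset.mem_univ, true_and] at this
        exact this ((key e₀).2.2 rfl)
    have := hadd u t (z - t • toReal u) hus htpos (fun e => by
      rw [sub_add_cancel]; exact (key e).1) hP
    rwa [sub_add_cancel] at this

lemma mem_voronoiCell_iff (x : Fin r → ℝ) : x ∈ voronoiCell (B * Bᵀ) ↔
    ∀ v : Fin r → ℤ, gramForm B x (toReal v) ≤ gramForm B (toReal v) (toReal v) / 2 := by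
  refine forall_congr' fun v => ?_
  simp only [← gramForm_eq, map_sub, LinearMap.sub_apply]
  rw [gramForm_comm (toReal v) x]
  constructor <;> intro h <;> linarith

lemma normOne_add_of_abs {z w : Fin r → ℝ} {t : ℝ}
    (h : ∀ e, |coord B (z + t • w) e| = |coord B z e| + t * |coord B w e|) :
    normOne B (z + t • w) = normOne B z + t * normOne B w := by
  simp only [normOne, h, Finset.sum_add_distrib, Finset.mul_sum]

/-- The support function of the Voronoi cell is half the sum of the absolute coordinates. -/
theorem IsRegular.form_le (h : IsRegular B) {x : Fin r → ℝ} (hx : x ∈ voronoiCell (B * Bᵀ))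
    (z : Fin r → ℝ) : gramForm B x z ≤ normOne B z / 2 := by
  induction z using h.induction with
  | h0 => simp [normOne]
  | hadd u t z hu ht habs ih =>
    rw [normOne_add_of_abs habs, map_add, map_smul, smul_eq_mul]
    have h1 := (mem_voronoiCell_iff x).mp hx u
    rw [hu.form_self] at h1
    nlinarith [mul_le_mul_of_nonneg_left h1 ht.le]

/-- The projection of a point of the cube `[-1/2, 1/2]^E` lies in the Voronoi cell. -/
lemma IsRegular.exists_mem_voronoiCell (h : IsRegular B) {t : E → ℝ} (ht : ∀ e, |t e| ≤ 1 / 2) :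
    ∃ x ∈ voronoiCell (B * Bᵀ), ∀ y, gramForm B x y = ∑ e, t e * coord B y e := by
  obtain ⟨x, hx⟩ := h.exists_form_eq (∑ e, t e • (LinearMap.proj e).comp (coord B))
  replace hx : ∀ y, gramForm B x y = ∑ e, t e * coord B y e := by
    intro y; rw [hx]; simp [LinearMap.sum_apply]
  refine ⟨x, ?_, hx⟩
  rw [mem_voronoiCell_iff]
  intro v
  rw [hx]
  calc ∑ e, t e * coord B (toReal v) e ≤ ∑ e, |coord B (toReal v) e| / 2 := by
        refine Finset.sum_le_sum fun e _ => (le_abs_self _).trans ?_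
        rw [abs_mul]
        nlinarith [ht e, abs_nonneg (coord B (toReal v) e)]
    _ = normOne B (toReal v) / 2 := by rw [normOne, Finset.sum_div]
    _ ≤ _ := by linarith [normOne_le_form_self (B := B) v]

/-- The vector representing the coordinate functional of `e`. -/
noncomputable def IsRegular.edgeVec (h : IsRegular B) (e : E) : Fin r → ℝ :=
  (h.exists_form_eq ((LinearMap.proj e).comp (coord B))).choose

lemma IsRegular.form_edgeVec (h : IsRegular B) (e : E) (y : Fin r → ℝ) :
    gramForm B (h.edgeVec e) y = coord B y e :=
  (h.exists_form_eq ((LinearMap.proj e).comp (coord B))).choose_spec y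

lemma IsRegular.ext_form (h : IsRegular B) {x x' : Fin r → ℝ}
    (hx : ∀ y, gramForm B x y = gramForm B x' y) : x = x' := by
  rw [← sub_eq_zero]
  apply h.eq_zero_of_form
  have := hx (x - x')
  rwa [← sub_eq_zero, ← LinearMap.sub_apply, ← map_sub] at this

/-- The face of the Voronoi cell in the direction `z`. -/
def dirFace (B : Matrix (Fin r) E ℤ) (z : Fin r → ℝ) : Set (Fin r → ℝ) :=
  {x ∈ voronoiCell (B * Bᵀ) | gramForm B x z = normOne B z / 2}

/-- Equality case of the support bound: `t e` must be `±1/2` with the sign of `z` where `z` is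
nonzero, and is free where `z` vanishes. That freedom later produces the directions of the face. -/
lemma IsRegular.exists_mem_dirFace (h : IsRegular B) {z : Fin r → ℝ} {t : E → ℝ}
    (ht : ∀ e, |t e| ≤ 1 / 2) (htz : ∀ e, t e * coord B z e = |coord B z e| / 2) :
    ∃ x ∈ dirFace B z, ∀ y, gramForm B x y = ∑ e, t e * coord B y e := by
  obtain ⟨x, hx, hxy⟩ := h.exists_mem_voronoiCell ht
  refine ⟨x, ⟨hx, ?_⟩, hxy⟩
  rw [hxy, normOne, Finset.sum_div]
  exact Finset.sum_congr rfl fun e _ => htz e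

lemma abs_half_sign_le (a : ℝ) : |(SignType.sign a : ℝ) / 2| ≤ 1 / 2 := by
  rcases lt_trichotomy a 0 with h | h | h <;> simp [h, abs_div]

lemma half_sign_mul (a : ℝ) : (SignType.sign a : ℝ) / 2 * a = |a| / 2 := by
  rw [div_mul_eq_mul_div, sign_mul_self]

lemma IsRegular.dirFace_nonempty (h : IsRegular B) (z : Fin r → ℝ) : (dirFace B z).Nonempty := by
  obtain ⟨x, hx, -⟩ := h.exists_mem_dirFace (z := z) (fun e => abs_half_sign_le (coord B z e))
    fun e => half_sign_mul _
  exact ⟨x, hx⟩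

/-- Every functional is represented by the form, and the maximum of `(·, z)` on the cell is `normOne
B z / 2`. The direction `z = 0` yields the whole cell. -/
theorem IsRegular.isFace_iff (h : IsRegular B) (F : Set (Fin r → ℝ)) :
    IsFace (B * Bᵀ) F ↔ ∃ z, F = dirFace B z := by
  constructor
  · rintro ⟨hne, hF⟩
    obtain ⟨l, hl⟩ := hF hne
    obtain ⟨z, hz⟩ := h.exists_form_eq (l : (Fin r → ℝ) →ₗ[ℝ] ℝ)
    replace hz : ∀ y, l y = gramForm B y z := fun y => by rw [gramForm_comm, hz]; rfl
    refine ⟨z, ?_⟩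
    obtain ⟨p, hp⟩ := h.dirFace_nonempty z
    rw [hl]
    ext x
    simp only [hz, dirFace, Set.mem_ofPred_eq]
    refine and_congr_right fun hx => ⟨fun hmax => ?_, fun heq y hy => ?_⟩
    · exact le_antisymm (h.form_le hx z) (hp.2 ▸ hmax p hp.1)
    · rw [heq]; exact h.form_le hy z
  · rintro ⟨z, rfl⟩
    refine ⟨h.dirFace_nonempty z, fun _ => ⟨LinearMap.toContinuousLinearMap (gramForm B z), ?_⟩⟩
    obtain ⟨p, hp⟩ := h.dirFace_nonempty z
    ext x
    simp only [dirFace, Set.mem_ofPred_eq, LinearMap.coe_toContinuousLinearMap', gramForm_comm z]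
    refine and_congr_right fun hx => ⟨fun heq y hy => ?_, fun hmax => ?_⟩
    · rw [heq]; exact h.form_le hy z
    · exact le_antisymm (h.form_le hx z) (hp.2 ▸ hmax p hp.1)

end Regular

/-! ### Inclusions and dimensions of faces; facets and elementary vectors -/

section Regular

variable {E : Type*} {r : ℕ} [Fintype E] {B : Matrix (Fin r) E ℤ}

/-- Supplies a step size small enough that a perturbation changes no nonzero sign. -/
lemma exists_pos_mul_abs_lt (a y : E → ℝ) :
    ∃ ε : ℝ, 0 < ε ∧ ∀ e, a e ≠ 0 → ε * |y e| < |a e| := by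
  have h : ∀ᶠ ε : ℝ in nhdsWithin 0 (Set.Ioi 0), ∀ e, a e ≠ 0 → ε * |y e| < |a e| := by
    rw [Filter.eventually_all]
    intro e
    by_cases ha : a e = 0
    · simp [ha]
    · have : Filter.Tendsto (fun ε : ℝ => ε * |y e|) (nhdsWithin 0 (Set.Ioi 0)) (nhds 0) := by
        have h1 : Continuous fun ε : ℝ => ε * |y e| := by fun_prop
        simpa using (h1.tendsto 0).mono_left nhdsWithin_le_nhds
      exact (this.eventually_lt_const (abs_pos.mpr ha)).mono fun _ h _ => h
  obtain ⟨ε, hε, hpos⟩ := (h.and self_mem_nhdsWithin).exists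
  exact ⟨ε, hpos, hε⟩

lemma abs_eq_abs_sub_add {a b ε : ℝ} (h : 0 < b * a) (hle : ε * |b| ≤ |a|) :
    |a| = |a - ε * b| + ε * |b| := by
  rcases pos_and_pos_or_neg_and_neg_of_mul_pos h with ⟨hb, ha⟩ | ⟨hb, ha⟩
  · rw [abs_of_pos ha, abs_of_pos hb] at *
    rw [abs_of_nonneg (by linarith)]; ring
  · rw [abs_of_neg ha, abs_of_neg hb] at *
    rw [abs_of_nonpos (by linarith)]; ring

/-- `z` has the sign of `v` wherever `v` is nonzero. -/
def Conforms (B : Matrix (Fin r) E ℤ) (v z : Fin r → ℝ) : Prop :=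
  ∀ e, coord B v e ≠ 0 → 0 < coord B v e * coord B z e

/-- The l¹-norm is additive in the decomposition `z = (z - ε • v) + ε • v`, so a point attaining the
bound for `z` attains it for both summands. -/
theorem IsRegular.dirFace_subset (h : IsRegular B) {v z : Fin r → ℝ} (hc : Conforms B v z) :
    dirFace B z ⊆ dirFace B v := by
  obtain ⟨ε, hε, hlt⟩ := exists_pos_mul_abs_lt (coord B z) (coord B v)
  have habs : ∀ e, |coord B z e| = |coord B (z - ε • v) e| + ε * |coord B v e| := by
    intro e
    rw [map_sub, map_smul, Pi.sub_apply, Pi.smul_apply, smul_eq_mul]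
    by_cases hv : coord B v e = 0
    · simp [hv]
    · have hz : coord B z e ≠ 0 := fun h0 => by
        have := hc e hv
        rw [h0, mul_zero] at this
        exact lt_irrefl _ this
      exact abs_eq_abs_sub_add (hc e hv) (hlt e hz).le
  have hsum : normOne B z = normOne B (z - ε • v) + ε * normOne B v := by
    simp only [normOne, habs, Finset.sum_add_distrib, Finset.mul_sum]
  rintro x ⟨hx, hxz⟩
  refine ⟨hx, le_antisymm (h.form_le hx v) ?_⟩
  have h1 := h.form_le hx (z - ε • v)
  rw [map_sub, map_smul, smul_eq_mul, hxz, hsum] at h1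
  have h2 : ε * (normOne B v / 2) ≤ ε * gramForm B x v := by linarith
  exact le_of_mul_le_mul_left h2 hε

/-- The vectors whose coordinates vanish wherever those of `z` do. -/
def supportSpace (B : Matrix (Fin r) E ℤ) (z : Fin r → ℝ) : Submodule ℝ (Fin r → ℝ) where
  carrier := {y | ∀ e, coord B z e = 0 → coord B y e = 0}
  zero_mem' := by intro e _; simp
  add_mem' := by
    intro a b ha hb e he
    simp [ha e he, hb e he]
  smul_mem' := by
    intro c a ha e he
    simp [ha e he]

omit [Fintype E] in
lemma mem_supportSpace {z y : Fin r → ℝ} :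
    y ∈ supportSpace B z ↔ ∀ e, coord B z e = 0 → coord B y e = 0 := Iff.rfl

lemma abs_add_eq_of_abs_le {a b : ℝ} (h : |b| ≤ |a|) (h0 : a = 0 → b = 0) :
    |a + b| = |a| + (SignType.sign a : ℝ) * b := by
  rcases lt_trichotomy a 0 with ha | ha | ha
  · rw [abs_of_neg ha] at *
    have := abs_le.mp h
    rw [abs_of_nonpos (by linarith), sign_neg ha]; simp; ring
  · simp [ha, h0 ha]
  · rw [abs_of_pos ha] at *
    have := abs_le.mp h
    rw [abs_of_nonneg (by linarith), sign_pos ha]; simp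

/-- Near `z` the support function is linear along `y`. The bounds at `z + ε • y` and `z - ε • y`
together force equality, with a value that does not depend on the point `x` of the face. -/
theorem IsRegular.form_eq_of_mem_dirFace (h : IsRegular B) {z y x : Fin r → ℝ}
    (hy : y ∈ supportSpace B z) (hx : x ∈ dirFace B z) :
    gramForm B x y = (∑ e, (SignType.sign (coord B z e) : ℝ) * coord B y e) / 2 := by
  obtain ⟨ε, hε, hlt⟩ := exists_pos_mul_abs_lt (coord B z) (coord B y)
  have key : ∀ δ : ℝ, |δ| = ε → normOne B (z + δ • y) =
      normOne B z + δ * ∑ e, (SignType.sign (coord B z e) : ℝ) * coord B y e := by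
    intro δ hδ
    rw [normOne, normOne, Finset.mul_sum, ← Finset.sum_add_distrib]
    refine Finset.sum_congr rfl fun e _ => ?_
    rw [map_add, map_smul, Pi.add_apply, Pi.smul_apply, smul_eq_mul, abs_add_eq_of_abs_le]
    · ring
    · by_cases hz : coord B z e = 0
      · simp [hz, hy e hz]
      · rw [abs_mul, hδ]; exact (hlt e hz).le
    · intro hz; simp [hy e hz]
  have h1 := h.form_le hx.1 (z + ε • y)
  have h2 := h.form_le hx.1 (z + (-ε) • y)
  rw [key _ (abs_of_pos hε), map_add, map_smul, smul_eq_mul, hx.2] at h1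
  rw [key _ (by rw [abs_neg, abs_of_pos hε]), map_add, map_smul, smul_eq_mul, hx.2] at h2
  have h3 : ε * gramForm B x y =
      ε * ((∑ e, (SignType.sign (coord B z e) : ℝ) * coord B y e) / 2) := by linarith
  exact mul_left_cancel₀ hε.ne' h3

/-- The cube coordinate at `e` is free on this face. The projections of the points with value `0`
and `1/2` there differ by half of `h.edgeVec e`. -/
lemma IsRegular.edgeVec_mem_vectorSpan_of_eq_zero (h : IsRegular B) {z : Fin r → ℝ} {e : E}
    (he : coord B z e = 0) : h.edgeVec e ∈ vectorSpan ℝ (dirFace B z) := by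
  classical
  set s : E → ℝ := fun f => (SignType.sign (coord B z f) : ℝ) / 2 with hs
  have hse : s e = 0 := by simp [hs, he]
  obtain ⟨x, hx, hxy⟩ := h.exists_mem_dirFace (z := z) (t := s)
    (fun f => abs_half_sign_le _) (fun f => half_sign_mul _)
  obtain ⟨x', hx', hxy'⟩ := h.exists_mem_dirFace (z := z) (t := Function.update s e (1 / 2))
    (fun f => by
      by_cases hf : f = e
      · subst hf; simp
      · simpa [hf] using abs_half_sign_le (coord B z f))
    (fun f => by
      by_cases hf : f = e
      · subst hf; simp [he]
      · simpa [hf] using half_sign_mul (coord B z f))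
  have hmem := vsub_mem_vectorSpan ℝ hx' hx
  have heq : h.edgeVec e = (2 : ℝ) • (x' -ᵥ x) := by
    apply h.ext_form
    intro y
    rw [h.form_edgeVec, map_smul, LinearMap.smul_apply, vsub_eq_sub, map_sub, LinearMap.sub_apply,
      hxy', hxy, ← Finset.sum_sub_distrib, Finset.sum_eq_single e]
    · simp [hse]
    · intro f _ hf; simp [hf]
    · simp
  rw [heq]
  exact Submodule.smul_mem _ _ hmem

/-- The two preceding lemmas give the two inclusions. Dimensions of faces thereby become dimensions
of spaces of vectors with restricted support. -/
theorem IsRegular.orthogonal_vectorSpan (h : IsRegular B) (z : Fin r → ℝ) :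
    (gramForm B).orthogonal (vectorSpan ℝ (dirFace B z)) = supportSpace B z := by
  ext y
  rw [LinearMap.BilinForm.mem_orthogonal_iff, mem_supportSpace]
  constructor
  · intro hy e he
    rw [← h.form_edgeVec]
    exact hy _ (h.edgeVec_mem_vectorSpan_of_eq_zero he)
  · intro hy x hx
    have hle : vectorSpan ℝ (dirFace B z) ≤ LinearMap.ker ((gramForm B).flip y) := by
      rw [vectorSpan_def, Submodule.span_le]
      rintro _ ⟨p, hp, q, hq, rfl⟩
      simp only [SetLike.mem_coe, LinearMap.mem_ker, LinearMap.BilinForm.flip_apply, vsub_eq_sub,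
        map_sub]
      rw [h.form_eq_of_mem_dirFace hy hp, h.form_eq_of_mem_dirFace hy hq, sub_self]
    exact hle hx

lemma IsRegular.finrank_vectorSpan_add (h : IsRegular B) (z : Fin r → ℝ) :
    Module.finrank ℝ (vectorSpan ℝ (dirFace B z)) + Module.finrank ℝ (supportSpace B z) = r := by
  have h1 := LinearMap.BilinForm.finrank_orthogonal h.nondegenerate (vectorSpan ℝ (dirFace B z))
  rw [h.orthogonal_vectorSpan] at h1
  have h2 := Submodule.finrank_le (vectorSpan ℝ (dirFace B z))
  simp only [Module.finrank_fin_fun] at h1 h2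
  omega

lemma IsRegular.edgeVec_mem_vectorSpan_iff (h : IsRegular B) (z : Fin r → ℝ) (e : E) :
    h.edgeVec e ∈ vectorSpan ℝ (dirFace B z) ↔ coord B z e = 0 := by
  refine ⟨fun he => ?_, h.edgeVec_mem_vectorSpan_of_eq_zero⟩
  have hz : z ∈ supportSpace B z := fun e he => he
  rw [← h.orthogonal_vectorSpan] at hz
  have := hz _ he
  rwa [← h.form_edgeVec]

/-- The lattice vectors with coordinates in `{-1, 0, 1}` and minimal support. -/
structure IsElementary (B : Matrix (Fin r) E ℤ) (v : Fin r → ℤ) : Prop where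
  ne_zero : v ≠ 0
  sign : IsSignVector B v
  eq_smul : ∀ y ∈ supportSpace B (toReal v), ∃ t : ℝ, y = t • toReal v

lemma IsSignVector.bisectorFace_eq {v : Fin r → ℤ} (hv : IsSignVector B v) :
    bisectorFace (B * Bᵀ) v = dirFace B (toReal v) := by
  ext x
  simp only [bisectorFace, dirFace, ← gramForm_eq, hv.form_self]

lemma toReal_ne_zero {v : Fin r → ℤ} (hv : v ≠ 0) : toReal v ≠ 0 := by
  rw [← toReal_zero]; exact toReal_injective.ne hv

omit [Fintype E] in
lemma IsElementary.finrank_supportSpace {v : Fin r → ℤ} (hv : IsElementary B v) :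
    Module.finrank ℝ (supportSpace B (toReal v)) = 1 := by
  refine finrank_eq_one (⟨toReal v, fun e he => he⟩ : supportSpace B (toReal v)) ?_ ?_
  · intro h0
    exact toReal_ne_zero hv.ne_zero (congrArg Subtype.val h0)
  · rintro ⟨y, hy⟩
    obtain ⟨t, rfl⟩ := hv.eq_smul y hy
    exact ⟨t, rfl⟩

lemma IsRegular.isFacet_of_isElementary (h : IsRegular B) {v : Fin r → ℤ}
    (hv : IsElementary B v) : IsFacet (B * Bᵀ) (bisectorFace (B * Bᵀ) v) := by
  rw [hv.sign.bisectorFace_eq]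
  refine ⟨(h.isFace_iff _).mpr ⟨_, rfl⟩, ?_⟩
  rw [← hv.finrank_supportSpace]
  exact h.finrank_vectorSpan_add _

/-- For a facet the support space is a line. A sign vector `u` conformal to `z` spans it, so `z` and
`u` have the same sign pattern and expose the same face. -/
lemma IsRegular.exists_isElementary_of_isFacet (h : IsRegular B) {F : Set (Fin r → ℝ)}
    (hF : IsFacet (B * Bᵀ) F) : ∃ v, IsElementary B v ∧ F = bisectorFace (B * Bᵀ) v := by
  obtain ⟨z, rfl⟩ := (h.isFace_iff F).mp hF.1
  have hK : Module.finrank ℝ (supportSpace B z) = 1 := by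
    have := h.finrank_vectorSpan_add z
    have := hF.2
    omega
  have hz : z ≠ 0 := by
    rintro rfl
    obtain ⟨y, hy, -⟩ := finrank_eq_one_iff'.mp hK
    apply hy
    ext1
    apply h.inj
    ext e
    exact y.2 e (by simp)
  obtain ⟨u, hu0, hus, huz⟩ := h.conformal z hz
  have hc : Conforms B (toReal u) z := by
    intro e he
    rw [coord_toReal] at he ⊢
    exact huz e (by exact_mod_cast he)
  have hsub : ∀ e, coord B z e = 0 → coord B (toReal u) e = 0 := by
    intro e he
    by_contra hne
    have := hc e hne
    rw [he, mul_zero] at this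
    exact lt_irrefl _ this
  have hspan := (finrank_eq_one_iff_of_nonzero'
    (⟨toReal u, hsub⟩ : supportSpace B z) (fun h0 =>
      toReal_ne_zero hu0 (congrArg Subtype.val h0))).mp hK
  have hel : IsElementary B u := by
    refine ⟨hu0, hus, fun y hy => ?_⟩
    obtain ⟨t, ht⟩ := hspan ⟨y, fun e he => hy e (hsub e he)⟩
    exact ⟨t, (congrArg Subtype.val ht).symm⟩
  refine ⟨u, hel, ?_⟩
  rw [hel.sign.bisectorFace_eq]
  refine (h.dirFace_subset hc).antisymm (h.dirFace_subset ?_)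
  obtain ⟨t, ht⟩ := hspan ⟨z, fun e he => he⟩
  replace ht : t • toReal u = z := congrArg Subtype.val ht
  intro e he
  have : coord B (toReal u) e ≠ 0 := by
    intro h0
    apply he
    rw [← ht, map_smul, Pi.smul_apply, h0, smul_zero]
  rw [mul_comm]
  exact hc e this

/-- Here `v` is an arbitrary lattice vector. It is orthogonal to the directions of the facet, so `v
= c u`, and the bisector equation gives `c * (c - 1) = 0`. The case `c = 0` is impossible because
the bisector face of `0` contains the origin and that of `u` does not. -/
lemma IsElementary.eq_of_bisectorFace_eq (h : IsRegular B) {u v : Fin r → ℤ}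
    (hu : IsElementary B u) (huv : bisectorFace (B * Bᵀ) u = bisectorFace (B * Bᵀ) v) : u = v := by
  have hface := huv
  rw [hu.sign.bisectorFace_eq] at huv
  have hv : ∀ x ∈ dirFace B (toReal u), gramForm B x (toReal v) =
      gramForm B (toReal v) (toReal v) / 2 := by
    intro x hx
    rw [huv] at hx
    simpa only [gramForm_eq] using hx.2
  have hmem : toReal v ∈ supportSpace B (toReal u) := by
    rw [← h.orthogonal_vectorSpan]
    have hle : vectorSpan ℝ (dirFace B (toReal u)) ≤
        LinearMap.ker ((gramForm B).flip (toReal v)) := by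
      rw [vectorSpan_def, Submodule.span_le]
      rintro _ ⟨p, hp, q, hq, rfl⟩
      simp only [SetLike.mem_coe, LinearMap.mem_ker, LinearMap.BilinForm.flip_apply, vsub_eq_sub,
        map_sub]
      rw [hv p hp, hv q hq, sub_self]
    exact fun x hx => hle hx
  obtain ⟨c, hc⟩ := hu.eq_smul _ hmem
  obtain ⟨x, hx⟩ := h.dirFace_nonempty (toReal u)
  have h1 := hv x hx
  have h2 := hx.2
  rw [← hu.sign.form_self] at h2
  have hpos : gramForm B (toReal u) (toReal u) ≠ 0 := fun h0 =>
    toReal_ne_zero hu.ne_zero (h.eq_zero_of_form h0)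
  rw [hc] at h1
  simp only [map_smul, LinearMap.smul_apply, smul_eq_mul, h2] at h1
  have h3 : c = 0 ∨ c = 1 := by
    have : gramForm B (toReal u) (toReal u) * (c * (c - 1)) = 0 := by linarith
    rcases mul_eq_zero.mp this with h | h
    · exact absurd h hpos
    · rcases mul_eq_zero.mp h with h | h
      · exact Or.inl h
      · exact Or.inr (by linarith)
  rcases h3 with rfl | rfl
  · exfalso
    have hv0 : v = 0 := toReal_injective (by rw [hc]; simp)
    have h0 : (0 : Fin r → ℝ) ∈ bisectorFace (B * Bᵀ) v := by
      refine ⟨(mem_voronoiCell_iff 0).mpr fun w => ?_, ?_⟩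
      · have := normOne_le_form_self (B := B) w
        have h4 : 0 ≤ normOne B (toReal w) := Finset.sum_nonneg fun _ _ => abs_nonneg _
        rw [map_zero, LinearMap.zero_apply]; linarith
      · simp [← gramForm_eq, hv0]
    rw [← hface] at h0
    have h5 := h0.2
    simp only [← gramForm_eq, map_zero, LinearMap.zero_apply] at h5
    exact hpos (by linarith)
  · rw [one_smul] at hc
    exact (toReal_injective hc).symm

theorem IsRegular.isFacet_bisectorFace_iff (h : IsRegular B) (v : Fin r → ℤ) :
    IsFacet (B * Bᵀ) (bisectorFace (B * Bᵀ) v) ↔ IsElementary B v := by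
  refine ⟨fun hF => ?_, h.isFacet_of_isElementary⟩
  obtain ⟨u, hu, huv⟩ := h.exists_isElementary_of_isFacet hF
  rwa [← hu.eq_of_bisectorFace_eq h huv.symm]

theorem IsRegular.existsUnique_of_isFacet (h : IsRegular B) {F : Set (Fin r → ℝ)}
    (hF : IsFacet (B * Bᵀ) F) : ∃! v, F = bisectorFace (B * Bᵀ) v := by
  obtain ⟨u, hu, rfl⟩ := h.exists_isElementary_of_isFacet hF
  exact ⟨u, rfl, fun v hv => (hu.eq_of_bisectorFace_eq h hv).symm⟩

/-- A face is determined by the sign pattern of any direction exposing it, and there are finitely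
many patterns. -/
theorem IsRegular.finite_isFace (h : IsRegular B) : {F | IsFace (B * Bᵀ) F}.Finite := by
  classical
  let pat : (Fin r → ℝ) → (E → SignType) := fun z e => SignType.sign (coord B z e)
  have hpat : ∀ z z', pat z = pat z' → dirFace B z = dirFace B z' := by
    have hc : ∀ z z', pat z = pat z' → Conforms B z z' := by
      intro z z' hzz e he
      have : SignType.sign (coord B z e) = SignType.sign (coord B z' e) := congrFun hzz e
      rcases lt_or_gt_of_ne he with hlt | hgt
      · have h1 : SignType.sign (coord B z' e) = -1 := by rw [← this]; exact sign_neg hlt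
        exact mul_pos_of_neg_of_neg hlt (sign_eq_neg_one_iff.mp h1)
      · have h1 : SignType.sign (coord B z' e) = 1 := by rw [← this]; exact sign_pos hgt
        exact mul_pos hgt (sign_eq_one_iff.mp h1)
    exact fun z z' hzz => (h.dirFace_subset (hc z' z hzz.symm)).antisymm
      (h.dirFace_subset (hc z z' hzz))
  have hsub : {F | IsFace (B * Bᵀ) F} ⊆
      Set.range fun p : Set.range pat => dirFace B p.2.choose := by
    intro F hF
    obtain ⟨z, rfl⟩ := (h.isFace_iff F).mp hF
    refine ⟨⟨pat z, z, rfl⟩, hpat _ _ ?_⟩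
    exact (⟨z, rfl⟩ : ∃ y, pat y = pat z).choose_spec
  exact (Set.finite_range _).subset hsub

end Regular

section Regular

variable {E : Type*} {r : ℕ} {B : Matrix (Fin r) E ℤ}

/-! ### Parallel coordinates -/

/-- The `f`-th coordinate is a multiple of the `e`-th one. -/
def ParallelCoords (B : Matrix (Fin r) E ℤ) (e f : E) : Prop :=
  ∃ t : ℝ, ∀ z, coord B z f = t * coord B z e

lemma ParallelCoords.refl (e : E) : ParallelCoords B e e := ⟨1, fun _ => (one_mul _).symm⟩

/-- The coordinate functional of `e`. -/
noncomputable def coordFun (B : Matrix (Fin r) E ℤ) (e : E) : Module.Dual ℝ (Fin r → ℝ) :=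
  (LinearMap.proj e).comp (coord B)

lemma coordFun_apply (e : E) (z : Fin r → ℝ) : coordFun B e z = coord B z e := rfl

lemma exists_mul_eq_of_ker_le {V : Type*} [AddCommGroup V] [Module ℝ V] {φ ψ : Module.Dual ℝ V}
    (h : ∀ z, φ z = 0 → ψ z = 0) : ∃ t : ℝ, ∀ z, ψ z = t * φ z := by
  by_cases hφ : ∃ y, φ y ≠ 0
  · obtain ⟨y, hy⟩ := hφ
    refine ⟨ψ y / φ y, fun z => ?_⟩
    have := h (z - (φ z / φ y) • y) (by simp [hy])
    rw [map_sub, map_smul, smul_eq_mul, sub_eq_zero] at this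
    rw [this]; field_simp
  · push Not at hφ
    exact ⟨0, fun z => by simp [h z (hφ z)]⟩

/-- A real vector space is not a finite union of proper subspaces. -/
lemma exists_ker_generic {V ι : Type*} [AddCommGroup V] [Module ℝ V] [Finite ι]
    (φ : Module.Dual ℝ V) (ψ : ι → Module.Dual ℝ V) :
    ∃ z, φ z = 0 ∧ ∀ i, ψ i z = 0 → ∀ y, φ y = 0 → ψ i y = 0 := by
  obtain ⟨z, hz, hzi⟩ := Module.Dual.exists_forall_mem_ne_zero_of_forall_exists
    (LinearMap.ker φ) (fun i : {i // ∃ y, φ y = 0 ∧ ψ i y ≠ 0} => ψ i.1)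
    (fun i => by obtain ⟨y, hy, hyi⟩ := i.2; exact ⟨y, hy, hyi⟩)
  refine ⟨z, hz, fun i hi y hy => ?_⟩
  by_contra hne
  exact hzi ⟨i, y, hy, hne⟩ hi

variable [Fintype E]

omit [Fintype E] in
lemma exists_coord_eq_zero_iff [Finite E] (e : E) :
    ∃ z, ∀ f, coord B z f = 0 ↔ ParallelCoords B e f := by
  obtain ⟨z, hz, hzf⟩ := exists_ker_generic (coordFun B e) (coordFun B)
  refine ⟨z, fun f => ⟨fun hf => exists_mul_eq_of_ker_le (hzf f hf), ?_⟩⟩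
  rintro ⟨t, ht⟩
  rw [ht]
  exact mul_eq_zero_of_right _ hz

lemma IsRegular.edgeVec_ne_zero (h : IsRegular B) (e : E) : h.edgeVec e ≠ 0 := by
  intro h0
  obtain ⟨z, hz⟩ := h.col_ne e
  rw [← h.form_edgeVec, h0] at hz
  simp at hz

lemma IsRegular.edgeVec_mem_span_iff (h : IsRegular B) (e f : E) :
    h.edgeVec f ∈ Submodule.span ℝ {h.edgeVec e} ↔ ParallelCoords B e f := by
  rw [Submodule.mem_span_singleton]
  refine exists_congr fun t => ⟨fun ht z => ?_, fun ht => ?_⟩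
  · rw [← h.form_edgeVec, ← ht, map_smul, LinearMap.smul_apply, h.form_edgeVec, smul_eq_mul]
  · apply h.ext_form
    intro y
    rw [map_smul, LinearMap.smul_apply, h.form_edgeVec, h.form_edgeVec, ht, smul_eq_mul]

/-! ### Edges of the Voronoi cell -/

lemma IsRegular.vectorSpan_eq_span (h : IsRegular B) (ε : VoronoiEdge (B * Bᵀ)) {e : E}
    (he : h.edgeVec e ∈ vectorSpan ℝ ε.1) :
    vectorSpan ℝ ε.1 = Submodule.span ℝ {h.edgeVec e} := by
  symm
  apply Submodule.eq_of_le_of_finrank_eq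
  · rwa [Submodule.span_le, Set.singleton_subset_iff]
  · rw [finrank_span_singleton (h.edgeVec_ne_zero e), ε.2.2]

/-- If no coordinate of the exposing direction vanished, its support space would be everything and
the face a single point. -/
lemma IsRegular.exists_edgeVec_mem (h : IsRegular B) (ε : VoronoiEdge (B * Bᵀ)) :
    ∃ e, h.edgeVec e ∈ vectorSpan ℝ ε.1 := by
  obtain ⟨z, hz⟩ := (h.isFace_iff _).mp ε.2.1
  by_contra hcon
  push Not at hcon
  simp only [hz, h.edgeVec_mem_vectorSpan_iff] at hcon
  have htop : supportSpace B z = ⊤ := by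
    rw [eq_top_iff]
    exact fun y _ e he => absurd he (hcon e)
  have h1 := h.finrank_vectorSpan_add z
  rw [htop, finrank_top, Module.finrank_fin_fun, ← hz, ε.2.2] at h1
  omega

/-- The coordinates whose direction is that of the parallel class `c`. -/
def IsRegular.classEdges (h : IsRegular B) (c : EdgeClass (B * Bᵀ)) : Set E :=
  Quotient.lift (fun ε : VoronoiEdge (B * Bᵀ) => {e | h.edgeVec e ∈ vectorSpan ℝ ε.1})
    (fun ε ε' (hε : vectorSpan ℝ ε.1 = vectorSpan ℝ ε'.1) => by simp only [hε]) c

lemma IsRegular.mem_classEdges_mk (h : IsRegular B) (ε : VoronoiEdge (B * Bᵀ)) (e : E) :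
    e ∈ h.classEdges (Quotient.mk (parallel _) ε) ↔ h.edgeVec e ∈ vectorSpan ℝ ε.1 := Iff.rfl

lemma IsRegular.classEdges_nonempty (h : IsRegular B) (c : EdgeClass (B * Bᵀ)) :
    (h.classEdges c).Nonempty := by
  induction c using Quotient.inductionOn with
  | h ε => exact h.exists_edgeVec_mem ε

lemma IsRegular.mem_classEdges_iff (h : IsRegular B) {c : EdgeClass (B * Bᵀ)} {e : E}
    (he : e ∈ h.classEdges c) (f : E) : f ∈ h.classEdges c ↔ ParallelCoords B e f := by
  induction c using Quotient.inductionOn with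
  | h ε =>
    rw [h.mem_classEdges_mk] at he ⊢
    rw [h.vectorSpan_eq_span ε he, h.edgeVec_mem_span_iff]

lemma IsRegular.eq_of_mem_classEdges (h : IsRegular B) {c c' : EdgeClass (B * Bᵀ)} {e : E}
    (he : e ∈ h.classEdges c) (he' : e ∈ h.classEdges c') : c = c' := by
  induction c using Quotient.inductionOn with
  | h ε =>
    induction c' using Quotient.inductionOn with
    | h ε' =>
      rw [h.mem_classEdges_mk] at he he'
      apply Quotient.sound
      change vectorSpan ℝ ε.1 = vectorSpan ℝ ε'.1
      rw [h.vectorSpan_eq_span ε he, h.vectorSpan_eq_span ε' he']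

/-- A direction whose vanishing coordinates form one parallel class exposes an edge. -/
lemma IsRegular.finrank_vectorSpan_eq_one (h : IsRegular B) {e : E} {z : Fin r → ℝ}
    (hz : ∀ f, coord B z f = 0 ↔ ParallelCoords B e f) :
    Module.finrank ℝ (vectorSpan ℝ (dirFace B z)) = 1 := by
  have hK : supportSpace B z = LinearMap.ker (coordFun B e) := by
    ext y
    rw [mem_supportSpace, LinearMap.mem_ker, coordFun_apply]
    constructor
    · exact fun hy => hy e ((hz e).mpr (.refl e))
    · intro hy f hf
      obtain ⟨t, ht⟩ := (hz f).mp hf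
      rw [ht, hy, mul_zero]
  have h1 := h.finrank_vectorSpan_add z
  have hne : coordFun B e ≠ 0 := by
    intro h0
    obtain ⟨y, hy⟩ := h.col_ne e
    exact hy (by rw [← coordFun_apply, h0]; rfl)
  have h2 := Module.Dual.finrank_ker_add_one_of_ne_zero hne
  rw [hK] at h1
  rw [Module.finrank_fin_fun] at h2
  omega

/-- The edge of the Voronoi cell exposed by such a direction. -/
noncomputable def IsRegular.voronoiEdge (h : IsRegular B) {e : E} {z : Fin r → ℝ}
    (hz : ∀ f, coord B z f = 0 ↔ ParallelCoords B e f) : VoronoiEdge (B * Bᵀ) :=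
  ⟨dirFace B z, (h.isFace_iff _).mpr ⟨z, rfl⟩, h.finrank_vectorSpan_eq_one hz⟩

lemma IsRegular.mem_classEdges_voronoiEdge (h : IsRegular B) {e : E} {z : Fin r → ℝ}
    (hz : ∀ f, coord B z f = 0 ↔ ParallelCoords B e f) :
    e ∈ h.classEdges (Quotient.mk (parallel _) (h.voronoiEdge hz)) := by
  rw [h.mem_classEdges_mk]
  exact (h.edgeVec_mem_vectorSpan_iff z e).mpr ((hz e).mpr (.refl e))

lemma IsRegular.exists_mem_classEdges (h : IsRegular B) (e : E) : ∃ c, e ∈ h.classEdges c := by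
  obtain ⟨z, hz⟩ := exists_coord_eq_zero_iff (B := B) e
  exact ⟨_, h.mem_classEdges_voronoiEdge hz⟩

/-- The parallel class of the Voronoi edges in the direction of the coordinate `e`. -/
noncomputable def IsRegular.classOf (h : IsRegular B) (e : E) : EdgeClass (B * Bᵀ) :=
  (h.exists_mem_classEdges e).choose

lemma IsRegular.mem_classEdges_classOf (h : IsRegular B) (e : E) :
    e ∈ h.classEdges (h.classOf e) := (h.exists_mem_classEdges e).choose_spec

lemma IsRegular.mem_classEdges_iff_classOf (h : IsRegular B) (e : E) (c : EdgeClass (B * Bᵀ)) :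
    e ∈ h.classEdges c ↔ h.classOf e = c :=
  ⟨fun he => h.eq_of_mem_classEdges (h.mem_classEdges_classOf e) he,
    fun he => he ▸ h.mem_classEdges_classOf e⟩

lemma IsRegular.finite_voronoiEdge (h : IsRegular B) : Finite (VoronoiEdge (B * Bᵀ)) :=
  (h.finite_isFace.subset fun _ hF => hF.1).to_subtype

lemma IsRegular.finite_edgeClass (h : IsRegular B) : Finite (EdgeClass (B * Bᵀ)) :=
  have := h.finite_voronoiEdge
  inferInstanceAs (Finite (Quotient _))

/-- An edge inside the face of `v` has direction `h.edgeVec e`, which forces `v e = 0`. Conversely,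
perturb `v` by a small multiple of a generic vector of the hyperplane of `e`: the result conforms to
`v` and vanishes exactly on the class of `e`, so it exposes an edge inside the face of `v`. -/
theorem IsRegular.participates_iff (h : IsRegular B) {c : EdgeClass (B * Bᵀ)} {e : E}
    (he : e ∈ h.classEdges c) (v : Fin r → ℝ) :
    Participates c (dirFace B v) ↔ coord B v e = 0 := by
  constructor
  · rintro ⟨ε, rfl, hε⟩
    rw [h.mem_classEdges_mk] at he
    exact (h.edgeVec_mem_vectorSpan_iff v e).mp (vectorSpan_mono ℝ hε he)
  · intro hv
    obtain ⟨z, hz⟩ := exists_coord_eq_zero_iff (B := B) e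
    obtain ⟨δ, hδ, hlt⟩ := exists_pos_mul_abs_lt (coord B v) (coord B z)
    have hpos : ∀ f, coord B v f ≠ 0 → 0 < coord B v f * coord B (v + δ • z) f := by
      intro f hf
      have h1 := hlt f hf
      rw [map_add, map_smul, Pi.add_apply, Pi.smul_apply, smul_eq_mul]
      rw [← abs_of_pos hδ, ← abs_mul] at h1
      rcases lt_or_gt_of_ne hf with hneg | hgt
      · rw [abs_of_neg hneg] at h1
        exact mul_pos_of_neg_of_neg hneg (by linarith [(abs_lt.mp h1).2])
      · rw [abs_of_pos hgt] at h1
        exact mul_pos hgt (by linarith [(abs_lt.mp h1).1])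
    have hz' : ∀ f, coord B (v + δ • z) f = 0 ↔ ParallelCoords B e f := by
      intro f
      by_cases hf : coord B v f = 0
      · rw [← hz f, map_add, map_smul, Pi.add_apply, Pi.smul_apply, smul_eq_mul, hf, zero_add,
          mul_eq_zero, or_iff_right hδ.ne']
      · refine iff_of_false (fun h0 => ?_) (fun hp => hf ?_)
        · have := hpos f hf
          rw [h0, mul_zero] at this
          exact lt_irrefl _ this
        · obtain ⟨t, ht⟩ := hp
          rw [ht, hv, mul_zero]
    exact ⟨h.voronoiEdge hz', h.eq_of_mem_classEdges (h.mem_classEdges_voronoiEdge hz') he,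
      h.dirFace_subset hpos⟩

/-! ### Linear independence of absolute values of linear functionals -/

/-- Take the second difference in direction `y` at a generic point of the hyperplane `w i₀ = 0`.
Each `|w i|` is affine near that point unless `w i` vanishes on the whole hyperplane, in which case
it contributes `2 * δ * |w i y|`. -/
theorem sum_parallel_eq_zero {V ι : Type*} [AddCommGroup V] [Module ℝ V] [Fintype ι]
    (w : ι → Module.Dual ℝ V) (d : ι → ℝ) (hd : ∀ z, ∑ i, d i * |w i z| = 0) (i₀ : ι) (y : V) :
    open Classical in
    ∑ i with ∀ z, w i₀ z = 0 → w i z = 0, d i * |w i y| = 0 := by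
  classical
  obtain ⟨z, hz, hzi⟩ := exists_ker_generic (w i₀) w
  obtain ⟨δ, hδ, hlt⟩ := exists_pos_mul_abs_lt (fun i => w i z) (fun i => w i y)
  have key : ∀ i, d i * |w i (z + δ • y)| + d i * |w i (z - δ • y)| - 2 * (d i * |w i z|) =
      2 * δ * (if ∀ z, w i₀ z = 0 → w i z = 0 then d i * |w i y| else 0) := by
    intro i
    rw [map_add, map_sub, map_smul, smul_eq_mul]
    by_cases hi : w i z = 0
    · rw [if_pos (hzi i hi), hi, zero_add, zero_sub, abs_neg, abs_mul, abs_of_pos hδ]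
      simp; ring
    · rw [if_neg (fun hcon => hi (hcon z hz))]
      have h1 := hlt i hi
      rw [← abs_of_pos hδ, ← abs_mul] at h1
      rcases lt_or_gt_of_ne hi with hneg | hgt
      · rw [abs_of_neg hneg] at *
        have h2 := abs_lt.mp h1
        rw [abs_of_neg (by linarith), abs_of_neg (by linarith)]; ring
      · rw [abs_of_pos hgt] at *
        have h2 := abs_lt.mp h1
        rw [abs_of_pos (by linarith), abs_of_pos (by linarith)]; ring
  have hsum : 2 * δ * ∑ i, (if ∀ z, w i₀ z = 0 → w i z = 0 then d i * |w i y| else 0) = 0 := by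
    rw [Finset.mul_sum, ← Finset.sum_congr rfl fun i _ => key i]
    rw [Finset.sum_sub_distrib, Finset.sum_add_distrib, ← Finset.mul_sum, hd, hd, hd]
    simp
  rw [Finset.sum_filter]
  exact (mul_eq_zero.mp hsum).resolve_left (by positivity)

end Regular

section Regular

variable {E : Type*} {r : ℕ} {B : Matrix (Fin r) E ℤ} [Fintype E]

/-! ### Good bases -/

/-- Without opposite signs `u + v` conforms to both vectors, so its face lies in both faces. -/
lemma dirFace_inter_nonempty (h : IsRegular B) {u v : Fin r → ℝ}
    (huv : ∀ e, 0 ≤ coord B u e * coord B v e) : (dirFace B u ∩ dirFace B v).Nonempty := by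
  obtain ⟨x, hx⟩ := h.dirFace_nonempty (u + v)
  refine ⟨x, h.dirFace_subset (fun e he => ?_) hx, h.dirFace_subset (fun e he => ?_) hx⟩
  all_goals
    rw [map_add, Pi.add_apply, mul_add]
    have := mul_self_pos.mpr he
    linarith [huv e, mul_comm (coord B u e) (coord B v e)]

/-- A common point gives `‖u‖₁ + ‖v‖₁ ≤ ‖u + v‖₁`, hence equality in the triangle inequality at
every coordinate. -/
lemma mul_nonneg_of_dirFace_inter_nonempty (h : IsRegular B) {u v : Fin r → ℝ}
    (huv : (dirFace B u ∩ dirFace B v).Nonempty) (e : E) : 0 ≤ coord B u e * coord B v e := by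
  obtain ⟨x, ⟨hx, hxu⟩, -, hxv⟩ := huv
  have h1 := h.form_le hx (u + v)
  rw [map_add, hxu, hxv] at h1
  have h2 : ∑ e, (|coord B u e| + |coord B v e| - |coord B (u + v) e|) ≤ 0 := by
    simp only [Finset.sum_sub_distrib, Finset.sum_add_distrib]
    simp only [normOne] at h1
    linarith
  have hnn : ∀ e ∈ Finset.univ, 0 ≤ |coord B u e| + |coord B v e| - |coord B (u + v) e| := by
    intro e _
    rw [map_add, Pi.add_apply, sub_nonneg]
    exact abs_add_le _ _
  have h3 := (Finset.sum_eq_zero_iff_of_nonneg hnn).mp (le_antisymm h2 (Finset.sum_nonneg hnn)) e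
    (Finset.mem_univ e)
  rw [map_add, Pi.add_apply] at h3
  rcases abs_add_eq_add_abs_iff (coord B u e) (coord B v e) |>.mp (by linarith) with h | h
  · exact mul_nonneg h.1 h.2
  · exact mul_nonneg_of_nonpos_of_nonpos h.1 h.2

omit [Fintype E] in
lemma neg_vecMul_apply (v : Fin r → ℤ) (e : E) : ((-v) ᵥ* B) e = -(v ᵥ* B) e := by
  rw [Matrix.neg_vecMul]; rfl

omit [Fintype E] in
lemma IsSignVector.neg {v : Fin r → ℤ} (hv : IsSignVector B v) : IsSignVector B (-v) := by
  intro e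
  rw [Matrix.neg_vecMul, Pi.neg_apply, abs_neg]
  exact hv e

/-- Facets meet exactly when the coordinates of the lattice vectors have no opposite signs. -/
lemma IsRegular.bisectorFace_inter_nonempty_iff (h : IsRegular B) {u v : Fin r → ℤ}
    (hu : IsSignVector B u) (hv : IsSignVector B v) :
    (bisectorFace (B * Bᵀ) u ∩ bisectorFace (B * Bᵀ) v).Nonempty ↔
      ∀ e, 0 ≤ (u ᵥ* B) e * (v ᵥ* B) e := by
  rw [hu.bisectorFace_eq, hv.bisectorFace_eq]
  constructor
  · intro hne e
    have := mul_nonneg_of_dirFace_inter_nonempty h hne e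
    rw [coord_toReal, coord_toReal] at this
    exact_mod_cast this
  · intro hnn
    apply dirFace_inter_nonempty h
    intro e
    rw [coord_toReal, coord_toReal]
    exact_mod_cast hnn e

lemma IsRegular.meets_iff (h : IsRegular B) {u v : Fin r → ℤ}
    (hu : IsSignVector B u) (hv : IsSignVector B v) :
    ((bisectorFace (B * Bᵀ) u ∩ bisectorFace (B * Bᵀ) v).Nonempty ∨
      (bisectorFace (B * Bᵀ) u ∩ bisectorFace (B * Bᵀ) (-v)).Nonempty) ↔
      (∀ e, 0 ≤ (u ᵥ* B) e * (v ᵥ* B) e) ∨ (∀ e, (u ᵥ* B) e * (v ᵥ* B) e ≤ 0) := by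
  rw [h.bisectorFace_inter_nonempty_iff hu hv, h.bisectorFace_inter_nonempty_iff hu hv.neg]
  simp only [Matrix.neg_vecMul, Pi.neg_apply, mul_neg, Left.nonneg_neg_iff]

/-- `J` plays the role of the complement of a spanning tree, a minimal set of coordinates
determining a vector, and `c j` that of the fundamental circuit of `j`. -/
lemma exists_fundamental (h : IsRegular B) : ∃ (J : Finset E) (c : J → (Fin r → ℤ)),
    (∀ z, (∀ e ∈ J, coord B z e = 0) → z = 0) ∧ (∀ j, IsSignVector B (c j)) ∧
    (∀ j, (c j ᵥ* B) j = 1) ∧ ∀ j i : J, i ≠ j → (c j ᵥ* B) i = 0 := by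
  classical
  obtain ⟨J, hJ⟩ := (Set.toFinite
    {J : Finset E | ∀ z, (∀ e ∈ J, coord B z e = 0) → z = 0}).exists_minimal
    ⟨Finset.univ, fun z hz => h.inj z (funext fun e => hz e (Finset.mem_univ e))⟩
  have hc : ∀ j : J, ∃ c : Fin r → ℤ, IsSignVector B c ∧ (c ᵥ* B) j = 1 ∧
      ∀ i : J, i ≠ j → (c ᵥ* B) i = 0 := by
    intro j
    -- By minimality some nonzero vector vanishes on `J` without `j`. A sign vector conformal to it
    -- inherits these zeros.
    have hnot : ¬ ∀ z, (∀ e ∈ J.erase j, coord B z e = 0) → z = 0 := fun hcon =>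
      Finset.notMem_erase j.1 J (hJ.2 hcon (Finset.erase_subset _ _) j.2)
    push Not at hnot
    obtain ⟨z, hz, hz0⟩ := hnot
    obtain ⟨u, hu0, hus, huz⟩ := h.conformal z hz0
    have hui : ∀ i : J, i ≠ j → (u ᵥ* B) i = 0 := by
      intro i hij
      by_contra hne
      have := huz i hne
      rw [hz i (Finset.mem_erase.mpr ⟨fun h => hij (Subtype.ext h), i.2⟩), mul_zero] at this
      exact lt_irrefl _ this
    have huj : (u ᵥ* B) j ≠ 0 := by
      intro huj
      apply toReal_ne_zero hu0
      apply hJ.1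
      intro e he
      rw [coord_toReal]
      by_cases hej : e = j
      · rw [hej, huj, Int.cast_zero]
      · rw [hui ⟨e, he⟩ (fun h => hej (congrArg Subtype.val h)), Int.cast_zero]
    have h3 := abs_le.mp (hus j)
    obtain h4 | h4 : (u ᵥ* B) j = -1 ∨ (u ᵥ* B) j = 1 := by omega
    · refine ⟨-u, IsSignVector.neg hus, ?_, fun i hij => ?_⟩
      · rw [neg_vecMul_apply, h4]; rfl
      · rw [neg_vecMul_apply, hui i hij, neg_zero]
    · exact ⟨u, hus, h4, hui⟩
  choose c hcs hcj hci using hc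
  exact ⟨J, c, hJ.1, hcs, hcj, hci⟩

omit [Fintype E] in
lemma vecMul_sum_smul {J : Type*} [Fintype J] (a : J → ℤ) (c : J → (Fin r → ℤ)) (e : E) :
    ((∑ j, a j • c j) ᵥ* B) e = ∑ j, a j * (c j ᵥ* B) e := by
  rw [Matrix.sum_vecMul, Finset.sum_apply]
  exact Finset.sum_congr rfl fun j _ => by rw [Matrix.smul_vecMul]; rfl

/-- The fundamental basis is good. If two of its members had equal signs at one coordinate and
opposite signs at another, a sign vector conformal to their difference would have to be that
difference, which has an entry `±2`. -/
theorem IsRegular.exists_isGoodBasis (h : IsRegular B) : ∃ C, IsGoodBasis (B * Bᵀ) C := by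
  classical
  obtain ⟨J, c, hJ, hcs, hcj, hci⟩ := exists_fundamental h
  have hval : ∀ (a : J → ℤ) (i : J), ((∑ j, a j • c j) ᵥ* B) i = a i := by
    intro a i
    rw [vecMul_sum_smul, Finset.sum_eq_single i, hcj, mul_one]
    · intro j _ hj
      rw [hci j i hj.symm, mul_zero]
    · simp
  have hrep : ∀ v : Fin r → ℤ, v = ∑ j : J, (v ᵥ* B) j • c j := by
    intro v
    apply toReal_injective
    rw [← sub_eq_zero, ← toReal_sub]
    apply hJ
    intro e he
    rw [coord_toReal, Matrix.sub_vecMul, Pi.sub_apply, hval (fun j => (v ᵥ* B) j) ⟨e, he⟩,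
      sub_self, Int.cast_zero]
  have hli : LinearIndependent ℤ c := by
    rw [Fintype.linearIndependent_iff]
    intro a ha i
    rw [← hval a i, ha]; simp
  have hspan : ⊤ ≤ Submodule.span ℤ (Set.range c) := by
    intro v _
    rw [hrep v]
    exact Submodule.sum_mem _ fun j _ => Submodule.smul_mem _ _ (Submodule.subset_span ⟨j, rfl⟩)
  have hcard : Fintype.card J = r := by
    have h1 := Module.finrank_eq_card_basis (Module.Basis.mk hli hspan)
    rw [← h1, Module.finrank_fin_fun]
  let σ : Fin r ≃ J := (Fintype.equivFinOfCardEq hcard).symm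
  have hel : ∀ j, IsElementary B (c j) := by
    intro j
    refine ⟨fun h0 => ?_, hcs j, fun y hy => ⟨coord B y j, ?_⟩⟩
    · have := hcj j
      rw [h0] at this
      simp at this
    · rw [← sub_eq_zero]
      apply hJ
      intro e he
      rw [map_sub, map_smul, Pi.sub_apply, Pi.smul_apply, smul_eq_mul, coord_toReal]
      by_cases hej : e = j
      · rw [hej, hcj]; simp
      · have h0 := hci j ⟨e, he⟩ (fun h => hej (congrArg Subtype.val h))
        simp only at h0
        rw [h0, hy e (by rw [coord_toReal, h0, Int.cast_zero])]; simp
  refine ⟨c ∘ σ, hli.comp _ σ.injective, ?_, fun i => h.isFacet_of_isElementary (hel _), ?_⟩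
  · rw [σ.surjective.range_comp]; exact top_le_iff.mp hspan
  · intro i j hij
    rw [Function.comp_apply, Function.comp_apply, h.meets_iff (hcs _) (hcs _)]
    have hne : σ i ≠ σ j := σ.injective.ne hij
    generalize σ i = i at *
    generalize σ j = j at *
    by_contra hcon
    push Not at hcon
    -- Opposite signs occur at `g`, equal signs at `f`.
    obtain ⟨⟨g, hg⟩, f, hf⟩ := hcon
    have hw0 : c i - c j ≠ 0 := by
      intro h0
      have := congrArg (fun v => (v ᵥ* B) i.1) h0
      simp [Matrix.sub_vecMul, hcj, hci j i hne] at this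
    obtain ⟨u, hu0, hus, huz⟩ := h.conformal _ (toReal_ne_zero hw0)
    simp only [coord_toReal, Matrix.sub_vecMul, Pi.sub_apply] at huz
    replace huz : ∀ e, (u ᵥ* B) e ≠ 0 → 0 < (u ᵥ* B) e * ((c i ᵥ* B) e - (c j ᵥ* B) e) :=
      fun e he => by exact_mod_cast huz e he
    -- `c i - c j` vanishes on the rest of `J`, hence so does `u`, and only two coefficients remain.
    have hu : ∀ e, (u ᵥ* B) e = (u ᵥ* B) i * (c i ᵥ* B) e + (u ᵥ* B) j * (c j ᵥ* B) e := by
      intro e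
      conv_lhs => rw [hrep u, vecMul_sum_smul]
      rw [Fintype.sum_eq_add i j hne]
      rintro k ⟨hki, hkj⟩
      by_cases hk : (u ᵥ* B) k = 0
      · rw [hk, zero_mul]
      · have := huz k hk
        rw [hci i k hki, hci j k hkj] at this
        simp at this
    have hi := huz i
    have hj := huz j
    rw [hcj, hci j i hne] at hi
    rw [hcj, hci i j hne.symm] at hj
    have hif := abs_le.mp (hcs i f)
    have hjf := abs_le.mp (hcs j f)
    have hig := abs_le.mp (hcs i g)
    have hjg := abs_le.mp (hcs j g)
    have hui := abs_le.mp (hus i)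
    have huj := abs_le.mp (hus j)
    have hug := abs_le.mp (hus g)
    have hfeq : (c i ᵥ* B) f = (c j ᵥ* B) f ∧ (c i ᵥ* B) f ≠ 0 := by
      obtain h1 | h1 | h1 : (c i ᵥ* B) f = -1 ∨ (c i ᵥ* B) f = 0 ∨ (c i ᵥ* B) f = 1 := by omega
      all_goals rw [h1] at hf ⊢; omega
    have hgeq : (c i ᵥ* B) g = -(c j ᵥ* B) g ∧ (c i ᵥ* B) g ≠ 0 := by
      obtain h1 | h1 | h1 : (c i ᵥ* B) g = -1 ∨ (c i ᵥ* B) g = 0 ∨ (c i ᵥ* B) g = 1 := by omega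
      all_goals rw [h1] at hg ⊢; omega
    have huf : (u ᵥ* B) f = 0 := by
      by_contra hne
      have := huz f hne
      rw [hfeq.1, sub_self, mul_zero] at this
      exact lt_irrefl _ this
    -- The difference vanishes at `f`, so `u` does too, which makes the two coefficients opposite.
    have hab : (u ᵥ* B) i = -(u ᵥ* B) j := by
      have h1 := hu f
      rw [huf, ← hfeq.1, ← add_mul, eq_comm, mul_eq_zero] at h1
      have := h1.resolve_right hfeq.2
      omega
    have hui0 : (u ᵥ* B) i ≠ 0 := by
      intro h0
      apply hu0
      apply toReal_injective
      rw [toReal_zero]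
      apply h.inj
      ext e
      rw [coord_toReal, hu e, h0, show (u ᵥ* B) j = 0 by omega]
      simp
    have h1 := hi hui0
    have h2 := hu g
    rw [show (u ᵥ* B) i = 1 by omega, show (u ᵥ* B) j = -1 by omega] at h2
    omega

lemma IsRegular.isElementary_of_isGoodBasis (h : IsRegular B) {C : Fin r → (Fin r → ℤ)}
    (hC : IsGoodBasis (B * Bᵀ) C) (i : Fin r) : IsElementary B (C i) :=
  (h.isFacet_bisectorFace_iff _).mp (hC.isFacet i)

/-- Members of a good basis agree in sign up to a global sign. -/
lemma IsRegular.sign_of_isGoodBasis (h : IsRegular B) {C : Fin r → (Fin r → ℤ)}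
    (hC : IsGoodBasis (B * Bᵀ) C) (i j : Fin r) :
    (∀ e, 0 ≤ (C i ᵥ* B) e * (C j ᵥ* B) e) ∨ (∀ e, (C i ᵥ* B) e * (C j ᵥ* B) e ≤ 0) := by
  by_cases hij : i = j
  · subst hij
    exact Or.inl fun e => mul_self_nonneg _
  · exact (h.meets_iff (h.isElementary_of_isGoodBasis hC i).sign
      (h.isElementary_of_isGoodBasis hC j).sign).mp (hC.meets i j hij)

lemma abs_sum_eq_sum_abs {ι : Type*} [Fintype ι] {a : ι → ℤ} (h : (∀ i, 0 ≤ a i) ∨ ∀ i, a i ≤ 0) :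
    |∑ i, a i| = ∑ i, |a i| := by
  rcases h with h | h
  · rw [abs_of_nonneg (Finset.sum_nonneg fun i _ => h i)]
    exact Finset.sum_congr rfl fun i _ => (abs_of_nonneg (h i)).symm
  · rw [abs_of_nonpos (Finset.sum_nonpos fun i _ => h i), ← Finset.sum_neg_distrib]
    exact Finset.sum_congr rfl fun i _ => (abs_of_nonpos (h i)).symm

lemma abs_mul_eq_ite {a b : ℤ} (ha : |a| ≤ 1) (hb : |b| ≤ 1) :
    |a * b| = if a ≠ 0 ∧ b ≠ 0 then 1 else 0 := by
  have ha := abs_le.mp ha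
  have hb := abs_le.mp hb
  obtain h | h | h : a = -1 ∨ a = 0 ∨ a = 1 := by omega
  all_goals
    obtain h' | h' | h' : b = -1 ∨ b = 0 ∨ b = 1 := by omega
    all_goals subst h; subst h'; simp

/-- All products of corresponding entries have one sign and lie in {-1, 0, 1}, so nothing cancels.
-/
theorem IsRegular.abs_latticeForm_of_isGoodBasis (h : IsRegular B) {C : Fin r → (Fin r → ℤ)}
    (hC : IsGoodBasis (B * Bᵀ) C) (i j : Fin r) :
    |latticeForm (B * Bᵀ) (C i) (C j)| =
      ∑ e, if (C i ᵥ* B) e ≠ 0 ∧ (C j ᵥ* B) e ≠ 0 then 1 else 0 := by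
  rw [latticeForm_gram, abs_sum_eq_sum_abs (h.sign_of_isGoodBasis hC i j)]
  exact Finset.sum_congr rfl fun e _ => abs_mul_eq_ite
    ((h.isElementary_of_isGoodBasis hC i).sign e) ((h.isElementary_of_isGoodBasis hC j).sign e)

end Regular

section Regular

variable {E : Type*} {r : ℕ} {B : Matrix (Fin r) E ℤ} [Fintype E]

/-! ### The linear system -/

lemma IsRegular.not_participates_iff (h : IsRegular B) {v : Fin r → ℤ} (hv : IsSignVector B v)
    {c : EdgeClass (B * Bᵀ)} {e : E} (he : e ∈ h.classEdges c) :
    ¬ Participates c (bisectorFace (B * Bᵀ) v) ↔ (v ᵥ* B) e ≠ 0 := by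
  rw [hv.bisectorFace_eq, h.participates_iff he, coord_toReal, Int.cast_eq_zero]

/-- A coordinate in the class `c`. -/
noncomputable def IsRegular.rep (h : IsRegular B) (c : EdgeClass (B * Bᵀ)) : E :=
  (h.classEdges_nonempty c).some

lemma IsRegular.rep_mem (h : IsRegular B) (c : EdgeClass (B * Bᵀ)) : h.rep c ∈ h.classEdges c :=
  (h.classEdges_nonempty c).some_mem

lemma finsum_mem_setOf_eq_sum_ite {ι : Type*} [Fintype ι] (p : ι → Prop) [DecidablePred p]
    (n : ι → ℕ) : ∑ᶠ c ∈ {c | p c}, n c = ∑ c, if p c then n c else 0 := by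
  classical
  rw [finsum_mem_def, finsum_eq_sum_of_fintype]
  refine Finset.sum_congr rfl fun c _ => ?_
  simp [Set.indicator_apply]

/-- The length equations are the diagonal case of the intersection equations, and participation of a
class can be tested at a single representative coordinate. -/
theorem IsRegular.isSolution_iff (h : IsRegular B) [Fintype (EdgeClass (B * Bᵀ))]
    {C : Fin r → (Fin r → ℤ)} (hC : IsGoodBasis (B * Bᵀ) C) (n : EdgeClass (B * Bᵀ) → ℕ) :
    IsSolution (B * Bᵀ) C n ↔ (∀ c, 0 < n c) ∧ ∀ i j,
      ((∑ c, if (C i ᵥ* B) (h.rep c) ≠ 0 ∧ (C j ᵥ* B) (h.rep c) ≠ 0 then n c else 0 : ℕ) : ℤ) =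
        |latticeForm (B * Bᵀ) (C i) (C j)| := by
  classical
  have hs : ∀ i, IsSignVector B (C i) := fun i => (h.isElementary_of_isGoodBasis hC i).sign
  have h1 : ∀ i, ∑ᶠ c ∈ {c : EdgeClass (B * Bᵀ) |
      ¬ Participates c (bisectorFace (B * Bᵀ) (C i))}, n c =
      ∑ c, if (C i ᵥ* B) (h.rep c) ≠ 0 ∧ (C i ᵥ* B) (h.rep c) ≠ 0 then n c else 0 := by
    intro i
    rw [finsum_mem_setOf_eq_sum_ite]
    refine Finset.sum_congr rfl fun c _ => if_congr ?_ rfl rfl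
    rw [and_self, h.not_participates_iff (hs i) (h.rep_mem c)]
  have h2 : ∀ i j, ∑ᶠ c ∈ {c : EdgeClass (B * Bᵀ) |
      ¬ Participates c (bisectorFace (B * Bᵀ) (C i)) ∧
        ¬ Participates c (bisectorFace (B * Bᵀ) (C j))}, n c =
      ∑ c, if (C i ᵥ* B) (h.rep c) ≠ 0 ∧ (C j ᵥ* B) (h.rep c) ≠ 0 then n c else 0 := by
    intro i j
    rw [finsum_mem_setOf_eq_sum_ite]
    refine Finset.sum_congr rfl fun c _ => if_congr ?_ rfl rfl
    rw [h.not_participates_iff (hs i) (h.rep_mem c), h.not_participates_iff (hs j) (h.rep_mem c)]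
  have h3 : ∀ i, |latticeForm (B * Bᵀ) (C i) (C i)| = latticeForm (B * Bᵀ) (C i) (C i) := by
    intro i
    rw [latticeForm_gram]
    exact abs_of_nonneg (Finset.sum_nonneg fun e _ => mul_self_nonneg _)
  constructor
  · rintro ⟨hpos, hlen, hint⟩
    refine ⟨hpos, fun i j => ?_⟩
    by_cases hij : i = j
    · subst hij
      rw [h3, ← hlen, h1]
    · rw [← hint i j hij, h2]
  · rintro ⟨hpos, hall⟩
    refine ⟨hpos, fun i => ?_, fun i j _ => ?_⟩
    · rw [← h3, ← hall, h1]
    · rw [← hall, h2]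

lemma IsRegular.eq_zero_iff_of_mem_classEdges (h : IsRegular B) {c : EdgeClass (B * Bᵀ)} {e f : E}
    (he : e ∈ h.classEdges c) (hf : f ∈ h.classEdges c) (z : Fin r → ℝ) :
    coord B z e = 0 ↔ coord B z f = 0 := by
  have hp : ∀ e f, e ∈ h.classEdges c → f ∈ h.classEdges c → coord B z e = 0 →
      coord B z f = 0 := by
    intro e f he hf hz
    obtain ⟨t, ht⟩ := (h.mem_classEdges_iff he f).mp hf
    rw [ht, hz, mul_zero]
  exact ⟨hp e f he hf, hp f e hf he⟩

/-- Supports are unions of classes, so the common support can be counted class by class. -/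
theorem IsRegular.isSolution_ncard (h : IsRegular B) {C : Fin r → (Fin r → ℤ)}
    (hC : IsGoodBasis (B * Bᵀ) C) :
    IsSolution (B * Bᵀ) C fun c => (h.classEdges c).ncard := by
  classical
  have := h.finite_edgeClass
  have := Fintype.ofFinite (EdgeClass (B * Bᵀ))
  rw [h.isSolution_iff hC]
  refine ⟨fun c => (Set.ncard_pos (Set.toFinite _)).mpr (h.classEdges_nonempty c), fun i j => ?_⟩
  rw [h.abs_latticeForm_of_isGoodBasis hC, ← Finset.sum_fiberwise _ h.classOf]
  push_cast
  refine Finset.sum_congr rfl fun c _ => ?_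
  have hcard : ((h.classEdges c).ncard : ℤ) =
      ∑ e with h.classOf e = c, (1 : ℤ) := by
    rw [Finset.sum_const, nsmul_eq_mul, mul_one]
    congr 1
    rw [← Set.ncard_coe_finset]
    congr 1
    ext e
    simp [h.mem_classEdges_iff_classOf]
  have hite : ∀ e ∈ Finset.univ.filter (fun e => h.classOf e = c),
      (if (C i ᵥ* B) e ≠ 0 ∧ (C j ᵥ* B) e ≠ 0 then (1 : ℤ) else 0) =
      if (C i ᵥ* B) (h.rep c) ≠ 0 ∧ (C j ᵥ* B) (h.rep c) ≠ 0 then 1 else 0 := by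
    intro e he
    have he : e ∈ h.classEdges c := by
      rw [h.mem_classEdges_iff_classOf]; exact (Finset.mem_filter.mp he).2
    have h1 := fun k => h.eq_zero_iff_of_mem_classEdges he (h.rep_mem c) (toReal (C k))
    simp only [coord_toReal, Int.cast_eq_zero] at h1
    simp only [ne_eq, h1]
  rw [Finset.sum_congr rfl hite, hcard]
  split_ifs <;> simp

lemma mul_eq_sign_mul_ite {a b s : ℤ} (ha : |a| ≤ 1) (hb : |b| ≤ 1) (hs : s = 1 ∨ s = -1)
    (h : 0 ≤ s * (a * b)) : a * b = s * if a ≠ 0 ∧ b ≠ 0 then 1 else 0 := by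
  rw [← abs_mul_eq_ite ha hb]
  rcases hs with rfl | rfl
  · rw [abs_of_nonneg (by linarith), one_mul]
  · rw [abs_of_nonpos (by linarith)]; ring

theorem IsRegular.isSolution_unique (h : IsRegular B) {C : Fin r → (Fin r → ℤ)}
    (hC : IsGoodBasis (B * Bᵀ) C) {n n' : EdgeClass (B * Bᵀ) → ℕ}
    (hn : IsSolution (B * Bᵀ) C n) (hn' : IsSolution (B * Bᵀ) C n') : n = n' := by
  classical
  have := h.finite_edgeClass
  have := Fintype.ofFinite (EdgeClass (B * Bᵀ))
  rw [h.isSolution_iff hC] at hn hn'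
  set d : EdgeClass (B * Bᵀ) → ℤ := fun c => n c - n' c with hd
  -- The equations involve supports only. Since the signs of two basis vectors are consistent, each
  -- equation becomes, up to a global sign, the vanishing of this bilinear form on that pair.
  let Q : (Fin r → ℤ) → (Fin r → ℤ) → ℤ := fun u v =>
    ∑ c, d c * ((u ᵥ* B) (h.rep c) * (v ᵥ* B) (h.rep c))
  have hQC : ∀ i j, Q (C i) (C j) = 0 := by
    intro i j
    have hs : ∃ s : ℤ, (s = 1 ∨ s = -1) ∧ ∀ e, 0 ≤ s * ((C i ᵥ* B) e * (C j ᵥ* B) e) := by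
      rcases h.sign_of_isGoodBasis hC i j with hs | hs
      · exact ⟨1, Or.inl rfl, fun e => by rw [one_mul]; exact hs e⟩
      · exact ⟨-1, Or.inr rfl, fun e => by linarith [hs e]⟩
    obtain ⟨s, hs1, hs⟩ := hs
    have h1 : Q (C i) (C j) = s * ∑ c, d c *
        if (C i ᵥ* B) (h.rep c) ≠ 0 ∧ (C j ᵥ* B) (h.rep c) ≠ 0 then 1 else 0 := by
      rw [Finset.mul_sum]
      refine Finset.sum_congr rfl fun c _ => ?_
      rw [mul_eq_sign_mul_ite ((h.isElementary_of_isGoodBasis hC i).sign _)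
        ((h.isElementary_of_isGoodBasis hC j).sign _) hs1 (hs _)]
      ring
    have h2 := (hn.2 i j).trans (hn'.2 i j).symm
    push_cast at h2
    rw [← sub_eq_zero, ← Finset.sum_sub_distrib] at h2
    rw [h1]
    refine mul_eq_zero_of_right _ (Eq.trans (Finset.sum_congr rfl fun c _ => ?_) h2)
    split_ifs <;> simp [hd]
  have hQ1 : ∀ j u, Q u (C j) = 0 := by
    intro j u
    have hu : u ∈ Submodule.span ℤ (Set.range C) := by rw [hC.span_eq_top]; trivial
    induction hu using Submodule.span_induction with
    | mem x hx => obtain ⟨i, rfl⟩ := hx; exact hQC i j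
    | zero => simp [Q]
    | add x y _ _ hx hy =>
      simp only [Q, Matrix.add_vecMul, Pi.add_apply, add_mul, mul_add,
        Finset.sum_add_distrib] at hx hy ⊢
      rw [hx, hy, add_zero]
    | smul a x _ hx =>
      simp only [Q, Matrix.smul_vecMul, Pi.smul_apply, smul_eq_mul] at hx ⊢
      rw [Finset.sum_congr rfl fun c _ => show d c * (a * (x ᵥ* B) (h.rep c) *
        (C j ᵥ* B) (h.rep c)) = a * (d c * ((x ᵥ* B) (h.rep c) * (C j ᵥ* B) (h.rep c))) by ring,
        ← Finset.mul_sum, hx, mul_zero]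
  have hQ : ∀ u v, Q u v = 0 := by
    intro u v
    have hv : v ∈ Submodule.span ℤ (Set.range C) := by rw [hC.span_eq_top]; trivial
    induction hv using Submodule.span_induction with
    | mem x hx => obtain ⟨i, rfl⟩ := hx; exact hQ1 i u
    | zero => simp [Q]
    | add x y _ _ hx hy =>
      simp only [Q, Matrix.add_vecMul, Pi.add_apply, mul_add, Finset.sum_add_distrib] at hx hy ⊢
      rw [hx, hy, add_zero]
    | smul a x _ hx =>
      simp only [Q, Matrix.smul_vecMul, Pi.smul_apply, smul_eq_mul] at hx ⊢
      rw [Finset.sum_congr rfl fun c _ => show d c * ((u ᵥ* B) (h.rep c) *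
        (a * (x ᵥ* B) (h.rep c))) = a * (d c * ((u ᵥ* B) (h.rep c) * (x ᵥ* B) (h.rep c))) by ring,
        ← Finset.mul_sum, hx, mul_zero]
  -- On a sign vector `u` the value `Q u u` is linear in the absolute values, and conformal sums
  -- preserve such identities.
  have habs : ∀ z, ∑ c, (d c : ℝ) * |coordFun B (h.rep c) z| = 0 := by
    intro z
    simp only [coordFun_apply]
    induction z using h.induction with
    | h0 => simp
    | hadd u t z hu ht hadd hz =>
      simp only [hadd, mul_add, Finset.sum_add_distrib, hz, zero_add]
      have h1 : ∑ c, (d c : ℝ) * |coord B (toReal u) (h.rep c)| = 0 := by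
        have h2 := hQ u u
        simp only [Q, mul_self_eq_abs_of_abs_le_one (hu _)] at h2
        simp only [coord_toReal]
        exact_mod_cast h2
      rw [Finset.sum_congr rfl fun c _ => show (d c : ℝ) * (t * |coord B (toReal u) (h.rep c)|) =
        t * (d c * |coord B (toReal u) (h.rep c)|) by ring, ← Finset.mul_sum, h1, mul_zero]
  funext c
  obtain ⟨y, hy⟩ := h.col_ne (h.rep c)
  have hsum := sum_parallel_eq_zero _ _ habs c y
  rw [Finset.sum_eq_single c] at hsum
  · have h1 : (d c : ℝ) = 0 := (mul_eq_zero.mp hsum).resolve_right (abs_ne_zero.mpr hy)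
    have h2 : d c = 0 := by exact_mod_cast h1
    simp only [hd] at h2
    omega
  · intro c' hc' hne
    exfalso
    apply hne
    have hp : ParallelCoords B (h.rep c) (h.rep c') :=
      exists_mul_eq_of_ker_le (Finset.mem_filter.mp hc').2
    exact h.eq_of_mem_classEdges (h.rep_mem c')
      ((h.mem_classEdges_iff (h.rep_mem c) _).mpr hp)
  · intro hc
    exact absurd (Finset.mem_filter.mpr ⟨Finset.mem_univ _, fun _ hz => hz⟩) hc

/-! ### The Gram matrix determines the columns up to signs and order -/

/-- The Voronoi cell depends on the Gram matrix only, so a point attaining the bound for `B` obeys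
the bound for `B'`. -/
lemma IsRegular.normOne_le_of_gram_eq {E' : Type*} [Fintype E'] {B' : Matrix (Fin r) E' ℤ}
    (h : IsRegular B) (h' : IsRegular B') (hA : B * Bᵀ = B' * B'ᵀ) (z : Fin r → ℝ) :
    normOne B z ≤ normOne B' z := by
  obtain ⟨x, hx, hxz⟩ := h.dirFace_nonempty z
  rw [hA] at hx
  have h1 := h'.form_le hx z
  rw [gramForm_eq, ← hA, ← gramForm_eq, hxz] at h1
  linarith

lemma IsRegular.exists_isSignVector_ne_zero (h : IsRegular B) (e : E) :
    ∃ u, IsSignVector B u ∧ (u ᵥ* B) e ≠ 0 := by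
  by_contra hcon
  push Not at hcon
  obtain ⟨z, hz⟩ := h.col_ne e
  apply hz
  induction z using h.induction with
  | h0 => simp
  | hadd u t z hu ht hadd hz' =>
    have hze : coord B z e = 0 := by_contra fun hne => hne (hz' hne)
    rw [map_add, map_smul, Pi.add_apply, Pi.smul_apply, hze, coord_toReal, hcon u hu]
    simp

/-- Evaluate at a sign vector that is nonzero at `e`: its coordinate at `e'` is a nonzero integer,
while the one at `e` is at most `1` in absolute value. -/
lemma IsRegular.one_le_abs_of_coord_eq {E' : Type*} [Fintype E'] {B' : Matrix (Fin r) E' ℤ}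
    (h : IsRegular B) {e : E} {e' : E'} {t : ℝ} (ht0 : t ≠ 0)
    (ht : ∀ z, coord B' z e' = t * coord B z e) : 1 ≤ |t| := by
  obtain ⟨u, hu, hue⟩ := h.exists_isSignVector_ne_zero e
  have h1 := ht (toReal u)
  rw [coord_toReal, coord_toReal] at h1
  have h2 : (u ᵥ* B') e' ≠ 0 := by
    intro h0
    rw [h0, Int.cast_zero, eq_comm, mul_eq_zero, Int.cast_eq_zero] at h1
    exact h1.elim ht0 hue
  have h3 : (1 : ℝ) ≤ |((u ᵥ* B') e' : ℝ)| := by exact_mod_cast Int.one_le_abs h2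
  have h4 : |((u ᵥ* B) e : ℝ)| ≤ 1 := by exact_mod_cast hu e
  rw [h1, abs_mul] at h3
  nlinarith [abs_nonneg t]

lemma IsRegular.abs_coord_eq {E' : Type*} [Fintype E'] {B' : Matrix (Fin r) E' ℤ}
    (h : IsRegular B) (h' : IsRegular B') {e : E} {e' : E'}
    (hee : ∀ z, coord B z e = 0 → coord B' z e' = 0) (z : Fin r → ℝ) :
    |coord B' z e'| = |coord B z e| := by
  obtain ⟨t, ht⟩ := exists_mul_eq_of_ker_le (φ := coordFun B e) (ψ := coordFun B' e') hee
  simp only [coordFun_apply] at ht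
  have ht0 : t ≠ 0 := by
    rintro rfl
    obtain ⟨y, hy⟩ := h'.col_ne e'
    simp [ht] at hy
  have h1 := h.one_le_abs_of_coord_eq ht0 ht
  have ht' : ∀ z, coord B z e = t⁻¹ * coord B' z e' := fun z => by
    rw [ht z, inv_mul_cancel_left₀ ht0]
  have h2 := h'.one_le_abs_of_coord_eq (inv_ne_zero ht0) ht'
  rw [abs_inv, one_le_inv₀ (abs_pos.mpr ht0)] at h2
  rw [ht, abs_mul, le_antisymm h2 h1, one_mul]

/-- The l¹-norms agree. With weight `1` on `E` and `-1` on `E'`, independence of absolute values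
shows that each function `|w i|` occurs equally often on both sides; the bijections of the fibres
are then glued. -/
theorem IsRegular.exists_equiv_of_gram_eq {E' : Type*} [Fintype E'] {B' : Matrix (Fin r) E' ℤ}
    (h : IsRegular B) (h' : IsRegular B') (hA : B * Bᵀ = B' * B'ᵀ) :
    ∃ σ : E ≃ E', ∀ e z, |coord B' z (σ e)| = |coord B z e| := by
  classical
  let w : E ⊕ E' → Module.Dual ℝ (Fin r → ℝ) := Sum.elim (coordFun B) (coordFun B')
  let d : E ⊕ E' → ℝ := Sum.elim (fun _ => 1) (fun _ => -1)
  have hd : ∀ z, ∑ i, d i * |w i z| = 0 := by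
    intro z
    rw [Fintype.sum_sum_type]
    have := le_antisymm (h.normOne_le_of_gram_eq h' hA z) (h'.normOne_le_of_gram_eq h hA.symm z)
    simp only [normOne] at this
    simp [w, d, coordFun_apply, this]
  have hw : ∀ i j, (∀ z, w i z = 0 → w j z = 0) → ∀ z, |w j z| = |w i z| := by
    rintro (e | e) (f | f) hef z
    · exact h.abs_coord_eq h hef z
    · exact h.abs_coord_eq h' hef z
    · exact h'.abs_coord_eq h hef z
    · exact h'.abs_coord_eq h' hef z
  have hne : ∀ i, ∃ y, w i y ≠ 0 := by
    rintro (e | e)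
    · exact h.col_ne e
    · exact h'.col_ne e
  let κ : E ⊕ E' → ((Fin r → ℝ) → ℝ) := fun i z => |w i z|
  have hκ : ∀ i j, (∀ z, w i z = 0 → w j z = 0) ↔ κ j = κ i := by
    refine fun i j => ⟨fun hij => funext (hw i j hij), fun hij z hz => ?_⟩
    have := congrFun hij z
    simpa [κ, hz] using this
  have hcard : ∀ i, Fintype.card {e : E // κ (Sum.inl e) = κ i} =
      Fintype.card {e : E' // κ (Sum.inr e) = κ i} := by
    intro i
    obtain ⟨y, hy⟩ := hne i
    have hsum := sum_parallel_eq_zero w d hd i y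
    rw [Finset.sum_filter, Finset.sum_congr rfl fun j _ => show _ =
      (if κ j = κ i then d j else 0) * |w i y| by
        by_cases hj : κ j = κ i
        · rw [if_pos ((hκ i j).mpr hj), if_pos hj, hw i j ((hκ i j).mpr hj)]
        · rw [if_neg (fun hc => hj ((hκ i j).mp hc)), if_neg hj, zero_mul],
      ← Finset.sum_mul, mul_eq_zero, or_iff_left (abs_ne_zero.mpr hy),
      Fintype.sum_sum_type] at hsum
    simp only [d, Sum.elim_inl, Sum.elim_inr, ← Finset.sum_filter, Finset.sum_const,
      nsmul_eq_mul, mul_one, mul_neg] at hsum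
    rw [Fintype.card_subtype, Fintype.card_subtype]
    have h2 : ((Finset.univ.filter fun e => κ (Sum.inl e) = κ i).card : ℝ) =
      (Finset.univ.filter fun e => κ (Sum.inr e) = κ i).card := by linarith
    exact_mod_cast h2
  have hcard' : ∀ q, Nonempty ({e : E // κ (Sum.inl e) = q} ≃ {e : E' // κ (Sum.inr e) = q}) := by
    intro q
    by_cases hq : ∃ i, κ i = q
    · obtain ⟨i, rfl⟩ := hq
      exact ⟨Fintype.equivOfCardEq (hcard i)⟩
    · push Not at hq
      have := Subtype.isEmpty_of_false (p := fun e : E => κ (Sum.inl e) = q) fun e => hq _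
      have := Subtype.isEmpty_of_false (p := fun e : E' => κ (Sum.inr e) = q) fun e => hq _
      exact ⟨Equiv.equivOfIsEmpty _ _⟩
  let τ := fun q => (hcard' q).some
  refine ⟨(Equiv.sigmaFiberEquiv fun e => κ (Sum.inl e)).symm.trans
    ((Equiv.sigmaCongrRight τ).trans (Equiv.sigmaFiberEquiv fun e => κ (Sum.inr e))), fun e z => ?_⟩
  have := (τ (κ (Sum.inl e)) ⟨e, rfl⟩).2
  exact congrFun this z

end Regular

/-! ### Circulations on directed multigraphs -/

section Circulation

variable {E α R : Type*} [Fintype E] [CommRing R] {tail head : E → α}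

open Classical in
/-- The net inflow of `f` at the vertex `x`. -/
noncomputable def boundary (tail head : E → α) (f : E → R) (x : α) : R :=
  ∑ e, f e * ((if head e = x then 1 else 0) - (if tail e = x then 1 else 0))

/-- The net inflow vanishes at every vertex. -/
def IsCirculation (tail head : E → α) (f : E → R) : Prop := ∀ x, boundary tail head f x = 0

lemma boundary_add (f g : E → R) (x : α) :
    boundary tail head (f + g) x = boundary tail head f x + boundary tail head g x := by
  simp [boundary, add_mul, Finset.sum_add_distrib]

lemma boundary_sum {ι : Type*} (s : Finset ι) (f : ι → E → R) (x : α) :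
    boundary tail head (∑ i ∈ s, f i) x = ∑ i ∈ s, boundary tail head (f i) x := by
  simp only [boundary, Finset.sum_apply, Finset.sum_mul]
  exact Finset.sum_comm

open Classical in
lemma boundary_single [DecidableEq E] (e : E) (a : R) (x : α) : boundary tail head (Pi.single e a) x =
    a * ((if head e = x then 1 else 0) - (if tail e = x then 1 else 0)) := by
  rw [boundary, Finset.sum_eq_single e]
  · rw [Pi.single_eq_same]
  · intro f _ hf
    rw [Pi.single_eq_of_ne hf, zero_mul]
  · simp

lemma boundary_intCast (a : E → ℤ) (x : α) :
    boundary tail head (fun e => (a e : ℝ)) x = (boundary tail head a x : ℤ) := by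
  classical
  simp [boundary]

lemma isCirculation_intCast_iff (a : E → ℤ) :
    IsCirculation tail head (fun e => (a e : ℝ)) ↔ IsCirculation tail head a := by
  simp only [IsCirculation, boundary_intCast, Int.cast_eq_zero]

lemma IsCirculation.sum_smul {ι : Type*} [Fintype ι] {f : ι → E → R}
    (hf : ∀ i, IsCirculation tail head (f i)) (z : ι → R) :
    IsCirculation tail head (fun e => ∑ i, z i * f i e) := by
  classical
  intro x
  have h : ∀ i, ∑ e, z i * (f i e * ((if head e = x then 1 else 0) -
      (if tail e = x then 1 else 0))) = 0 := fun i => by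
    rw [← Finset.mul_sum]
    exact mul_eq_zero_of_right _ (hf i x)
  simp only [boundary, Finset.sum_mul]
  rw [Finset.sum_comm]
  refine Finset.sum_eq_zero fun i _ => ?_
  simp only [mul_assoc]
  exact h i

/-- Circulations are orthogonal to potential differences. -/
lemma IsCirculation.sum_mul_sub {f : E → R} (hf : IsCirculation tail head f) (p : α → R) :
    ∑ e, f e * (p (head e) - p (tail e)) = 0 := by
  classical
  let S := Finset.univ.image head ∪ Finset.univ.image tail
  have hS : ∀ g : E → α, (∀ e, g e ∈ S) → ∀ e, p (g e) = ∑ x ∈ S, p x * if g e = x then 1 else 0 := by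
    intro g hg e
    simp [hg e]
  have hh := hS head fun e => Finset.mem_union_left _ (Finset.mem_image_of_mem _ (Finset.mem_univ e))
  have ht := hS tail fun e =>
    Finset.mem_union_right _ (Finset.mem_image_of_mem _ (Finset.mem_univ e))
  have h1 : ∀ e, f e * (p (head e) - p (tail e)) =
      ∑ x ∈ S, p x * (f e * ((if head e = x then 1 else 0) - (if tail e = x then 1 else 0))) := by
    intro e
    rw [hh e, ht e, ← Finset.sum_sub_distrib, Finset.mul_sum]
    exact Finset.sum_congr rfl fun x _ => by ring
  rw [Finset.sum_congr rfl fun e _ => h1 e, Finset.sum_comm]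
  refine Finset.sum_eq_zero fun x _ => ?_
  rw [← Finset.mul_sum]
  exact mul_eq_zero_of_right _ (hf x)

/-- A closed walk with signs recording the direction of traversal. -/
def IsSignedWalk (tail head : E → α) (k : ℕ) (v : Fin (k + 1) → α) (e : Fin (k + 1) → E)
    (s : Fin (k + 1) → ℤ) : Prop :=
  ∀ i, (s i = 1 ∧ tail (e i) = v i ∧ head (e i) = v (i + 1)) ∨
    (s i = -1 ∧ head (e i) = v i ∧ tail (e i) = v (i + 1))

/-- By conservation, a vertex entered by the flow is also left by it. Choosing one exit edge per
vertex gives a self-map of a finite set, and a periodic orbit of that map is the desired closed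
walk. -/
theorem exists_conformal_walk {f : E → ℝ} (hf : IsCirculation tail head f) (hf0 : f ≠ 0) :
    ∃ (k : ℕ) (v : Fin (k + 1) → α) (e : Fin (k + 1) → E) (s : Fin (k + 1) → ℤ),
      v.Injective ∧ e.Injective ∧ IsSignedWalk tail head k v e s ∧
      ∀ i, 0 < (s i : ℝ) * f (e i) := by
  classical
  let src : E → α := fun e => if 0 < f e then tail e else head e
  let tgt : E → α := fun e => if 0 < f e then head e else tail e
  -- If no flow left the target of `e`, every term of the net inflow there would be nonnegative, and
  -- the term of `e` positive.
  have hstep : ∀ e, f e ≠ 0 → ∃ e', f e' ≠ 0 ∧ src e' = tgt e := by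
    intro e he
    by_contra hcon
    push Not at hcon
    have h1 : ∀ d, f d * ((if head d = tgt e then 1 else 0) - (if tail d = tgt e then 1 else 0)) =
        |f d| * (if tgt d = tgt e then 1 else 0) := by
      intro d
      by_cases hd : f d = 0
      · simp [hd]
      · have h2 := hcon d hd
        by_cases hpos : 0 < f d
        · simp only [src, tgt, if_pos hpos] at h2 ⊢
          rw [if_neg h2, abs_of_pos hpos, sub_zero]
        · have hneg : f d < 0 := lt_of_le_of_ne (not_lt.mp hpos) hd
          simp only [src, tgt, if_neg hpos] at h2 ⊢
          rw [if_neg h2, abs_of_neg hneg]; ring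
    have h2 := hf (tgt e)
    rw [boundary, Finset.sum_congr rfl fun d _ => by convert h1 d,
      Finset.sum_eq_zero_iff_of_nonneg fun d _ => by positivity] at h2
    have h3 := h2 e (Finset.mem_univ e)
    simp [he] at h3
  let X := {x : α // ∃ e, f e ≠ 0 ∧ src e = x}
  choose out hout0 houts using fun x : X => x.2
  let step : X → X := fun x => ⟨tgt (out x), hstep _ (hout0 x)⟩
  have hfin : Finite X := by
    refine Finite.of_surjective (fun e : {e // f e ≠ 0} => (⟨src e.1, e.1, e.2, rfl⟩ : X)) ?_
    rintro ⟨x, e, he, rfl⟩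
    exact ⟨⟨e, he⟩, rfl⟩
  obtain ⟨e₀, he₀⟩ : ∃ e, f e ≠ 0 := by
    by_contra hcon
    push Not at hcon
    exact hf0 (funext hcon)
  obtain ⟨x, hx⟩ : ∃ x, x ∈ Function.periodicPts step := by
    obtain ⟨m, n, hmn, heq⟩ := Finite.exists_ne_map_eq_of_infinite
      fun n : ℕ => step^[n] ⟨src e₀, e₀, he₀, rfl⟩
    wlog hlt : m < n generalizing m n
    · exact this n m hmn.symm heq.symm (by omega)
    refine ⟨step^[m] ⟨src e₀, e₀, he₀, rfl⟩, n - m, by omega, ?_⟩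
    rw [Function.IsPeriodicPt, Function.IsFixedPt, ← Function.iterate_add_apply, heq,
      Nat.sub_add_cancel hlt.le]
  -- Within one minimal period the vertices are distinct, hence so are their exit edges.
  obtain ⟨k, hk⟩ : ∃ k, Function.minimalPeriod step x = k + 1 :=
    Nat.exists_eq_succ_of_ne_zero (Function.minimalPeriod_pos_of_mem_periodicPts hx).ne'
  let w : Fin (k + 1) → X := fun i => step^[i.1] x
  have hwinj : w.Injective := by
    intro i j hij
    apply Fin.ext
    exact Function.iterate_injOn_Iio_minimalPeriod (f := step) (x := x)
      (by rw [hk]; exact i.2) (by rw [hk]; exact j.2) hij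
  have hwsucc : ∀ i, w (i + 1) = step (w i) := by
    intro i
    simp only [w]
    rw [← Function.iterate_succ_apply' step, ← Function.iterate_mod_minimalPeriod_eq (n := i.1.succ),
      hk]
    congr 1
    rw [Fin.val_add, Nat.succ_eq_add_one, Fin.val_one']
    simp
  refine ⟨k, fun i => (w i).1, fun i => out (w i), fun i => if 0 < f (out (w i)) then 1 else -1,
    Subtype.val_injective.comp hwinj, fun i j hij => hwinj (Subtype.ext ?_), fun i => ?_,
    fun i => ?_⟩
  · rw [← houts (w i), ← houts (w j)]
    exact congrArg src hij
  · have h1 := houts (w i)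
    have h2 : (w (i + 1)).1 = tgt (out (w i)) := by rw [hwsucc]
    by_cases hpos : 0 < f (out (w i))
    · simp only [src, tgt, if_pos hpos] at h1 h2 ⊢
      exact Or.inl ⟨trivial, h1, h2.symm⟩
    · simp only [src, tgt, if_neg hpos] at h1 h2 ⊢
      exact Or.inr ⟨trivial, h1, h2.symm⟩
  · have h0 := hout0 (w i)
    by_cases hpos : 0 < f (out (w i))
    · simp [hpos]
    · simp only [if_neg hpos]
      push_cast
      have : f (out (w i)) < 0 := lt_of_le_of_ne (not_lt.mp hpos) h0
      linarith

variable {k : ℕ} {v : Fin (k + 1) → α} {e : Fin (k + 1) → E} {s : Fin (k + 1) → ℤ}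

omit [Fintype E] in
lemma IsSignedWalk.sq_eq_one (h : IsSignedWalk tail head k v e s) (i : Fin (k + 1)) :
    s i * s i = 1 := by
  rcases h i with ⟨hs, -⟩ | ⟨hs, -⟩ <;> simp [hs]

omit [Fintype E] in
open Classical in
lemma IsSignedWalk.indicator_sub (h : IsSignedWalk tail head k v e s) (i : Fin (k + 1)) (x : α) :
    ((if head (e i) = x then 1 else 0) - (if tail (e i) = x then 1 else 0) : ℝ) =
      s i * ((if v (i + 1) = x then 1 else 0) - (if v i = x then 1 else 0)) := by
  rcases h i with ⟨hs, h1, h2⟩ | ⟨hs, h1, h2⟩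
  · rw [hs, h1, h2]; push_cast; ring
  · rw [hs, h1, h2]; push_cast; ring

open Classical in
/-- The signed sum of the edges of a walk. -/
noncomputable def walkVec (e : Fin (k + 1) → E) (s : Fin (k + 1) → ℤ) : E → ℤ :=
  ∑ i, Pi.single (e i) (s i)

omit [Fintype E] in
lemma walkVec_apply (he : e.Injective) (i : Fin (k + 1)) : walkVec e s (e i) = s i := by
  classical
  rw [walkVec, Finset.sum_apply, Finset.sum_eq_single i]
  · simp
  · intro j _ hj
    exact Pi.single_eq_of_ne (he.ne hj.symm) _
  · simp

omit [Fintype E] in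
lemma walkVec_of_notMem {d : E} (hd : d ∉ Set.range e) : walkVec e s d = 0 := by
  classical
  rw [walkVec, Finset.sum_apply]
  exact Finset.sum_eq_zero fun j _ => Pi.single_eq_of_ne (fun h => hd ⟨j, h.symm⟩) _

lemma IsSignedWalk.isCirculation (h : IsSignedWalk tail head k v e s) :
    IsCirculation tail head (walkVec e s) := by
  classical
  rw [← isCirculation_intCast_iff]
  intro x
  rw [boundary_intCast, walkVec, boundary_sum]
  push_cast [boundary_single]
  have h1 : ∀ i, (s i : ℝ) * ((if head (e i) = x then 1 else 0) - (if tail (e i) = x then 1 else 0))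
      = (if v (i + 1) = x then 1 else 0) - (if v i = x then 1 else 0) := by
    intro i
    rw [h.indicator_sub, ← mul_assoc]
    have := h.sq_eq_one i
    rw [show (s i : ℝ) * s i = 1 by exact_mod_cast this, one_mul]
  rw [Finset.sum_congr rfl fun i _ => h1 i, Finset.sum_sub_distrib, sub_eq_zero]
  exact Equiv.sum_comp (Equiv.addRight (1 : Fin (k + 1))) fun i => if v i = x then (1 : ℝ) else 0

/-- The circulations supported on a simple closed walk are the multiples of its signed sum. -/
theorem IsSignedWalk.eq_smul (h : IsSignedWalk tail head k v e s) (hv : v.Injective)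
    (he : e.Injective) {y : E → ℝ} (hy : IsCirculation tail head y)
    (hsupp : ∀ d ∉ Set.range e, y d = 0) : ∃ t : ℝ, ∀ d, y d = t * walkVec e s d := by
  classical
  have h1 : ∀ x, ∑ i, (s i * y (e i)) * ((if v (i + 1) = x then 1 else 0) -
      (if v i = x then 1 else 0)) = 0 := by
    intro x
    have h2 := hy x
    rw [boundary, ← Finset.sum_subset (Finset.subset_univ (Finset.univ.image e)),
      Finset.sum_image (fun i _ j _ hij => he hij)] at h2
    · refine Eq.trans (Finset.sum_congr rfl fun i _ => ?_) h2
      have := h.indicator_sub i x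
      rw [mul_comm (s i : ℝ), mul_assoc, ← this]
    · intro d _ hd
      rw [hsupp d (fun ⟨i, hi⟩ => hd (Finset.mem_image.mpr ⟨i, Finset.mem_univ i, hi⟩)), zero_mul]
  -- Conservation at `v (j + 1)`: what arrives along edge `j` leaves along edge `j + 1`.
  have h2 : ∀ j, (s (j + 1) : ℝ) * y (e (j + 1)) = s j * y (e j) := by
    intro j
    have h3 := h1 (v (j + 1))
    simp only [mul_sub, Finset.sum_sub_distrib, hv.eq_iff, add_left_inj, mul_ite, mul_one, mul_zero,
      Finset.sum_ite_eq', Finset.mem_univ, if_true] at h3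
    linarith
  have h3 : ∀ j, (s j : ℝ) * y (e j) = s 0 * y (e 0) := by
    intro j
    induction j using Fin.induction with
    | zero => rfl
    | succ i ih =>
      rw [← Fin.coeSucc_eq_succ, h2, ih]
  refine ⟨s 0 * y (e 0), fun d => ?_⟩
  by_cases hd : d ∈ Set.range e
  · obtain ⟨i, rfl⟩ := hd
    rw [walkVec_apply he, ← h3 i]
    have := h.sq_eq_one i
    have h4 : (s i : ℝ) * s i = 1 := by exact_mod_cast this
    linear_combination (-y (e i)) * h4
  · rw [walkVec_of_notMem hd, hsupp d hd]; simp

omit [Fintype E] in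
lemma IsSignedWalk.abs_walkVec_le (h : IsSignedWalk tail head k v e s) (he : e.Injective) (d : E) :
    |walkVec e s d| ≤ 1 := by
  by_cases hd : d ∈ Set.range e
  · obtain ⟨i, rfl⟩ := hd
    rw [walkVec_apply he]
    rcases h i with ⟨hs, -⟩ | ⟨hs, -⟩ <;> simp [hs]
  · simp [walkVec_of_notMem hd]

omit [Fintype E] in
lemma IsSignedWalk.walkVec_ne_zero_iff (h : IsSignedWalk tail head k v e s) (he : e.Injective)
    (d : E) : walkVec e s d ≠ 0 ↔ d ∈ Set.range e := by
  refine ⟨fun hd => by_contra fun hcon => hd (walkVec_of_notMem hcon), ?_⟩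
  rintro ⟨i, rfl⟩
  rw [walkVec_apply he]
  rcases h i with ⟨hs, -⟩ | ⟨hs, -⟩ <;> simp [hs]

/-! ### Regularity -/

variable {r : ℕ} {B : Matrix (Fin r) E ℤ}

lemma isCirculation_coord (hB : ∀ i, IsCirculation tail head (B i)) (z : Fin r → ℝ) :
    IsCirculation tail head (coord B z) :=
  IsCirculation.sum_smul (f := fun i e => (B i e : ℝ))
    (fun i => (isCirculation_intCast_iff _).mpr (hB i)) z

/-- The conformal walk of a real circulation is itself a circulation with entries in {-1, 0, 1}.
Only these finitely many circulations have to be generated by the rows, which makes regularity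
checkable. -/
theorem isRegular_of_circulations (hinj : ∀ z, coord B z = 0 → z = 0)
    (hB : ∀ i, IsCirculation tail head (B i))
    (hgen : ∀ a : E → ℤ, (∀ d, |a d| ≤ 1) → IsCirculation tail head a → ∃ u, u ᵥ* B = a)
    (hcol : ∀ d, ∃ i, B i d ≠ 0) : IsRegular B where
  inj := hinj
  conformal z hz := by
    obtain ⟨k, v, e, s, hv, he, hw, hpos⟩ := exists_conformal_walk (isCirculation_coord hB z)
      (fun h => hz (hinj z h))
    obtain ⟨u, hu⟩ := hgen _ (hw.abs_walkVec_le he) hw.isCirculation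
    refine ⟨u, ?_, fun d => by rw [hu]; exact hw.abs_walkVec_le he d, fun d hd => ?_⟩
    · rintro rfl
      have h1 := congrFun hu (e 0)
      exact (hw.walkVec_ne_zero_iff he _).mpr ⟨0, rfl⟩ (by rw [← h1]; simp)
    · rw [hu] at hd ⊢
      obtain ⟨i, rfl⟩ := (hw.walkVec_ne_zero_iff he d).mp hd
      rw [walkVec_apply he]
      exact hpos i
  col_ne d := by
    classical
    obtain ⟨i, hi⟩ := hcol d
    refine ⟨toReal (Pi.single i 1), ?_⟩
    rw [coord_toReal]
    simpa using hi

/-- Independence passes from `ℤ` to `ℝ` through the Gram determinant, an integer that is nonzero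
because the form is definite on integer vectors. -/
lemma coord_injective_of_vecMul (h : ∀ u : Fin r → ℤ, u ᵥ* B = 0 → u = 0) (z : Fin r → ℝ)
    (hz : coord B z = 0) : z = 0 := by
  have hdet : (B * Bᵀ).det ≠ 0 := by
    intro h0
    obtain ⟨u, hu0, hu⟩ := Matrix.exists_vecMul_eq_zero_iff.mpr h0
    apply hu0
    apply h
    have h1 : latticeForm (B * Bᵀ) u u = 0 := by
      rw [latticeForm, Matrix.dotProduct_mulVec, hu, zero_dotProduct]
    rw [latticeForm_gram, Finset.sum_eq_zero_iff_of_nonneg fun e _ => mul_self_nonneg _] at h1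
    ext e
    simpa using h1 e (Finset.mem_univ e)
  by_contra hz0
  apply hdet
  have h1 : ((B * Bᵀ).map (Int.cast : ℤ → ℝ)).det = 0 := by
    apply Matrix.exists_mulVec_eq_zero_iff.mp
    refine ⟨z, hz0, ?_⟩
    ext i
    have h2 := gramForm_apply (B := B) (Pi.single i 1) z
    rw [gramForm_eq, realForm, single_one_dotProduct] at h2
    rw [Pi.zero_apply]
    refine Eq.trans h2 ?_
    simp [hz]
  have h2 := (Int.castRingHom ℝ).map_det (B * Bᵀ)
  rw [RingHom.mapMatrix_apply] at h2
  have h3 : ((B * Bᵀ).det : ℝ) = 0 := h2.trans h1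
  exact_mod_cast h3

end Circulation


/-! ### The flow lattice of a graph, its circuits and its 2-cuts -/

section GraphFlows

variable {α β : Type*} {G : Graph α β} [Fintype E(G)] {o : Orientation G} {r : ℕ}

lemma mem_flowLattice_iff (a : E(G) → ℤ) :
    a ∈ flowLattice o ↔ IsCirculation o.tail o.head a := by
  classical
  have h : ∀ x, boundary o.tail o.head a x =
      ∑ e with o.head e = x, a e - ∑ e with o.tail e = x, a e := by
    intro x
    simp [boundary, mul_sub, Finset.sum_filter]
  constructor
  · intro ha x
    by_cases hx : x ∈ V(G)
    · rw [h]
      convert ha x hx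
    · refine Finset.sum_eq_zero fun e _ => ?_
      rw [if_neg, if_neg, sub_zero, mul_zero]
      · rintro rfl; exact hx (o.isLink e).left_mem
      · rintro rfl; exact hx (o.isLink e).right_mem
  · intro ha x _
    have := ha x
    rw [h] at this
    convert this

/-- The matrix whose rows are the basis flows. -/
noncomputable def flowMatrix (b : Module.Basis (Fin r) ℤ (flowLattice o)) : Matrix (Fin r) E(G) ℤ :=
  fun i e => (b i : E(G) → ℤ) e

variable {b : Module.Basis (Fin r) ℤ (flowLattice o)}

lemma gramMatrix_eq : gramMatrix b = flowMatrix b * (flowMatrix b)ᵀ := by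
  ext i j
  simp [gramMatrix, pairing, Matrix.mul_apply, flowMatrix]

lemma flowOf_eq (v : Fin r → ℤ) : flowOf b v = v ᵥ* flowMatrix b := by
  ext e
  simp [flowOf, Matrix.vecMul, dotProduct, flowMatrix]

lemma isCirculation_flowMatrix (i : Fin r) : IsCirculation o.tail o.head (flowMatrix b i) :=
  (mem_flowLattice_iff _).mp (b i).2

lemma exists_vecMul_eq {a : E(G) → ℤ} (ha : IsCirculation o.tail o.head a) :
    ∃ u, u ᵥ* flowMatrix b = a := by
  refine ⟨fun i => b.repr ⟨a, (mem_flowLattice_iff a).mpr ha⟩ i, ?_⟩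
  rw [← flowOf_eq, flowOf, b.sum_repr]

lemma flowMatrix_injective {u : Fin r → ℤ} (hu : u ᵥ* flowMatrix b = 0) : u = 0 := by
  rw [← flowOf_eq] at hu
  have h : ∑ i, u i • b i = 0 := Subtype.ext hu
  exact funext (Fintype.linearIndependent_iff.mp b.linearIndependent u h)

/-- Two vertices joined by a walk avoiding `F` are joined by an integral chain avoiding `F`. -/
lemma exists_chain {F : Set β} {x y : α}
    (h : Relation.ReflTransGen (G.deleteEdges F).Adj x y) :
    open Classical in
    ∃ p : E(G) → ℤ, (∀ e, e.1 ∈ F → p e = 0) ∧ ∀ z, boundary o.tail o.head p z =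
      (if y = z then 1 else 0) - (if x = z then 1 else 0) := by
  classical
  induction h with
  | refl => exact ⟨0, fun _ _ => rfl, fun z => by simp [boundary]⟩
  | @tail y w _ hadj ih =>
    obtain ⟨p, hp, hpz⟩ := ih
    obtain ⟨d, hd⟩ := hadj
    rw [Graph.deleteEdges_isLink] at hd
    obtain ⟨hd, hdF⟩ := hd
    have hstep : ∃ s : ℤ, ∀ z, boundary o.tail o.head (Pi.single ⟨d, hd.edge_mem⟩ s) z =
        (if w = z then 1 else 0) - (if y = z then 1 else 0) := by
      rcases (o.isLink ⟨d, hd.edge_mem⟩).eq_and_eq_or_eq_and_eq hd with ⟨h1, h2⟩ | ⟨h1, h2⟩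
      · refine ⟨1, fun z => ?_⟩
        rw [boundary_single, h1, h2, one_mul]
      · refine ⟨-1, fun z => ?_⟩
        rw [boundary_single, h1, h2]; ring
    obtain ⟨s, hs⟩ := hstep
    refine ⟨p + Pi.single ⟨d, hd.edge_mem⟩ s, fun e he => ?_, fun z => ?_⟩
    · rw [Pi.add_apply, hp e he, Pi.single_eq_of_ne, add_zero]
      rintro rfl
      exact hdF he
    · rw [boundary_add, hpz, hs]; ring

/-- If the graph stays connected without `F`, each edge of `F` lies on a flow avoiding the rest. -/
lemma exists_flow_through {F : Set β} (hF : Connected (G.deleteEdges F)) {e : E(G)}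
    (he : e.1 ∈ F) : ∃ u : Fin r → ℤ, (u ᵥ* flowMatrix b) e = 1 ∧
      ∀ f, f.1 ∈ F → f ≠ e → (u ᵥ* flowMatrix b) f = 0 := by
  classical
  -- A chain from the head of `e` back to its tail, avoiding `F`, closes `e` up to a flow.
  obtain ⟨p, hp, hpz⟩ := exists_chain (o := o) (hF.2 (o.head e) (o.isLink e).right_mem
    (o.tail e) (o.isLink e).left_mem)
  have hcirc : IsCirculation o.tail o.head (p + Pi.single e 1) := by
    intro z
    rw [boundary_add, hpz, boundary_single]; ring
  obtain ⟨u, hu⟩ := exists_vecMul_eq (b := b) hcirc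
  refine ⟨u, ?_, fun f hf hfe => ?_⟩
  · rw [hu, Pi.add_apply, hp e he, Pi.single_eq_same, zero_add]
  · rw [hu, Pi.add_apply, hp f hf, Pi.single_eq_of_ne hfe, zero_add]

theorem isRegular_flowMatrix (hG : TwoEdgeConnected G) : IsRegular (flowMatrix b) :=
  isRegular_of_circulations (coord_injective_of_vecMul fun _ => flowMatrix_injective)
    isCirculation_flowMatrix (fun _ _ ha => exists_vecMul_eq ha) fun d => by
      obtain ⟨u, hu, -⟩ := exists_flow_through (b := b) (hG.2 d.1 d.2) (Set.mem_singleton d.1)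
      by_contra hcon
      push Not at hcon
      simp [Matrix.vecMul, dotProduct, hcon] at hu

/-! ### Circuits -/

omit [Fintype E(G)] in
lemma isCircuitElement_iff (a : E(G) → ℤ) : IsCircuitElement o a ↔
    ∃ k v e s, IsSimpleClosedWalk G k v e ∧ IsSignedWalk o.tail o.head k v e s ∧
      a = walkVec e s := by
  constructor
  · rintro ⟨k, v, e, hw, s, hs, ha⟩
    exact ⟨k, v, e, s, hw, hs, ha.trans (by rw [walkVec]; congr!)⟩
  · rintro ⟨k, v, e, s, hw, hs, ha⟩
    exact ⟨k, v, e, hw, s, hs, ha.trans (by rw [walkVec]; congr!)⟩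

omit [Fintype E(G)] in
lemma IsSignedWalk.isSimpleClosedWalk {k : ℕ} {v : Fin (k + 1) → α} {e : Fin (k + 1) → E(G)}
    {s : Fin (k + 1) → ℤ} (h : IsSignedWalk o.tail o.head k v e s) (hv : v.Injective)
    (he : e.Injective) : IsSimpleClosedWalk G k v e := by
  refine ⟨hv, he, fun i => ?_⟩
  have := o.isLink (e i)
  rcases h i with ⟨-, h1, h2⟩ | ⟨-, h1, h2⟩
  · rwa [h1, h2] at this
  · rw [h1, h2] at this; exact this.symm

/-- An elementary vector dominates a circuit and, by minimality of its support, is proportional to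
it. Conversely, a flow supported on a circuit is a multiple of that circuit. -/
theorem isElementary_iff_isCircuitElement (hG : TwoEdgeConnected G) (v : Fin r → ℤ) :
    IsElementary (flowMatrix b) v ↔ IsCircuitElement o (flowOf b v) := by
  have hreg := isRegular_flowMatrix (b := b) hG
  rw [flowOf_eq, isCircuitElement_iff]
  constructor
  · intro hv
    have hcirc := isCirculation_coord (isCirculation_flowMatrix (b := b)) (toReal v)
    obtain ⟨k, x, e, s, hx, he, hw, hpos⟩ := exists_conformal_walk hcirc
      (fun h0 => toReal_ne_zero hv.ne_zero (hreg.inj _ h0))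
    refine ⟨k, x, e, s, hw.isSimpleClosedWalk hx he, hw, ?_⟩
    obtain ⟨u, hu⟩ := exists_vecMul_eq (b := b) hw.isCirculation
    have hmem : toReal u ∈ supportSpace (flowMatrix b) (toReal v) := by
      intro d hd
      rw [coord_toReal, hu, Int.cast_eq_zero]
      by_contra hne
      obtain ⟨i, rfl⟩ := (hw.walkVec_ne_zero_iff he d).mp hne
      have := hpos i
      rw [hd, mul_zero] at this
      exact lt_irrefl _ this
    obtain ⟨t, ht⟩ := hv.eq_smul _ hmem
    have h1 : ∀ d, (walkVec e s d : ℝ) = t * ((v ᵥ* flowMatrix b) d : ℝ) := by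
      intro d
      rw [← hu, ← coord_toReal, ht, map_smul, Pi.smul_apply, smul_eq_mul, coord_toReal]
    have h2 := hpos 0
    have h3 := h1 (e 0)
    rw [walkVec_apply he] at h3
    rw [coord_toReal] at h2
    have hs := hw.sq_eq_one 0
    have hve := abs_le.mp (hv.sign (e 0))
    -- At `e 0` both vectors have entry `±1`, with the same sign.
    have ht1 : t = 1 := by
      obtain hv1 | hv1 | hv1 : (v ᵥ* flowMatrix b) (e 0) = -1 ∨ (v ᵥ* flowMatrix b) (e 0) = 0 ∨
        (v ᵥ* flowMatrix b) (e 0) = 1 := by omega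
      all_goals
        rw [hv1] at h2 h3
        rcases mul_self_eq_one_iff.mp hs with hs1 | hs1
        all_goals
          rw [hs1] at h2 h3
          push_cast at h2 h3
          linarith
    funext d
    have := h1 d
    rw [ht1, one_mul] at this
    exact_mod_cast this.symm
  · rintro ⟨k, x, e, s, hsw, hw, hv⟩
    refine ⟨?_, fun d => by rw [hv]; exact hw.abs_walkVec_le hsw.2.1 d, fun y hy => ?_⟩
    · rintro rfl
      refine (hw.walkVec_ne_zero_iff hsw.2.1 (e 0)).mpr ⟨0, rfl⟩ ?_
      rw [← hv]; simp
    · obtain ⟨t, ht⟩ := hw.eq_smul hsw.1 hsw.2.1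
        (isCirculation_coord (isCirculation_flowMatrix (b := b)) y) (fun d hd => by
          apply hy
          rw [coord_toReal, hv, walkVec_of_notMem hd, Int.cast_zero])
      refine ⟨t, ?_⟩
      rw [← sub_eq_zero]
      apply hreg.inj
      ext d
      rw [map_sub, map_smul, Pi.sub_apply, Pi.smul_apply, smul_eq_mul, coord_toReal, hv, ht,
        sub_self, Pi.zero_apply]

theorem isCircuit_iff (hG : TwoEdgeConnected G) (X : Set E(G)) :
    IsCircuit G X ↔ ∃ v, IsElementary (flowMatrix b) v ∧ X = edgeSupport (flowOf b v) := by
  constructor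
  · rintro ⟨k, x, e, hsw, rfl⟩
    have hs : ∀ i, ∃ s : ℤ, (s = 1 ∧ o.tail (e i) = x i ∧ o.head (e i) = x (i + 1)) ∨
        (s = -1 ∧ o.head (e i) = x i ∧ o.tail (e i) = x (i + 1)) := by
      intro i
      rcases (o.isLink (e i)).eq_and_eq_or_eq_and_eq (hsw.2.2 i) with h | h
      · exact ⟨1, Or.inl ⟨rfl, h⟩⟩
      · exact ⟨-1, Or.inr ⟨rfl, h.2, h.1⟩⟩
    choose s hs using hs
    have hw : IsSignedWalk o.tail o.head k x e s := hs
    obtain ⟨u, hu⟩ := exists_vecMul_eq (b := b) hw.isCirculation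
    refine ⟨u, ?_, ?_⟩
    · rw [isElementary_iff_isCircuitElement hG, flowOf_eq, isCircuitElement_iff]
      exact ⟨k, x, e, s, hsw, hw, hu⟩
    · ext d
      rw [flowOf_eq, hu]
      exact (hw.walkVec_ne_zero_iff hsw.2.1 d).symm
  · rintro ⟨v, hv, rfl⟩
    rw [isElementary_iff_isCircuitElement hG, isCircuitElement_iff] at hv
    obtain ⟨k, x, e, s, hsw, hw, hv⟩ := hv
    refine ⟨k, x, e, hsw, ?_⟩
    ext d
    rw [hv]
    exact hw.walkVec_ne_zero_iff hsw.2.1 d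

/-! ### 2-cuts -/

/-- Flows are orthogonal to the potential difference of the indicator of a component. That
difference is supported on `e` and `f`, so it is a linear relation between these two coordinates. -/
lemma parallelCoords_of_not_connected (hG : TwoEdgeConnected G) {e f : E(G)}
    (h : ¬ Connected (G.deleteEdges {e.1, f.1})) : ParallelCoords (flowMatrix b) e f := by
  classical
  have hreg := isRegular_flowMatrix (b := b) hG
  have hx : ∃ x ∈ V(G), ∃ y ∈ V(G),
      ¬ Relation.ReflTransGen (G.deleteEdges {e.1, f.1}).Adj x y := by
    by_contra hcon
    push Not at hcon
    exact h ⟨hG.1.1, hcon⟩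
  obtain ⟨x, hx, y, hy, hxy⟩ := hx
  let p : α → ℝ := fun w =>
    if Relation.ReflTransGen (G.deleteEdges {e.1, f.1}).Adj x w then 1 else 0
  have hp : ∀ d : E(G), d ≠ e → d ≠ f → p (o.head d) - p (o.tail d) = 0 := by
    intro d hde hdf
    have hadj : (G.deleteEdges {e.1, f.1}).Adj (o.tail d) (o.head d) := by
      refine ⟨d.1, ?_⟩
      rw [Graph.deleteEdges_isLink]
      refine ⟨o.isLink d, ?_⟩
      rintro (hd | hd)
      · exact hde (Subtype.ext hd)
      · exact hdf (Subtype.ext hd)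
    have : Relation.ReflTransGen (G.deleteEdges {e.1, f.1}).Adj x (o.head d) ↔
        Relation.ReflTransGen (G.deleteEdges {e.1, f.1}).Adj x (o.tail d) :=
      ⟨fun hr => hr.tail hadj.symm, fun hr => hr.tail hadj⟩
    simp [p, this]
  have hnot : ¬ ∀ d : E(G), p (o.head d) - p (o.tail d) = 0 := by
    intro hall
    have hconst : ∀ w, Relation.ReflTransGen G.Adj x w → p w = p x := by
      intro w hw
      induction hw with
      | refl => rfl
      | tail _ hadj ih =>
        obtain ⟨d, hd⟩ := hadj
        rw [← ih]
        have := hall ⟨d, hd.edge_mem⟩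
        rcases (o.isLink ⟨d, hd.edge_mem⟩).eq_and_eq_or_eq_and_eq hd with ⟨h1, h2⟩ | ⟨h1, h2⟩
        · rw [h1, h2] at this; linarith
        · rw [h1, h2] at this; linarith
    have h1 := hconst y (hG.1.2 x hx y hy)
    simp [p, hxy, Relation.ReflTransGen.refl] at h1
  have hflow : ∀ z, ∑ d, coord (flowMatrix b) z d * (p (o.head d) - p (o.tail d)) = 0 := fun z =>
    (isCirculation_coord isCirculation_flowMatrix z).sum_mul_sub p
  by_cases hef : e = f
  · subst hef; exact .refl e
  set ce := p (o.head e) - p (o.tail e) with hce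
  set cf := p (o.head f) - p (o.tail f) with hcf
  have hsum : ∀ z, coord (flowMatrix b) z e * ce + coord (flowMatrix b) z f * cf = 0 := by
    intro z
    rw [← hflow z, Fintype.sum_eq_add e f hef]
    rintro d ⟨hde, hdf⟩
    rw [hp d hde hdf, mul_zero]
  -- Some flow passes through `e`, so `cf = 0` would force `ce = 0`, and the potential would be
  -- constant on the connected graph `G`.
  have hcf0 : cf ≠ 0 := by
    intro h0
    have hce0 : ce = 0 := by
      obtain ⟨z, hz⟩ := hreg.col_ne e
      have := hsum z
      rw [h0, mul_zero, add_zero] at this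
      exact (mul_eq_zero.mp this).resolve_left hz
    apply hnot
    intro d
    by_cases hde : d = e
    · rw [hde]; exact hce0
    · by_cases hdf : d = f
      · rw [hdf]; exact h0
      · exact hp d hde hdf
  refine ⟨-ce / cf, fun z => ?_⟩
  have := hsum z
  field_simp
  linarith

/-- If `G` stayed connected without both edges, some flow would be `1` on `f` and `0` on `e`, which
excludes proportionality. -/
theorem parallelCoords_iff (hG : TwoEdgeConnected G) (e f : E(G)) :
    ParallelCoords (flowMatrix b) e f ↔ e = f ∨ IsTwoCut G e f := by
  constructor
  · rintro ⟨t, ht⟩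
    refine or_iff_not_imp_left.mpr fun hef => ⟨hef, fun hconn => ?_⟩
    obtain ⟨u, hu1, hu2⟩ := exists_flow_through (b := b) hconn (e := f) (by simp)
    have h1 := ht (toReal u)
    rw [coord_toReal, coord_toReal, hu1, hu2 e (by simp) hef] at h1
    simp at h1
  · rintro (rfl | h)
    · exact .refl e
    · exact parallelCoords_of_not_connected hG h.2

end GraphFlows


section Primitive

/-! ### Integer arithmetic and bounded quantifiers are primitive recursive -/

lemma primrec_of_encode_int {α : Type*} [Primcodable α] {f : α → ℤ}
    (h : Primrec fun a => Encodable.encode (f a)) : Primrec f := Primrec.encode_iff.mp h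

/-- Codes of nonnegative integers are even and codes of negative ones odd, so the sign is a parity.
Integer arithmetic then reduces to natural arithmetic on `z.toNat` and `(-z).toNat`. -/
lemma encode_natCast_int (n : ℕ) : Encodable.encode (n : ℤ) = 2 * n := rfl

lemma encode_negSucc_int (n : ℕ) : Encodable.encode (Int.negSucc n) = 2 * n + 1 := rfl

lemma primrec_int_toNat : Primrec Int.toNat := by
  have h : Primrec fun z : ℤ => if Encodable.encode z % 2 = 0 then Encodable.encode z / 2 else 0 :=
    Primrec.ite (Primrec.eq.comp (Primrec.nat_mod.comp Primrec.encode (Primrec.const 2))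
      (Primrec.const 0)) (Primrec.nat_div.comp Primrec.encode (Primrec.const 2)) (Primrec.const 0)
  refine h.of_eq fun z => ?_
  cases z with
  | ofNat n =>
    rw [Int.ofNat_eq_natCast, encode_natCast_int, if_pos (by omega)]; simp
  | negSucc n =>
    rw [encode_negSucc_int, if_neg (by omega)]; simp

lemma primrec_int_neg_toNat : Primrec fun z : ℤ => (-z).toNat := by
  have h : Primrec fun z : ℤ => if Encodable.encode z % 2 = 0 then 0 else
      Encodable.encode z / 2 + 1 :=
    Primrec.ite (Primrec.eq.comp (Primrec.nat_mod.comp Primrec.encode (Primrec.const 2))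
      (Primrec.const 0)) (Primrec.const 0)
      (Primrec.succ.comp (Primrec.nat_div.comp Primrec.encode (Primrec.const 2)))
  refine h.of_eq fun z => ?_
  cases z with
  | ofNat n =>
    rw [Int.ofNat_eq_natCast, encode_natCast_int, if_pos (by omega)]; simp
  | negSucc n =>
    rw [encode_negSucc_int, if_neg (by omega), Int.neg_negSucc]
    simp only [Int.toNat_natCast]
    omega

lemma primrec_int_sub_cast : Primrec₂ fun a b : ℕ => (a : ℤ) - b := by
  apply primrec_of_encode_int
  have h : Primrec fun p : ℕ × ℕ => if p.2 ≤ p.1 then 2 * (p.1 - p.2) else 2 * (p.2 - p.1 - 1) + 1 :=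
    Primrec.ite (Primrec.nat_le.comp Primrec.snd Primrec.fst)
      (Primrec.nat_mul.comp (Primrec.const 2) (Primrec.nat_sub.comp Primrec.fst Primrec.snd))
      (Primrec.succ.comp (Primrec.nat_mul.comp (Primrec.const 2) (Primrec.nat_sub.comp
        (Primrec.nat_sub.comp Primrec.snd Primrec.fst) (Primrec.const 1))))
  refine h.of_eq fun p => ?_
  by_cases hp : p.2 ≤ p.1
  · rw [if_pos hp]
    simp only
    rw [← Nat.cast_sub hp, encode_natCast_int]
  · rw [if_neg hp]
    simp only
    rw [show (p.1 : ℤ) - p.2 = Int.negSucc (p.2 - p.1 - 1) by omega, encode_negSucc_int]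

lemma primrec_int_add : Primrec₂ fun a b : ℤ => a + b := by
  have h : Primrec fun p : ℤ × ℤ => ((p.1.toNat + p.2.toNat : ℕ) : ℤ) -
      ((-p.1).toNat + (-p.2).toNat : ℕ) :=
    primrec_int_sub_cast.comp
      (Primrec.nat_add.comp (primrec_int_toNat.comp .fst) (primrec_int_toNat.comp .snd))
      (Primrec.nat_add.comp (primrec_int_neg_toNat.comp .fst) (primrec_int_neg_toNat.comp .snd))
  exact h.of_eq fun p => by simp only; omega

lemma primrec_int_mul : Primrec₂ fun a b : ℤ => a * b := by
  have h : Primrec fun p : ℤ × ℤ =>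
      ((p.1.toNat * p.2.toNat + (-p.1).toNat * (-p.2).toNat : ℕ) : ℤ) -
      (p.1.toNat * (-p.2).toNat + (-p.1).toNat * p.2.toNat : ℕ) :=
    primrec_int_sub_cast.comp
      (Primrec.nat_add.comp
        (Primrec.nat_mul.comp (primrec_int_toNat.comp .fst) (primrec_int_toNat.comp .snd))
        (Primrec.nat_mul.comp (primrec_int_neg_toNat.comp .fst) (primrec_int_neg_toNat.comp .snd)))
      (Primrec.nat_add.comp
        (Primrec.nat_mul.comp (primrec_int_toNat.comp .fst) (primrec_int_neg_toNat.comp .snd))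
        (Primrec.nat_mul.comp (primrec_int_neg_toNat.comp .fst) (primrec_int_toNat.comp .snd)))
  refine h.of_eq fun p => ?_
  have h1 : ∀ z : ℤ, z = (z.toNat : ℤ) - ((-z).toNat : ℤ) := fun z => by omega
  conv_rhs => rw [h1 p.1, h1 p.2]
  push_cast
  ring

lemma primrec_pow (b : ℕ) : Primrec fun n : ℕ => b ^ n := by
  have h : Primrec (Nat.rec 1 fun _ x => x * b : ℕ → ℕ) :=
    Primrec.nat_rec₁ 1 (Primrec.nat_mul.comp Primrec.snd (Primrec.const b))
  refine h.of_eq fun n => ?_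
  induction n with
  | zero => rfl
  | succ n ih => rw [pow_succ, ← ih]

variable {α : Type*} [Primcodable α]

lemma primrec_sum_range {n : α → ℕ} {f : α → ℕ → ℤ} (hn : Primrec n) (hf : Primrec₂ f) :
    Primrec fun a => ∑ e ∈ Finset.range (n a), f a e := by
  have h := Primrec.nat_rec' (h := fun a p => p.2 + f a p.1) hn (Primrec.const (0 : ℤ))
    (primrec_int_add.comp (Primrec.snd.comp Primrec.snd)
      (hf.comp Primrec.fst (Primrec.fst.comp Primrec.snd)))
  refine h.of_eq fun a => ?_
  induction n a with
  | zero => rfl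
  | succ k ih => rw [Finset.sum_range_succ, ← ih]

lemma primrecPred_forall_lt {n : α → ℕ} {p : α → ℕ → Prop} (hn : Primrec n)
    (hp : PrimrecPred fun q : α × ℕ => p q.1 q.2) : PrimrecPred fun a => ∀ x < n a, p a x := by
  have h : PrimrecRel fun (x : ℕ) (a : α) => p a x :=
    PrimrecPred.comp (f := fun q : ℕ × α => (q.2, q.1)) hp (Primrec.pair Primrec.snd Primrec.fst)
  refine (PrimrecRel.comp (f := fun a => List.range (n a)) (g := fun a => a)
    (PrimrecRel.forall_mem_list h) (Primrec.list_range.comp hn) Primrec.id).of_eq fun a => ?_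
  simp

lemma primrecPred_exists_lt {n : α → ℕ} {p : α → ℕ → Prop} (hn : Primrec n)
    (hp : PrimrecPred fun q : α × ℕ => p q.1 q.2) : PrimrecPred fun a => ∃ x < n a, p a x := by
  have h : PrimrecRel fun (x : ℕ) (a : α) => p a x :=
    PrimrecPred.comp (f := fun q : ℕ × α => (q.2, q.1)) hp (Primrec.pair Primrec.snd Primrec.fst)
  refine (PrimrecRel.comp (f := fun a => List.range (n a)) (g := fun a => a)
    (PrimrecRel.exists_mem_list h) (Primrec.list_range.comp hn) Primrec.id).of_eq fun a => ?_
  simp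

lemma primrecPred_imp {p q : α → Prop} (hp : PrimrecPred p) (hq : PrimrecPred q) :
    PrimrecPred fun a => p a → q a :=
  (hp.not.or hq).of_eq fun _ => imp_iff_not_or.symm

lemma primrecPred_eq {β : Type*} [Primcodable β] [DecidableEq β] {f g : α → β} (hf : Primrec f)
    (hg : Primrec g) : PrimrecPred fun a => f a = g a :=
  Primrec.eq.comp hf hg

/-! ### Certificates -/

/-- An entry of a list of lists of integers. -/
def entry (L : List (List ℤ)) (i e : ℕ) : ℤ := (L.getD i []).getD e 0

lemma primrec_entry {L : α → List (List ℤ)} {i e : α → ℕ} (hL : Primrec L) (hi : Primrec i)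
    (he : Primrec e) : Primrec fun a => entry (L a) (i a) (e a) :=
  (Primrec.list_getD 0).comp ((Primrec.list_getD []).comp hL hi) he

/-- The `e`-th sign of the sign vector coded by `k`: its `e`-th ternary digit, modulo `3`. -/
def codeSign (k e : ℕ) : ℤ :=
  if k / 3 ^ e % 3 = 1 then 1 else if k / 3 ^ e % 3 = 2 then -1 else 0

lemma primrec_codeSign {k e : α → ℕ} (hk : Primrec k) (he : Primrec e) :
    Primrec fun a => codeSign (k a) (e a) := by
  have hd : Primrec fun a => k a / 3 ^ e a % 3 :=
    Primrec.nat_mod.comp (Primrec.nat_div.comp hk ((primrec_pow 3).comp he)) (Primrec.const 3)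
  exact Primrec.ite (primrecPred_eq hd (Primrec.const 1)) (Primrec.const 1)
    (Primrec.ite (primrecPred_eq hd (Primrec.const 2)) (Primrec.const (-1)) (Primrec.const 0))

/-- A directed multigraph on the natural numbers: the number of edges, their tails and heads. -/
abbrev ListGraph := ℕ × List ℕ × List ℕ

/-- The edge count. -/
def ListGraph.size (g : ListGraph) : ℕ := g.1

/-- The tail of an edge. -/
def ListGraph.tail (g : ListGraph) (e : ℕ) : ℕ := g.2.1.getD e 0

/-- The head of an edge. -/
def ListGraph.head (g : ListGraph) (e : ℕ) : ℕ := g.2.2.getD e 0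

lemma ListGraph.primrec_size : Primrec ListGraph.size := Primrec.fst

lemma ListGraph.primrec_tail : Primrec₂ ListGraph.tail :=
  (Primrec.list_getD 0).comp (Primrec.fst.comp (Primrec.snd.comp Primrec.fst)) Primrec.snd

lemma ListGraph.primrec_head : Primrec₂ ListGraph.head :=
  (Primrec.list_getD 0).comp (Primrec.snd.comp (Primrec.snd.comp Primrec.fst)) Primrec.snd

/-- The net inflow of `s` at `x`. -/
def ListGraph.inflow (g : ListGraph) (s : ℕ → ℤ) (x : ℕ) : ℤ :=
  ∑ e ∈ Finset.range g.size,
    s e * ((if g.head e = x then 1 else 0) + if g.tail e = x then -1 else 0)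

/-- The net inflow vanishes at every endpoint of an edge. -/
def ListGraph.IsFlow (g : ListGraph) (s : ℕ → ℤ) : Prop :=
  ∀ e < g.size, g.inflow s (g.head e) = 0 ∧ g.inflow s (g.tail e) = 0

/-- The sign vector coded by `k` is nonzero. -/
def ListGraph.IsNonzero (g : ListGraph) (k : ℕ) : Prop := ∃ e < g.size, codeSign k e ≠ 0

/-- The support of `k` is contained in that of `l`. -/
def ListGraph.SupportLe (g : ListGraph) (k l : ℕ) : Prop :=
  ∀ e < g.size, codeSign k e ≠ 0 → codeSign l e ≠ 0

/-- The sign vector coded by `k` is a nonzero flow of minimal support. -/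
def ListGraph.IsMinimalFlow (g : ListGraph) (k : ℕ) : Prop :=
  g.IsFlow (codeSign k) ∧ g.IsNonzero k ∧ ∀ l < 3 ^ g.size, g.IsFlow (codeSign l) →
    g.IsNonzero l → g.SupportLe l k → g.SupportLe k l

/-- The support of the sign vector coded by `k`, as a list of truth values. -/
def ListGraph.row (g : ListGraph) (k : ℕ) : List Bool :=
  (List.range g.size).map fun e => decide (codeSign k e ≠ 0)

variable {g : α → ListGraph}

lemma primrec_inflow {s : α → ℕ → ℤ} {x : α → ℕ} (hg : Primrec g) (hs : Primrec₂ s)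
    (hx : Primrec x) : Primrec fun a => (g a).inflow (s a) (x a) := by
  refine primrec_sum_range (ListGraph.primrec_size.comp hg) ?_
  refine primrec_int_mul.comp hs (primrec_int_add.comp ?_ ?_)
  · exact Primrec.ite (primrecPred_eq
      (ListGraph.primrec_head.comp (hg.comp Primrec.fst) Primrec.snd)
      (hx.comp Primrec.fst)) (Primrec.const 1) (Primrec.const 0)
  · exact Primrec.ite (primrecPred_eq
      (ListGraph.primrec_tail.comp (hg.comp Primrec.fst) Primrec.snd)
      (hx.comp Primrec.fst)) (Primrec.const (-1)) (Primrec.const 0)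

lemma primrecPred_isFlow {s : α → ℕ → ℤ} (hg : Primrec g) (hs : Primrec₂ s) :
    PrimrecPred fun a => (g a).IsFlow (s a) := by
  refine primrecPred_forall_lt (ListGraph.primrec_size.comp hg) (PrimrecPred.and ?_ ?_)
  · exact primrecPred_eq (primrec_inflow (hg.comp Primrec.fst)
      (hs.comp (Primrec.fst.comp Primrec.fst) Primrec.snd)
      (ListGraph.primrec_head.comp (hg.comp Primrec.fst) Primrec.snd)) (Primrec.const 0)
  · exact primrecPred_eq (primrec_inflow (hg.comp Primrec.fst)
      (hs.comp (Primrec.fst.comp Primrec.fst) Primrec.snd)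
      (ListGraph.primrec_tail.comp (hg.comp Primrec.fst) Primrec.snd)) (Primrec.const 0)

lemma primrecPred_codeSign_ne_zero {k e : α → ℕ} (hk : Primrec k) (he : Primrec e) :
    PrimrecPred fun a => codeSign (k a) (e a) ≠ 0 :=
  (primrecPred_eq (primrec_codeSign hk he) (Primrec.const 0)).not

lemma primrecPred_isFlow_codeSign {k : α → ℕ} (hg : Primrec g) (hk : Primrec k) :
    PrimrecPred fun a => (g a).IsFlow (codeSign (k a)) :=
  primrecPred_isFlow hg (primrec_codeSign (hk.comp Primrec.fst) Primrec.snd)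

lemma primrecPred_isNonzero {k : α → ℕ} (hg : Primrec g) (hk : Primrec k) :
    PrimrecPred fun a => (g a).IsNonzero (k a) :=
  primrecPred_exists_lt (ListGraph.primrec_size.comp hg)
    (primrecPred_codeSign_ne_zero (hk.comp Primrec.fst) Primrec.snd)

lemma primrecPred_supportLe {k l : α → ℕ} (hg : Primrec g) (hk : Primrec k) (hl : Primrec l) :
    PrimrecPred fun a => (g a).SupportLe (k a) (l a) :=
  primrecPred_forall_lt (ListGraph.primrec_size.comp hg)
    (primrecPred_imp (primrecPred_codeSign_ne_zero (hk.comp Primrec.fst) Primrec.snd)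
      (primrecPred_codeSign_ne_zero (hl.comp Primrec.fst) Primrec.snd))

lemma primrec_codeBound (hg : Primrec g) : Primrec fun a => 3 ^ (g a).size :=
  (primrec_pow 3).comp (ListGraph.primrec_size.comp hg)

lemma primrecPred_isMinimalFlow {k : α → ℕ} (hg : Primrec g) (hk : Primrec k) :
    PrimrecPred fun a => (g a).IsMinimalFlow (k a) := by
  have hg' : Primrec fun q : α × ℕ => g q.1 := hg.comp Primrec.fst
  have hk' : Primrec fun q : α × ℕ => k q.1 := hk.comp Primrec.fst
  exact (primrecPred_isFlow_codeSign hg hk).and ((primrecPred_isNonzero hg hk).and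
    (primrecPred_forall_lt (primrec_codeBound hg)
      (primrecPred_imp (primrecPred_isFlow_codeSign hg' Primrec.snd)
        (primrecPred_imp (primrecPred_isNonzero hg' Primrec.snd)
          (primrecPred_imp (primrecPred_supportLe hg' Primrec.snd hk')
            (primrecPred_supportLe hg' hk' Primrec.snd))))))

lemma primrec_row {k : α → ℕ} (hg : Primrec g) (hk : Primrec k) :
    Primrec fun a => (g a).row (k a) :=
  Primrec.list_map (Primrec.list_range.comp (ListGraph.primrec_size.comp hg))
    (primrecPred_codeSign_ne_zero (hk.comp Primrec.fst) Primrec.snd).decide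

/-- A certificate: a directed multigraph, the coordinates of a basis of its flow lattice, the
coefficients of the flows with entries in `{-1, 0, 1}`, and the supports of its circuits. -/
abbrev Certificate := ListGraph × List (List ℤ) × List (List ℤ) × List (List Bool)

/-- The certificate is valid for the Gram matrix `A`. -/
structure IsCertificate (A : List (List ℤ)) (w : Certificate) : Prop where
  gram : ∀ i < A.length, ∀ j < A.length,
    entry A i j = ∑ e ∈ Finset.range w.1.size, entry w.2.1 i e * entry w.2.1 j e
  isFlow : ∀ i < A.length, w.1.IsFlow (entry w.2.1 i)
  -- The coefficients are supplied by the certificate, so that regularity is verified by bounded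
  -- quantifiers alone.
  generates : ∀ k < 3 ^ w.1.size, w.1.IsFlow (codeSign k) → ∀ e < w.1.size,
    ∑ i ∈ Finset.range A.length, entry w.2.2.1 k i * entry w.2.1 i e = codeSign k e
  ne_zero : ∀ e < w.1.size, ∃ i < A.length, entry w.2.1 i e ≠ 0
  sound : ∀ x < w.2.2.2.length, ∃ k < 3 ^ w.1.size, w.1.IsMinimalFlow k ∧
    w.2.2.2.getD x [] = w.1.row k
  complete : ∀ k < 3 ^ w.1.size, w.1.IsMinimalFlow k → ∃ x < w.2.2.2.length,
    w.2.2.2.getD x [] = w.1.row k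
  nodup : ∀ x < w.2.2.2.length, ∀ y < x, w.2.2.2.getD x [] ≠ w.2.2.2.getD y []

section

variable {A M T : α → List (List ℤ)} {X : α → List (List Bool)}

lemma primrec_entry_mul {L L' : α → List (List ℤ)} {i j i' j' : α → ℕ} (hL : Primrec L)
    (hL' : Primrec L') (hi : Primrec i) (hj : Primrec j) (hi' : Primrec i') (hj' : Primrec j') :
    Primrec fun a => entry (L a) (i a) (j a) * entry (L' a) (i' a) (j' a) :=
  primrec_int_mul.comp (primrec_entry hL hi hj) (primrec_entry hL' hi' hj')

lemma primrecPred_gram (hA : Primrec A) (hg : Primrec g) (hM : Primrec M) :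
    PrimrecPred fun a => ∀ i < (A a).length, ∀ j < (A a).length, entry (A a) i j =
      ∑ e ∈ Finset.range (g a).size, entry (M a) i e * entry (M a) j e := by
  refine primrecPred_forall_lt (Primrec.list_length.comp hA) ?_
  refine primrecPred_forall_lt (Primrec.list_length.comp (hA.comp Primrec.fst)) ?_
  refine primrecPred_eq (primrec_entry (hA.comp (Primrec.fst.comp Primrec.fst))
    (Primrec.snd.comp Primrec.fst) Primrec.snd) ?_
  refine primrec_sum_range
    (ListGraph.primrec_size.comp (hg.comp (Primrec.fst.comp Primrec.fst))) ?_
  have hM' : Primrec fun q : ((α × ℕ) × ℕ) × ℕ => M q.1.1.1 :=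
    hM.comp (Primrec.fst.comp (Primrec.fst.comp Primrec.fst))
  exact primrec_entry_mul hM' hM' (Primrec.snd.comp (Primrec.fst.comp Primrec.fst)) Primrec.snd
    (Primrec.snd.comp Primrec.fst) Primrec.snd

lemma primrecPred_rows_isFlow (hA : Primrec A) (hg : Primrec g) (hM : Primrec M) :
    PrimrecPred fun a => ∀ i < (A a).length, (g a).IsFlow (entry (M a) i) := by
  refine primrecPred_forall_lt (Primrec.list_length.comp hA) ?_
  refine primrecPred_isFlow (hg.comp Primrec.fst) ?_
  exact primrec_entry (hM.comp (Primrec.fst.comp Primrec.fst)) (Primrec.snd.comp Primrec.fst)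
    Primrec.snd

lemma primrecPred_generates (hA : Primrec A) (hg : Primrec g) (hM : Primrec M) (hT : Primrec T) :
    PrimrecPred fun a => ∀ k < 3 ^ (g a).size, (g a).IsFlow (codeSign k) → ∀ e < (g a).size,
      ∑ i ∈ Finset.range (A a).length, entry (T a) k i * entry (M a) i e = codeSign k e := by
  refine primrecPred_forall_lt (primrec_codeBound hg) ?_
  refine primrecPred_imp (primrecPred_isFlow_codeSign (hg.comp Primrec.fst) Primrec.snd) ?_
  refine primrecPred_forall_lt (ListGraph.primrec_size.comp (hg.comp Primrec.fst)) ?_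
  refine primrecPred_eq (primrec_sum_range
    (Primrec.list_length.comp (hA.comp (Primrec.fst.comp Primrec.fst))) ?_)
    (primrec_codeSign (Primrec.snd.comp Primrec.fst) Primrec.snd)
  have h3 : Primrec fun q : ((α × ℕ) × ℕ) × ℕ => q.1.1.1 :=
    Primrec.fst.comp (Primrec.fst.comp Primrec.fst)
  exact primrec_entry_mul (hT.comp h3) (hM.comp h3)
    (Primrec.snd.comp (Primrec.fst.comp Primrec.fst)) Primrec.snd Primrec.snd
    (Primrec.snd.comp Primrec.fst)

lemma primrecPred_columns_ne_zero (hA : Primrec A) (hg : Primrec g) (hM : Primrec M) :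
    PrimrecPred fun a => ∀ e < (g a).size, ∃ i < (A a).length, entry (M a) i e ≠ 0 := by
  refine primrecPred_forall_lt (ListGraph.primrec_size.comp hg) ?_
  refine primrecPred_exists_lt (Primrec.list_length.comp (hA.comp Primrec.fst)) ?_
  exact (primrecPred_eq (primrec_entry (hM.comp (Primrec.fst.comp Primrec.fst)) Primrec.snd
    (Primrec.snd.comp Primrec.fst)) (Primrec.const 0)).not

lemma primrecPred_getD_eq_row {x k : α → ℕ} (hX : Primrec X) (hg : Primrec g) (hx : Primrec x)
    (hk : Primrec k) : PrimrecPred fun a => (X a).getD (x a) [] = (g a).row (k a) :=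
  primrecPred_eq ((Primrec.list_getD []).comp hX hx) (primrec_row hg hk)

lemma primrecPred_sound (hg : Primrec g) (hX : Primrec X) :
    PrimrecPred fun a => ∀ x < (X a).length, ∃ k < 3 ^ (g a).size, (g a).IsMinimalFlow k ∧
      (X a).getD x [] = (g a).row k := by
  refine primrecPred_forall_lt (Primrec.list_length.comp hX) ?_
  refine primrecPred_exists_lt (primrec_codeBound (hg.comp Primrec.fst)) ?_
  have hg' : Primrec fun q : (α × ℕ) × ℕ => g q.1.1 := hg.comp (Primrec.fst.comp Primrec.fst)
  exact (primrecPred_isMinimalFlow hg' Primrec.snd).and (primrecPred_getD_eq_row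
    (hX.comp (Primrec.fst.comp Primrec.fst)) hg' (Primrec.snd.comp Primrec.fst) Primrec.snd)

lemma primrecPred_complete (hg : Primrec g) (hX : Primrec X) :
    PrimrecPred fun a => ∀ k < 3 ^ (g a).size, (g a).IsMinimalFlow k → ∃ x < (X a).length,
      (X a).getD x [] = (g a).row k := by
  refine primrecPred_forall_lt (primrec_codeBound hg) ?_
  refine primrecPred_imp (primrecPred_isMinimalFlow (hg.comp Primrec.fst) Primrec.snd) ?_
  refine primrecPred_exists_lt (Primrec.list_length.comp (hX.comp Primrec.fst)) ?_
  exact primrecPred_getD_eq_row (hX.comp (Primrec.fst.comp Primrec.fst))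
    (hg.comp (Primrec.fst.comp Primrec.fst)) Primrec.snd (Primrec.snd.comp Primrec.fst)

lemma primrecPred_nodup (hX : Primrec X) : PrimrecPred fun a => ∀ x < (X a).length, ∀ y < x,
    (X a).getD x [] ≠ (X a).getD y [] := by
  refine primrecPred_forall_lt (Primrec.list_length.comp hX) ?_
  refine primrecPred_forall_lt Primrec.snd ?_
  have hX' : Primrec fun q : (α × ℕ) × ℕ => X q.1.1 := hX.comp (Primrec.fst.comp Primrec.fst)
  exact (primrecPred_eq ((Primrec.list_getD []).comp hX' (Primrec.snd.comp Primrec.fst))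
    ((Primrec.list_getD []).comp hX' Primrec.snd)).not

theorem primrecPred_isCertificate {w : α → Certificate} (hA : Primrec A) (hw : Primrec w) :
    PrimrecPred fun a => IsCertificate (A a) (w a) := by
  have hg : Primrec fun a => (w a).1 := Primrec.fst.comp hw
  have hM : Primrec fun a => (w a).2.1 := Primrec.fst.comp (Primrec.snd.comp hw)
  have hT : Primrec fun a => (w a).2.2.1 :=
    Primrec.fst.comp (Primrec.snd.comp (Primrec.snd.comp hw))
  have hX : Primrec fun a => (w a).2.2.2 :=
    Primrec.snd.comp (Primrec.snd.comp (Primrec.snd.comp hw))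
  refine ((primrecPred_gram hA hg hM).and ((primrecPred_rows_isFlow hA hg hM).and
    ((primrecPred_generates hA hg hM hT).and ((primrecPred_columns_ne_zero hA hg hM).and
    ((primrecPred_sound hg hX).and ((primrecPred_complete hg hX).and
    (primrecPred_nodup hX))))))).of_eq fun a => ?_
  exact ⟨fun ⟨a, b, c, d, e, f, g⟩ => ⟨a, b, c, d, e, f, g⟩,
    fun ⟨a, b, c, d, e, f, g⟩ => ⟨a, b, c, d, e, f, g⟩⟩

end

open Classical in
/-- The search for a valid certificate, which puts out its list of circuits. -/
noncomputable def reconstruct (A : List (List ℤ)) : Part (List (List Bool)) :=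
  Nat.rfindOpt fun n => (Encodable.decode (α := Certificate) n).bind fun w =>
    if IsCertificate A w then some w.2.2.2 else none

theorem partrec_reconstruct : Partrec (reconstruct : List (List ℤ) →. List (List Bool)) := by
  apply Partrec.rfindOpt
  apply Primrec.to_comp
  refine Primrec.option_bind (Primrec.decode.comp .snd) ?_
  classical
  exact Primrec.ite (primrecPred_isCertificate (Primrec.fst.comp Primrec.fst) Primrec.snd)
    (Primrec.option_some.comp (.comp .snd (.comp .snd (.comp .snd .snd)))) (.const none)

theorem exists_of_mem_reconstruct {A : List (List ℤ)} {X : List (List Bool)}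
    (hX : X ∈ reconstruct A) : ∃ w, IsCertificate A w ∧ w.2.2.2 = X := by
  obtain ⟨n, hn⟩ := Nat.rfindOpt_spec hX
  simp only [Option.mem_def, Option.bind_eq_some_iff] at hn
  obtain ⟨w, -, hw⟩ := hn
  split_ifs at hw with h
  exact ⟨w, h, Option.some.inj hw⟩

/-- This gives termination only: the search may stop at a certificate other than `w`, so correctness
has to hold for every valid one. -/
theorem exists_mem_reconstruct {A : List (List ℤ)} {w : Certificate} (hw : IsCertificate A w) :
    ∃ X, X ∈ reconstruct A := by
  apply Part.dom_iff_mem.mp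
  rw [reconstruct, Nat.rfindOpt_dom]
  exact ⟨Encodable.encode w, w.2.2.2, by simp [hw]⟩

end Primitive


section Certificates

/-! ### Valid certificates determine the matroid -/

lemma abs_codeSign_le (k e : ℕ) : |codeSign k e| ≤ 1 := by
  rw [codeSign]
  split_ifs <;> simp

lemma exists_codeSign_eq {m : ℕ} (a : Fin m → ℤ) (ha : ∀ e, |a e| ≤ 1) :
    ∃ k < 3 ^ m, ∀ e : Fin m, codeSign k e = a e := by
  -- The digit `2` codes the sign `-1`.
  let d : Fin m → Fin 3 := fun e => if a e = 1 then 1 else if a e = -1 then 2 else 0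
  refine ⟨finFunctionFinEquiv d, Fin.is_lt _, fun e => ?_⟩
  have h1 : ((finFunctionFinEquiv d : Fin (3 ^ m)) : ℕ) / 3 ^ (e : ℕ) % 3 = d e := by
    conv_rhs => rw [← finFunctionFinEquiv.symm_apply_apply d]
    rfl
  rw [codeSign, h1]
  have h2 := abs_le.mp (ha e)
  obtain h | h | h : a e = -1 ∨ a e = 0 ∨ a e = 1 := by omega
  all_goals simp [d, h]

variable {E : Type*} [Fintype E] {r : ℕ} {B : Matrix (Fin r) E ℤ}

/-- The rows of a matrix as a list. -/
def matrixList {m n : ℕ} (F : Matrix (Fin m) (Fin n) ℤ) : List (List ℤ) :=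
  List.ofFn fun i => List.ofFn (F i)

lemma entry_matrixList {m n : ℕ} (F : Matrix (Fin m) (Fin n) ℤ) (i : Fin m) (j : Fin n) :
    entry (matrixList F) i j = F i j := by
  simp [entry, matrixList, List.getD_eq_getElem?_getD]

lemma length_matrixList {m n : ℕ} (F : Matrix (Fin m) (Fin n) ℤ) : (matrixList F).length = m := by
  simp [matrixList]

lemma ListGraph.row_eq (g : ListGraph) (k : ℕ) :
    g.row k = List.ofFn fun e : Fin g.size => decide (codeSign k e ≠ 0) := by
  apply List.ext_getElem <;> simp [ListGraph.row]

lemma ListGraph.inflow_eq (g : ListGraph) (s : ℕ → ℤ) (x : ℕ) : g.inflow s x =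
    boundary (fun e : Fin g.size => g.tail e) (fun e => g.head e) (fun e => s e) x := by
  classical
  rw [ListGraph.inflow, Finset.sum_range, boundary]
  refine Finset.sum_congr rfl fun e _ => ?_
  split_ifs <;> simp

lemma ListGraph.isFlow_iff (g : ListGraph) (s : ℕ → ℤ) : g.IsFlow s ↔
    IsCirculation (fun e : Fin g.size => g.tail e) (fun e => g.head e) (fun e => s e) := by
  classical
  constructor
  · intro h x
    rw [← g.inflow_eq]
    by_cases hx : ∃ e < g.size, g.head e = x ∨ g.tail e = x
    · obtain ⟨e, he, rfl | rfl⟩ := hx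
      · exact (h e he).1
      · exact (h e he).2
    · push Not at hx
      refine Finset.sum_eq_zero fun e he => ?_
      have := hx e (Finset.mem_range.mp he)
      rw [if_neg this.1, if_neg this.2, add_zero, mul_zero]
  · intro h e _
    rw [g.inflow_eq, g.inflow_eq]
    exact ⟨h _, h _⟩

-- Being elementary depends only on the absolute values of the coordinates, not on their order or
-- signs.
omit [Fintype E] in
lemma IsElementary.exists_of_abs_coord_eq {E' : Type*} {B' : Matrix (Fin r) E' ℤ} {σ : E' ≃ E}
    (hσ : ∀ e z, |coord B z (σ e)| = |coord B' z e|) {v : Fin r → ℤ} :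
    IsElementary B' v ↔ IsElementary B v := by
  have hint : ∀ e (u : Fin r → ℤ), |(u ᵥ* B) (σ e)| = |(u ᵥ* B') e| := by
    intro e u
    have := hσ e (toReal u)
    rw [coord_toReal, coord_toReal] at this
    exact_mod_cast this
  have hzero : ∀ e z, coord B z (σ e) = 0 ↔ coord B' z e = 0 := by
    intro e z
    rw [← abs_eq_zero, hσ, abs_eq_zero]
  have hsign : IsSignVector B' v ↔ IsSignVector B v := by
    rw [IsSignVector, IsSignVector, ← σ.forall_congr_right]
    simp only [hint]
  have hsupp : supportSpace B' (toReal v) = supportSpace B (toReal v) := by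
    ext y
    rw [mem_supportSpace, mem_supportSpace, ← σ.forall_congr_right]
    simp only [hzero]
  constructor
  · rintro ⟨h1, h2, h3⟩
    exact ⟨h1, hsign.mp h2, fun y hy => h3 y (hsupp ▸ hy)⟩
  · rintro ⟨h1, h2, h3⟩
    exact ⟨h1, hsign.mpr h2, fun y hy => h3 y (hsupp ▸ hy)⟩

omit [Fintype E] in
/-- A sign vector is elementary if no sign vector has smaller support. -/
lemma IsRegular.isElementary_of_minimal (h : IsRegular B) {v : Fin r → ℤ} (hv0 : v ≠ 0)
    (hv : IsSignVector B v) (hmin : ∀ u, u ≠ 0 → IsSignVector B u →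
      (∀ e, (u ᵥ* B) e ≠ 0 → (v ᵥ* B) e ≠ 0) → ∀ e, (v ᵥ* B) e ≠ 0 → (u ᵥ* B) e ≠ 0) :
    IsElementary B v := by
  refine ⟨hv0, hv, fun y hy => ?_⟩
  obtain ⟨e, he⟩ : ∃ e, coord B (toReal v) e ≠ 0 := by
    by_contra hcon
    push Not at hcon
    exact toReal_ne_zero hv0 (h.inj _ (funext hcon))
  -- Subtract the multiple of `v` that kills the coordinate `e`. A nonzero remainder would dominate
  -- a sign vector supported inside the support of `v` but missing `e`.
  refine ⟨coord B y e / coord B (toReal v) e, ?_⟩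
  rw [← sub_eq_zero]
  by_contra hz
  obtain ⟨u, hu0, hus, huz⟩ := h.conformal _ hz
  have hsub : ∀ f, (u ᵥ* B) f ≠ 0 → (v ᵥ* B) f ≠ 0 := by
    intro f hf hvf
    have h1 : coord B (toReal v) f = 0 := by rw [coord_toReal, hvf, Int.cast_zero]
    have := huz f hf
    rw [map_sub, map_smul, Pi.sub_apply, Pi.smul_apply, h1, hy f h1] at this
    simp at this
  have hue := hmin u hu0 hus hsub e (by
    intro h0
    apply he
    rw [coord_toReal, h0, Int.cast_zero])
  have := huz e hue
  rw [map_sub, map_smul, Pi.sub_apply, Pi.smul_apply, smul_eq_mul, div_mul_cancel₀ _ he,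
    sub_self, mul_zero] at this
  exact lt_irrefl _ this

/-- The matrix of a certificate. -/
def certificateMatrix (r : ℕ) (w : Certificate) : Matrix (Fin r) (Fin w.1.size) ℤ :=
  fun i e => entry w.2.1 i e

variable {w : Certificate} (hw : IsCertificate (matrixList (B * Bᵀ)) w)

include hw

lemma IsCertificate.gram_eq : certificateMatrix r w * (certificateMatrix r w)ᵀ = B * Bᵀ := by
  ext i j
  have hi : (i : ℕ) < (matrixList (B * Bᵀ)).length := by rw [length_matrixList]; exact i.2
  have hj : (j : ℕ) < (matrixList (B * Bᵀ)).length := by rw [length_matrixList]; exact j.2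
  have := hw.gram i hi j hj
  rw [entry_matrixList, Finset.sum_range] at this
  rw [this, Matrix.mul_apply]
  rfl

lemma IsCertificate.exists_vecMul_eq {k : ℕ} (hk : k < 3 ^ w.1.size)
    (hf : w.1.IsFlow (codeSign k)) :
    ∃ u, ∀ e, (u ᵥ* certificateMatrix r w) e = codeSign k e := by
  refine ⟨fun i => entry w.2.2.1 k i, fun e => ?_⟩
  have := hw.generates k hk hf e e.2
  rw [length_matrixList, Finset.sum_range] at this
  exact this

lemma IsCertificate.isCirculation (i : Fin r) : IsCirculation (fun e : Fin w.1.size => w.1.tail e)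
    (fun e => w.1.head e) (certificateMatrix r w i) := by
  have := hw.isFlow i (by rw [length_matrixList]; exact i.2)
  rwa [ListGraph.isFlow_iff] at this

/-- Independence of the rows is not part of the certificate; it follows from definiteness of the
common Gram matrix. -/
lemma IsCertificate.isRegular (h : IsRegular B) : IsRegular (certificateMatrix r w) := by
  refine isRegular_of_circulations (fun z hz => ?_) hw.isCirculation (fun a ha hc => ?_)
    fun d => ?_
  · apply h.eq_zero_of_form
    rw [gramForm_eq, ← hw.gram_eq, ← gramForm_eq, gramForm_apply, hz]
    simp
  · obtain ⟨k, hk, hka⟩ := exists_codeSign_eq a ha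
    obtain ⟨u, hu⟩ := hw.exists_vecMul_eq hk ((ListGraph.isFlow_iff _ _).mpr (by simpa only [hka]))
    exact ⟨u, funext fun e => (hu e).trans (hka e)⟩
  · obtain ⟨i, hi, hid⟩ := hw.ne_zero d d.2
    rw [length_matrixList] at hi
    exact ⟨⟨i, hi⟩, hid⟩

lemma IsCertificate.isFlow_of_vecMul_eq {u : Fin r → ℤ} {k : ℕ}
    (hu : ∀ e, (u ᵥ* certificateMatrix r w) e = codeSign k e) : w.1.IsFlow (codeSign k) := by
  rw [ListGraph.isFlow_iff, ← isCirculation_intCast_iff]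
  have := isCirculation_coord hw.isCirculation (toReal u)
  have h1 : coord (certificateMatrix r w) (toReal u) =
      fun e : Fin w.1.size => ((codeSign k e : ℤ) : ℝ) := by
    ext e
    rw [coord_toReal, hu]
  rwa [h1] at this

/-- Codes of flows correspond to sign vectors of the row lattice, and minimality among sign vectors
already makes a vector elementary. -/
lemma IsCertificate.isMinimalFlow_iff (h : IsRegular B) {k : ℕ} (hk : k < 3 ^ w.1.size) :
    w.1.IsMinimalFlow k ↔ ∃ v, IsElementary (certificateMatrix r w) v ∧
      ∀ e, (v ᵥ* certificateMatrix r w) e = codeSign k e := by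
  have hreg := hw.isRegular h
  have hne : ∀ (u : Fin r → ℤ) (l : ℕ), (∀ e, (u ᵥ* certificateMatrix r w) e = codeSign l e) →
      (w.1.IsNonzero l ↔ u ≠ 0) := by
    intro u l hu
    constructor
    · rintro ⟨e, he, hle⟩ rfl
      apply hle
      rw [← hu ⟨e, he⟩]; simp
    · intro hu0
      by_contra hcon
      apply toReal_ne_zero hu0
      apply hreg.inj
      ext e
      rw [coord_toReal, hu]
      by_contra hne
      exact hcon ⟨e, e.2, fun h0 => hne (by rw [h0]; simp)⟩
  constructor
  · rintro ⟨hf, hnz, hmin⟩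
    obtain ⟨v, hv⟩ := hw.exists_vecMul_eq hk hf
    refine ⟨v, hreg.isElementary_of_minimal ((hne v k hv).mp hnz)
      (fun e => by rw [hv]; exact abs_codeSign_le _ _) fun u hu0 hus hsub e he => ?_, hv⟩
    obtain ⟨l, hl, hlu⟩ := exists_codeSign_eq (u ᵥ* certificateMatrix r w) hus
    have hul : ∀ e, (u ᵥ* certificateMatrix r w) e = codeSign l e := fun e => (hlu e).symm
    rw [hul]
    refine hmin l hl (hw.isFlow_of_vecMul_eq hul) ((hne u l hul).mpr hu0) (fun d hd hld => ?_)
      e e.2 (hv e ▸ he)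
    rw [← hv ⟨d, hd⟩]
    exact hsub ⟨d, hd⟩ (by rw [hul]; exact hld)
  · rintro ⟨v, hv, hvk⟩
    refine ⟨hw.isFlow_of_vecMul_eq hvk, (hne v k hvk).mpr hv.ne_zero, fun l hl hlf hln hlk e he => ?_⟩
    obtain ⟨u, hu⟩ := hw.exists_vecMul_eq hl hlf
    obtain ⟨t, ht⟩ := hv.eq_smul (toReal u) (fun d hd => by
      rw [coord_toReal, hvk, Int.cast_eq_zero] at hd
      rw [coord_toReal, hu, Int.cast_eq_zero]
      by_contra hne
      exact hlk d d.2 hne hd)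
    have ht0 : t ≠ 0 := by
      rintro rfl
      rw [zero_smul] at ht
      exact toReal_ne_zero ((hne u l hu).mp hln) ht
    intro hke hle
    apply hke
    have h1 : coord (certificateMatrix r w) (toReal u) ⟨e, he⟩ =
        t * coord (certificateMatrix r w) (toReal v) ⟨e, he⟩ := by
      rw [ht, map_smul]; rfl
    rw [coord_toReal, coord_toReal, hu, hvk, hle, Int.cast_zero, eq_comm, mul_eq_zero,
      or_iff_right ht0] at h1
    exact_mod_cast h1

-- The graph of the certificate need not be `G`. The columns match up to order and sign, which
-- preserves elementary vectors and supports. `sound` turns rows into circuits, `complete` gives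
-- surjectivity and `nodup` injectivity.
omit hw in
theorem IsCertificate.isMatroidMatrix {α β : Type*} {G : Graph α β} [Fintype E(G)]
    {o : Orientation G} {b : Module.Basis (Fin r) ℤ (flowLattice o)} (hG : TwoEdgeConnected G)
    (hw : IsCertificate (matrixList (flowMatrix b * (flowMatrix b)ᵀ)) w) :
    IsMatroidMatrix G w.2.2.2 := by
  classical
  have h := isRegular_flowMatrix (b := b) hG
  obtain ⟨σ, hσ⟩ := (hw.isRegular h).exists_equiv_of_gram_eq h hw.gram_eq
  have habs : ∀ e (v : Fin r → ℤ), (v ᵥ* flowMatrix b) (σ e) ≠ 0 ↔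
      (v ᵥ* certificateMatrix r w) e ≠ 0 := by
    intro e v
    have := hσ e (toReal v)
    rw [coord_toReal, coord_toReal] at this
    have h1 : |(v ᵥ* flowMatrix b) (σ e)| = |(v ᵥ* certificateMatrix r w) e| := by
      exact_mod_cast this
    rw [← abs_ne_zero, h1, abs_ne_zero]
  have hrows : ∀ x : Fin w.2.2.2.length, ∃ C : {C : Set E(G) // IsCircuit G C},
      w.2.2.2.get x = List.ofFn fun j => decide (σ j ∈ C.1) := by
    intro x
    obtain ⟨k, hk, hkm, hkx⟩ := hw.sound x x.2
    obtain ⟨v, hv, hvk⟩ := (hw.isMinimalFlow_iff h hk).mp hkm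
    refine ⟨⟨edgeSupport (flowOf b v), (isCircuit_iff hG _).mpr
      ⟨v, (IsElementary.exists_of_abs_coord_eq hσ).mp hv, rfl⟩⟩, ?_⟩
    rw [List.getD_eq_getElem _ _ x.2, ListGraph.row_eq] at hkx
    refine hkx.trans (congrArg List.ofFn (funext fun e => ?_))
    have hmem : σ e ∈ edgeSupport (flowOf b v) ↔ (v ᵥ* flowMatrix b) (σ e) ≠ 0 := by
      rw [flowOf_eq]; rfl
    rw [decide_eq_decide, hmem, habs, hvk]
  choose C hC using hrows
  refine ⟨w.1.size, σ, Equiv.ofBijective C ⟨fun x y hxy => ?_, fun D => ?_⟩, fun i => ?_⟩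
  · have heq : w.2.2.2.get x = w.2.2.2.get y := by rw [hC x, hC y, hxy]
    by_contra hne
    wlog hlt : y < x generalizing x y
    · exact this y x hxy.symm heq.symm (Ne.symm hne) (lt_of_le_of_ne (not_lt.mp hlt) hne)
    refine hw.nodup x x.2 y hlt ?_
    rw [List.getD_eq_getElem _ _ x.2, List.getD_eq_getElem _ _ y.2]
    exact heq
  · obtain ⟨v, hv, hvD⟩ := (isCircuit_iff (b := b) hG D.1).mp D.2
    have hv' := (IsElementary.exists_of_abs_coord_eq hσ).mpr hv
    obtain ⟨k, hk, hkv⟩ := exists_codeSign_eq _ hv'.sign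
    obtain ⟨x, hx, hxk⟩ := hw.complete k hk
      ((hw.isMinimalFlow_iff h hk).mpr ⟨v, hv', fun e => (hkv e).symm⟩)
    refine ⟨⟨x, hx⟩, Subtype.ext (Set.ext fun d => ?_)⟩
    have h1 := hC ⟨x, hx⟩
    rw [List.getD_eq_getElem _ _ hx, ListGraph.row_eq] at hxk
    rw [List.get_eq_getElem] at h1
    simp only at h1
    rw [hxk, List.ofFn_injective.eq_iff, funext_iff] at h1
    have h2 := h1 (σ.symm d)
    rw [decide_eq_decide, hkv, σ.apply_symm_apply, ← habs, σ.apply_symm_apply] at h2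
    rw [← h2, hvD, flowOf_eq]
    rfl
  · exact (hC i).trans (congrArg List.ofFn (funext fun j => by congr!))

omit hw in
/-- Every Gram matrix of a lattice of circulations has a certificate. -/
theorem exists_isCertificate {α : Type*} {tail head : E → α}
    (hB : ∀ i, IsCirculation tail head (B i))
    (hgen : ∀ a : E → ℤ, IsCirculation tail head a → ∃ u, u ᵥ* B = a)
    (hcol : ∀ d, ∃ i, B i d ≠ 0) : ∃ w, IsCertificate (matrixList (B * Bᵀ)) w := by
  classical
  let ε := Fintype.equivFin E
  set m := Fintype.card E
  -- Only the finitely many endpoints of edges need numbers as vertices.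
  obtain ⟨c, hc⟩ := Set.countable_iff_exists_injOn.mp
    (Set.toFinite (Set.range head ∪ Set.range tail)).countable
  have hhead : ∀ e, head e ∈ Set.range head ∪ Set.range tail := fun e => Or.inl ⟨e, rfl⟩
  have htail : ∀ e, tail e ∈ Set.range head ∪ Set.range tail := fun e => Or.inr ⟨e, rfl⟩
  let g : ListGraph := (m, List.ofFn fun i => c (tail (ε.symm i)),
    List.ofFn fun i => c (head (ε.symm i)))
  have hgt : ∀ i : Fin m, g.tail i = c (tail (ε.symm i)) := by
    intro i
    simp [g, ListGraph.tail, List.getD_eq_getElem?_getD]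
  have hgh : ∀ i : Fin m, g.head i = c (head (ε.symm i)) := by
    intro i
    simp [g, ListGraph.head, List.getD_eq_getElem?_getD]
  have hinflow : ∀ (s : ℕ → ℤ) y, y ∈ Set.range head ∪ Set.range tail →
      g.inflow s (c y) = boundary tail head (fun e => s (ε e)) y := by
    intro s y hy
    rw [ListGraph.inflow, Finset.sum_range, boundary]
    change (∑ i : Fin m, s i * ((if g.head i = c y then 1 else 0) +
      if g.tail i = c y then -1 else 0)) = _
    rw [← Equiv.sum_comp ε]
    refine Finset.sum_congr rfl fun e _ => ?_
    rw [hgt, hgh, ε.symm_apply_apply]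
    simp only [hc.eq_iff (hhead e) hy, hc.eq_iff (htail e) hy]
    split_ifs <;> simp
  have hflow : ∀ s : ℕ → ℤ, g.IsFlow s ↔ IsCirculation tail head fun e => s (ε e) := by
    intro s
    constructor
    · intro hs x
      by_cases hx : x ∈ Set.range head ∪ Set.range tail
      · rw [← hinflow s x hx]
        rcases hx with ⟨e, rfl⟩ | ⟨e, rfl⟩
        · have := (hs (ε e) (ε e).2).1
          rwa [hgh, ε.symm_apply_apply] at this
        · have := (hs (ε e) (ε e).2).2
          rwa [hgt, ε.symm_apply_apply] at this
      · refine Finset.sum_eq_zero fun e _ => ?_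
        rw [if_neg (fun he => hx (Or.inl ⟨e, he⟩)), if_neg (fun he => hx (Or.inr ⟨e, he⟩)),
          sub_zero, mul_zero]
    · intro hs e he
      have h1 := hgh ⟨e, he⟩
      have h2 := hgt ⟨e, he⟩
      simp only at h1 h2
      rw [h1, h2, hinflow _ _ (hhead _), hinflow _ _ (htail _)]
      exact ⟨hs _, hs _⟩
  have hcoef : ∀ k : Fin (3 ^ m), ∃ u : Fin r → ℤ, g.IsFlow (codeSign k) →
      u ᵥ* B = fun e => codeSign k (ε e) := by
    intro k
    by_cases hk : g.IsFlow (codeSign k)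
    · obtain ⟨u, hu⟩ := hgen _ ((hflow _).mp hk)
      exact ⟨u, fun _ => hu⟩
    · exact ⟨0, fun h => absurd h hk⟩
  choose u₀ hu using hcoef
  let u : Matrix (Fin (3 ^ m)) (Fin r) ℤ := u₀
  -- A circuit and its reverse have the same support; taking the image as a finset removes the
  -- repetition.
  let X : List (List Bool) := (((Finset.range (3 ^ m)).filter g.IsMinimalFlow).image g.row).toList
  have hX : ∀ l, l ∈ X ↔ ∃ k < 3 ^ m, g.IsMinimalFlow k ∧ l = g.row k := by
    intro l
    simp only [X, Finset.mem_toList, Finset.mem_image, Finset.mem_filter, Finset.mem_range]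
    constructor
    · rintro ⟨k, ⟨h1, h2⟩, h3⟩; exact ⟨k, h1, h2, h3.symm⟩
    · rintro ⟨k, h1, h2, h3⟩; exact ⟨k, ⟨h1, h2⟩, h3.symm⟩
  let M : Matrix (Fin r) (Fin m) ℤ := fun i j => B i (ε.symm j)
  refine ⟨(g, matrixList M, matrixList u, X), ?_⟩
  constructor
  · intro i hi j hj
    rw [length_matrixList] at hi hj
    rw [entry_matrixList _ ⟨i, hi⟩ ⟨j, hj⟩, Matrix.mul_apply, ← Equiv.sum_comp ε.symm,
      Finset.sum_range]
    refine Finset.sum_congr rfl fun e _ => ?_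
    rw [entry_matrixList M ⟨i, hi⟩ e, entry_matrixList M ⟨j, hj⟩ e]
    rfl
  · intro i hi
    rw [length_matrixList] at hi
    rw [hflow]
    have h1 : (fun e => entry (matrixList M) i (ε e)) = B ⟨i, hi⟩ := by
      ext e
      rw [entry_matrixList M ⟨i, hi⟩ (ε e)]
      simp [M]
    rw [h1]
    exact hB _
  · intro k hk hkf e he
    rw [length_matrixList, Finset.sum_range]
    have h1 := congrFun (hu ⟨k, hk⟩ hkf) (ε.symm ⟨e, he⟩)
    rw [ε.apply_symm_apply] at h1
    refine Eq.trans (Finset.sum_congr rfl fun i _ => ?_) h1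
    rw [entry_matrixList u ⟨k, hk⟩ i, entry_matrixList M i ⟨e, he⟩]
  · intro e he
    obtain ⟨i, hi⟩ := hcol (ε.symm ⟨e, he⟩)
    refine ⟨i, by rw [length_matrixList]; exact i.2, ?_⟩
    rw [entry_matrixList M i ⟨e, he⟩]
    exact hi
  · intro x hx
    rw [List.getD_eq_getElem _ _ hx]
    exact (hX _).mp (List.getElem_mem hx)
  · intro k hk hkm
    obtain ⟨x, hx, hxk⟩ := List.getElem_of_mem ((hX _).mpr ⟨k, hk, hkm, rfl⟩)
    exact ⟨x, hx, by rw [List.getD_eq_getElem _ _ hx, hxk]⟩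
  · intro x hx y hy heq
    rw [List.getD_eq_getElem _ _ hx, List.getD_eq_getElem _ _ (hy.trans hx)] at heq
    exact hy.ne' ((Finset.nodup_toList _).getElem_inj_iff.mp heq)

end Certificates

end FlowRecon

/-! ### Assembly of the theorem -/

open FlowRecon
theorem theorem3 :
    ∃ compute : List (List ℤ) →. List (List Bool), Partrec compute ∧
    ∀ (α β : Type*) (G : Graph α β) [Fintype E(G)] (o : FlowRecon.Orientation G) (r : ℕ)
      (b : Module.Basis (Fin r) ℤ (flowLattice o)), TwoEdgeConnected G →
    -- the matroid is computable from the Gram matrix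
    (∃ X ∈ compute (List.ofFn fun i => List.ofFn (gramMatrix b i)), IsMatroidMatrix G X) ∧
    -- the list of facets, and its correspondence with the oriented circuits
    {F | IsFacet (gramMatrix b) F}.Finite ∧
    (∀ F, IsFacet (gramMatrix b) F → ∃! v, F = bisectorFace (gramMatrix b) v) ∧
    (∀ v, IsFacet (gramMatrix b) (bisectorFace (gramMatrix b) v) ↔
      IsCircuitElement o (flowOf b v)) ∧
    -- the choice of a good circuit basis
    (∃ C, IsGoodBasis (gramMatrix b) C) ∧
    (∀ C, IsGoodBasis (gramMatrix b) C → IsCancellationFree o fun i => flowOf b (C i)) ∧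
    -- the list of edges of the Voronoi cell; their parallel classes index the 2-cut blocks
    Finite (VoronoiEdge (gramMatrix b)) ∧
    ∃ S : EdgeClass (gramMatrix b) → Set E(G),
      Function.Injective S ∧ Set.range S = {B | IsTwoCutBlock G B} ∧
      -- for every choice of a good basis
      ∀ C, IsGoodBasis (gramMatrix b) C →
        -- the linear system has a unique positive integer solution,
        (∃! n, IsSolution (gramMatrix b) C n) ∧
        ∀ n, IsSolution (gramMatrix b) C n →
          -- which gives the sizes of the 2-cut blocks,
          (∀ c, (S c).ncard = n c) ∧
          ∃ σ : E(G) ≃ GroundSet (gramMatrix b) n,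
            -- the edge set is the disjoint union of the blocks,
            (∀ e c, e ∈ S c ↔ (σ e).1 = c) ∧
            -- an edge is in a circuit iff its class does not participate in the facet,
            (∀ v, IsCircuitElement o (flowOf b v) → ∀ e, e ∈ edgeSupport (flowOf b v) ↔
              ¬ Participates (σ e).1 (bisectorFace (gramMatrix b) v)) ∧
            -- and the output is the graphic matroid of the graph
            ∀ X : Set E(G), IsCircuit G X ↔ IsOutputCircuit (gramMatrix b) n (σ '' X) := by
  classical
  refine ⟨reconstruct, partrec_reconstruct, fun α β G _ o r b hG => ?_⟩
  have h := isRegular_flowMatrix (b := b) hG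
  have hcirc := isElementary_iff_isCircuitElement (b := b) hG
  refine ⟨?_, ?_⟩
  · rw [gramMatrix_eq]
    have hcol : ∀ d, ∃ i, flowMatrix b i d ≠ 0 := by
      intro d
      by_contra hcon
      push Not at hcon
      obtain ⟨z, hz⟩ := h.col_ne d
      exact hz (by simp [coord_apply, hcon])
    obtain ⟨w, hw⟩ := exists_isCertificate (isCirculation_flowMatrix (b := b))
      (fun a ha => exists_vecMul_eq ha) hcol
    obtain ⟨X, hX⟩ := exists_mem_reconstruct hw
    obtain ⟨w', hw', rfl⟩ := exists_of_mem_reconstruct hX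
    exact ⟨_, hX, IsCertificate.isMatroidMatrix hG hw'⟩
  rw [gramMatrix_eq]
  refine ⟨h.finite_isFace.subset fun F hF => hF.1, fun F hF => h.existsUnique_of_isFacet hF,
    fun v => (h.isFacet_bisectorFace_iff v).trans (hcirc v), h.exists_isGoodBasis,
    fun C hC => ⟨fun i => (hcirc _).mp (h.isElementary_of_isGoodBasis hC i), fun i j => ?_⟩,
    h.finite_voronoiEdge, h.classEdges, fun c c' hcc => ?_, ?_, fun C hC => ?_⟩
  · have h1 := h.abs_latticeForm_of_isGoodBasis hC i j
    rw [latticeForm_gram] at h1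
    simp only [pairing, flowOf_eq]
    rw [h1, ← Finset.sum_filter, Finset.sum_const, nsmul_eq_mul, mul_one, ← Set.ncard_coe_finset]
    congr 2
    ext e
    simp [edgeSupport]
  · obtain ⟨e, he⟩ := h.classEdges_nonempty c
    exact h.eq_of_mem_classEdges he (hcc ▸ he)
  · have hblock : ∀ c e, e ∈ h.classEdges c →
        h.classEdges c = {f | e = f ∨ IsTwoCut G e f} := by
      intro c e he
      ext f
      rw [h.mem_classEdges_iff he, parallelCoords_iff hG]
      rfl
    ext S
    constructor
    · rintro ⟨c, rfl⟩
      obtain ⟨e, he⟩ := h.classEdges_nonempty c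
      exact ⟨e, hblock c e he⟩
    · rintro ⟨e, rfl⟩
      exact ⟨_, hblock _ e (h.mem_classEdges_classOf e)⟩
  · have hsol := h.isSolution_ncard hC
    refine ⟨⟨_, hsol, fun n hn => h.isSolution_unique hC hn hsol⟩, fun n hn => ?_⟩
    -- By uniqueness every solution is the family of class sizes, so it suffices to treat that one.
    obtain rfl := h.isSolution_unique hC hn hsol
    refine ⟨fun c => rfl, ?_⟩
    have hfib : ∀ c, Nonempty ({e // h.classOf e = c} ≃ Fin (h.classEdges c).ncard) := by
      intro c
      refine ⟨(Equiv.subtypeEquivRight fun e =>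
        (h.mem_classEdges_iff_classOf e c).symm).trans (Finite.equivFinOfCardEq ?_)⟩
      rfl
    let τ := fun c => (hfib c).some
    -- Each edge lies in exactly one class, so `E(G)` splits into the fibres of `h.classOf`, each of
    -- which is enumerated arbitrarily.
    let σ : E(G) ≃ GroundSet (flowMatrix b * (flowMatrix b)ᵀ) fun c => (h.classEdges c).ncard :=
      (Equiv.sigmaFiberEquiv h.classOf).symm.trans (Equiv.sigmaCongrRight τ)
    have hσ : ∀ e, (σ e).1 = h.classOf e := fun e => rfl
    have hpart : ∀ v, IsElementary (flowMatrix b) v → ∀ e, e ∈ edgeSupport (flowOf b v) ↔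
        ¬ Participates (σ e).1 (bisectorFace (flowMatrix b * (flowMatrix b)ᵀ) v) := by
      intro v hv e
      rw [hσ, h.not_participates_iff hv.sign (h.mem_classEdges_classOf e), flowOf_eq]
      rfl
    refine ⟨σ, fun e c => by rw [hσ, h.mem_classEdges_iff_classOf],
      fun v hv => hpart v ((hcirc v).mpr hv), fun X => ?_⟩
    have himage : ∀ v, IsElementary (flowMatrix b) v → (X = edgeSupport (flowOf b v) ↔
        σ '' X = {p | ¬ Participates p.1 (bisectorFace (flowMatrix b * (flowMatrix b)ᵀ) v)}) := by
      intro v hv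
      rw [Set.ext_iff, Set.ext_iff, ← σ.forall_congr_right]
      refine forall_congr' fun e => ?_
      rw [σ.injective.mem_set_image, hpart v hv e]
      rfl
    rw [isCircuit_iff (b := b) hG]
    constructor
    · rintro ⟨v, hv, hX⟩
      exact ⟨_, h.isFacet_of_isElementary hv, (himage v hv).mp hX⟩
    · rintro ⟨F, hF, hX⟩
      obtain ⟨v, hv, rfl⟩ := h.exists_isElementary_of_isFacet hF
      exact ⟨v, hv, (himage v hv).mpr hX⟩
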